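/- Let $n\in\{2,3\}$, let $\Gamma$ be a non-empty bounded relatively open subset of the hyperplane $\{\mathbf x\in\mathbb R^n: x_n=0\}$, identified with an open subset of $\mathbb R^{n-1}$, and let $k>0$. For $s\in\mathbb R$ let $\mathcal J_k^s=\mathcal F^{-1}(k^2+|\boldsymbol\xi|^2)^{s/2}\mathcal F$ on tempered distributions, let $H^s(\mathbb R^{n-1})$ be the space of tempered distributions $u$ with $\mathcal J_k^su\in L^2(\mathbb R^{n-1})$, normed by $\|u\|_{H^s_k}=\|\mathcal J_k^su\|_{L^2}$, let $\tilde H^s(\Gamma)$ be the closure of $C_0^\infty(\Gamma)$ in $H^s(\mathbb R^{n-1})$, with the same norm (written $\|\cdot\|_{\tilde H^s_k(\Gamma)}$), and let $H^s(\Gamma)$ be the space of restrictions to $\Gamma$ of elements of $H^s(\mathbb R^{n-1})$. The pairing of $u\in H^{1/2}(\Gamma)$ with $\psi\in\tilde H^{-1/2}(\Gamma)$ is $\langle u,\psi\rangle_{H^{1/2}(\Gamma)\times\tilde H^{-1/2}(\Gamma)}=(\mathcal J_k^{1/2}U,\mathcal J_k^{-1/2}\psi)_{L^2(\mathbb R^{n-1})}$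 (the extension of $\int u\bar\psi$), where $U\in H^{1/2}(\mathbb R^{n-1})$ is any extension of $u$. Let $\Phi(\mathbf x,\mathbf y)=\dfrac{e^{ik|\mathbf x-\mathbf y|}}{4\pi|\mathbf x-\mathbf y|}$ if $n=3$ and $\Phi(\mathbf x,\mathbf y)=\dfrac i4H_0^{(1)}(k|\mathbf x-\mathbf y|)$ if $n=2$. For $\phi\in\tilde H^{-1/2}(\Gamma)$ let $\mathcal S_k\phi$ be the single-layer potential: for $\mathbf x\notin\overline\Gamma$, $\mathcal S_k\phi(\mathbf x)$ is the value of the distribution $\phi$ on the trace on $\{x_n=0\}$ of $\rho\,\Phi(\mathbf x,\cdot)$, where $\rho\in C_0^\infty(\mathbb R^n)$ is any function equal to $1$ in a neighbourhood of $\Gamma$ with $\mathbf x\notin\operatorname{supp}\rho$ (so $\mathcal S_k\phi(\mathbf x)=\int_\Gamma\Phi(\mathbf x,\mathbf y)\phi(\mathbf y)\,ds(\mathbf y)$ if $\phi\in C_0^\infty(\Gamma)$). Let $S_k\phi=\gamma^\pm(\chi\,\mathcal S_k\phi)|_\Gamma\in H^{1/2}(\Gamma)$, where $\gamma^\pm$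 are the Dirichlet traces on $\{x_n=0\}$ from the half-spaces $\{\pm x_n>0\}$ of functions in $W^1$ there, $\chi\in C_0^\infty(\mathbb R^n)$ is any function equal to $1$ in a neighbourhood of $\Gamma$, and either trace may be taken. Then $S_k\phi$ is well defined for every $\phi\in\tilde H^{-1/2}(\Gamma)$, and the sesquilinear form $$a(\phi,\psi):=\langle S_k\phi,\psi\rangle_{H^{1/2}(\Gamma)\times\tilde H^{-1/2}(\Gamma)},\qquad \phi,\psi\in\tilde H^{-1/2}(\Gamma),$$ satisfies $$|a(\phi,\phi)|\ \ge\ \frac1{2\sqrt2}\,\|\phi\|^2_{\tilde H^{-1/2}_k(\Gamma)}\qquad\text{for all }\phi\in\tilde H^{-1/2}(\Gamma).$$ -/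

import Mathlib

open MeasureTheory FourierTransform TemperedDistribution Topology
open scoped SchwartzMap ContDiff

noncomputable section

/-! ### Bessel potential spaces on `ℝᵈ` with wavenumber-dependent norm -/

/-- The hyperplane `ℝᵈ`, with its Euclidean norm. -/
abbrev Plane (d : ℕ) : Type := EuclideanSpace ℝ (Fin d)

/-- The Bessel potential operator `J_k^s = F⁻¹ (k² + |ξ|²)^{s/2} F` on tempered distributions.
Mathlib's Fourier transform uses the frequency variable `x` with `ξ = 2πx`, so that the symbol
`(k² + |ξ|²)^{s/2}` becomes `(k² + (2π|x|)²)^{s/2}`. -/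
def besselJ {d : ℕ} (k s : ℝ) : 𝓢'(Plane d, ℂ) →L[ℂ] 𝓢'(Plane d, ℂ) :=
  fourierMultiplierCLM ℂ
    (fun x : Plane d ↦ (((k ^ 2 + (2 * Real.pi * ‖x‖) ^ 2) ^ (s / 2) : ℝ) : ℂ))

/-- The standard embedding of `L²(ℝᵈ)` into the tempered distributions. -/
def iotaL2 (d : ℕ) : Lp ℂ 2 (volume : Measure (Plane d)) →ₗ[ℂ] 𝓢'(Plane d, ℂ) :=
  (Lp.toTemperedDistributionCLM ℂ (volume : Measure (Plane d)) 2).toLinearMap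

lemma iotaL2_injective (d : ℕ) : Function.Injective (iotaL2 d) :=
  LinearMap.ker_eq_bot.mp Lp.ker_toTemperedDistributionCLM_eq_bot

/-- The Sobolev space `H^s(ℝᵈ)` of all tempered distributions `u` with `J_k^s u ∈ L²(ℝᵈ)`. -/
def sobolev (d : ℕ) (k s : ℝ) : Submodule ℂ 𝓢'(Plane d, ℂ) :=
  (LinearMap.range (iotaL2 d)).comap (besselJ k s).toLinearMap

/-- The map `u ↦ J_k^s u`, from `H^s(ℝᵈ)` to `L²(ℝᵈ)`. -/
def sobolevRep {d : ℕ} {k s : ℝ} :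
    sobolev d k s →ₗ[ℂ] Lp ℂ 2 (volume : Measure (Plane d)) :=
  (LinearEquiv.ofInjective (iotaL2 d) (iotaL2_injective d)).symm.toLinearMap ∘ₗ
    (besselJ k s).toLinearMap.restrict (fun _ hu ↦ hu)

lemma iotaL2_sobolevRep {d : ℕ} {k s : ℝ} (u : sobolev d k s) :
    iotaL2 d (sobolevRep u) = besselJ k s (u : 𝓢'(Plane d, ℂ)) :=
  congrArg Subtype.val ((LinearEquiv.ofInjective (iotaL2 d) (iotaL2_injective d)).apply_symm_apply
    ((besselJ k s).toLinearMap.restrict (fun _ hu ↦ hu) u))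

/-- The norm `‖u‖_{H^s_k} = ‖J_k^s u‖_{L²}`. -/
def sobolevNorm {d : ℕ} {k s : ℝ} (u : sobolev d k s) : ℝ := ‖sobolevRep u‖

/-- The duality pairing of `H^s(ℝᵈ)` and `H^{-s}(ℝᵈ)`, the extension of `∫ u v̄`:
`⟨u, v⟩ = (J_k^s u, J_k^{-s} v)_{L²}`, linear in `u` and antilinear in `v`.
(Mathlib's inner product is antilinear in its first argument.) -/
def dualPairing {d : ℕ} {k s : ℝ} (u : sobolev d k s) (v : sobolev d k (-s)) : ℂ :=
  inner ℂ (sobolevRep v) (sobolevRep u)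

/-- The space `𝒟(Γ)` of smooth functions with compact support contained in `Γ`. -/
def testFunctions {d : ℕ} (Γ : Set (Plane d)) : Submodule ℂ 𝓢(Plane d, ℂ) where
  carrier := {φ | HasCompactSupport φ ∧ tsupport φ ⊆ Γ}
  add_mem' {φ ψ} hφ hψ :=
    ⟨hφ.1.add hψ.1, (tsupport_add φ ψ).trans (Set.union_subset hφ.2 hψ.2)⟩
  zero_mem' := ⟨HasCompactSupport.zero, by simp⟩
  smul_mem' c φ hφ :=
    ⟨hφ.1.smul_left (f := fun _ ↦ c), (tsupport_smul_subset_right (fun _ ↦ c) φ).trans hφ.2⟩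

/-- The elements of `H^s(ℝᵈ)` that are given by functions in `𝒟(Γ)`. -/
def testSobolev {d : ℕ} (k s : ℝ) (Γ : Set (Plane d)) : Submodule ℂ (sobolev d k s) :=
  ((testFunctions Γ).map
    (SchwartzMap.toTemperedDistributionCLM (Plane d) ℂ volume).toLinearMap).comap
      (sobolev d k s).subtype

/-- `H̃^s(Γ)`, the closure of `𝒟(Γ)` in `H^s(ℝᵈ)` for the norm `‖J_k^s u‖_{L²}`. -/
def sobolevTilde {d : ℕ} (k s : ℝ) (Γ : Set (Plane d)) : Submodule ℂ (sobolev d k s) :=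
  ((testSobolev k s Γ).map sobolevRep).topologicalClosure.comap sobolevRep

/-- Equality of the restrictions to `Γ` of two distributions: `u|_Γ = v|_Γ`. -/
def EqOnScreen {d : ℕ} (Γ : Set (Plane d)) (u v : 𝓢'(Plane d, ℂ)) : Prop :=
  ∀ ψ ∈ testFunctions Γ, u ψ = v ψ

/-! ### The space `ℝⁿ = ℝᵈ × ℝ`, `n = d + 1`, half-spaces, and traces

A point of `ℝⁿ` is written `(x̃, xₙ)`. The norm of the product type is not used. -/

/-- The screen `Γ × {0}` as a subset of `ℝⁿ`. -/
def screen {d : ℕ} (Γ : Set (Plane d)) : Set (Plane d × ℝ) := Γ ×ˢ {0}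

/-- The half-space `U⁺` (for `σ = 1`) or `U⁻` (for `σ = -1`). -/
def halfSpace (d : ℕ) (σ : ℤˣ) : Set (Plane d × ℝ) := {x | 0 < ((σ : ℤ) : ℝ) * x.2}

/-- `𝒟(V)`, for a set `V ⊆ ℝⁿ`. -/
def IsTest {d : ℕ} (V : Set (Plane d × ℝ)) (θ : Plane d × ℝ → ℂ) : Prop :=
  ContDiff ℝ ∞ θ ∧ HasCompactSupport θ ∧ tsupport θ ⊆ V

/-- `𝒟_{1,Γ}(ℝⁿ)`: test functions that equal `1` in some neighbourhood of the screen. -/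
def IsCutoff {d : ℕ} (Γ : Set (Plane d)) (χ : Plane d × ℝ → ℂ) : Prop :=
  IsTest Set.univ χ ∧ ∀ᶠ x in 𝓝ˢ (screen Γ), χ x = 1

/-- `G` is the weak gradient of `u` in the open set `V`; `G x v` is the derivative in
direction `v`. -/
def IsWeakGradient {d : ℕ} (V : Set (Plane d × ℝ)) (u : Plane d × ℝ → ℂ)
    (G : Plane d × ℝ → (Plane d × ℝ →L[ℝ] ℂ)) : Prop :=
  ∀ θ, IsTest V θ → ∀ v : Plane d × ℝ,
    ∫ x in V, u x * fderiv ℝ θ x v = -∫ x in V, G x v * θ x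

/-- `u ∈ W¹(V)` with weak gradient `G`: both are in `L²(V)`. -/
def IsW1 {d : ℕ} (V : Set (Plane d × ℝ)) (u : Plane d × ℝ → ℂ)
    (G : Plane d × ℝ → (Plane d × ℝ →L[ℝ] ℂ)) : Prop :=
  MemLp u 2 (volume.restrict V) ∧ MemLp G 2 (volume.restrict V) ∧ IsWeakGradient V u G

/-- `u ∈ W¹(U^σ)` and its Dirichlet trace `γ^σ u` on `xₙ = 0` is `g`. The trace is expressed by
the divergence theorem: for all `θ ∈ 𝒟(ℝⁿ)`, with boundary values `w = θ(·, 0)`,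
`∫_{U^σ} (u ∂ₙθ + (∂ₙu) θ) = -σ ∫_{ℝᵈ} (γ^σ u) w`. -/
def HasTrace {d : ℕ} (σ : ℤˣ) (u : Plane d × ℝ → ℂ) (g : 𝓢'(Plane d, ℂ)) : Prop :=
  ∃ G, IsW1 (halfSpace d σ) u G ∧
    ∀ θ, IsTest Set.univ θ → ∀ w : 𝓢(Plane d, ℂ), (∀ y, w y = θ (y, 0)) →
      ∫ x in halfSpace d σ, (u x * fderiv ℝ θ x (0, 1) + G x (0, 1) * θ x) =
        -((σ : ℤ) : ℂ) * g w

/-! ### The fundamental solution, the single-layer potential and the single-layer operator -/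

/-- The Hankel function `H₀⁽¹⁾(z)` for `z > 0`, by Hankel's (Poisson-type) integral
`H₀⁽¹⁾(z) = (2 / (π i)) e^{iz} ∫₀^∞ e^{-zs} (s² - 2is)^{-1/2} ds` with the principal branch
of the power. -/
def hankelH0 (z : ℝ) : ℂ :=
  2 / (Real.pi * Complex.I) * Complex.exp (Complex.I * z) *
    ∫ s in Set.Ioi (0 : ℝ),
      (Real.exp (-z * s) : ℂ) * ((s : ℂ) ^ 2 - 2 * Complex.I * s) ^ (-(1 / 2) : ℂ)

/-- The Euclidean distance in `ℝⁿ = ℝᵈ × ℝ`. -/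
def euclDist {d : ℕ} (x y : Plane d × ℝ) : ℝ :=
  Real.sqrt (‖x.1 - y.1‖ ^ 2 + (x.2 - y.2) ^ 2)

/-- The outgoing fundamental solution `Φ(x, y)` of the Helmholtz equation in `ℝ^{d+1}`,
for `d = 2` (i.e. `n = 3`) and for `d = 1` (i.e. `n = 2`). -/
def fundSol {d : ℕ} (k : ℝ) (x y : Plane d × ℝ) : ℂ :=
  if d = 2 then
    Complex.exp (Complex.I * k * euclDist x y) / (4 * Real.pi * euclDist x y)
  else
    Complex.I / 4 * hankelH0 (k * euclDist x y)

/-- `w` is the trace on `xₙ = 0` of `ρ Φ(x, ·) ∈ 𝒟(ℝⁿ)`, where `ρ ∈ 𝒟_{1,Γ}(ℝⁿ)` vanishes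
near `x`. -/
def IsKernelTrace {d : ℕ} (k : ℝ) (Γ : Set (Plane d)) (x : Plane d × ℝ)
    (w : 𝓢(Plane d, ℂ)) : Prop :=
  ∃ ρ, IsCutoff Γ ρ ∧ x ∉ tsupport ρ ∧ ∀ y, w y = ρ (y, 0) * fundSol k x (y, 0)

open Classical in
/-- The single-layer potential `𝒮_k φ (x) = ⟨γ^±(ρ Φ(x, ·)), φ̄⟩` for `x` off the closed screen.
Since the trace `w` is a Schwartz function, this pairing (the extension of `∫ w φ`) is the
action `φ w` of the distribution `φ` on `w`. The value does not depend on the choice of `ρ`; on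
the closed screen, where there is no such `ρ`, the value is set to `0`. -/
def singleLayerPotential {d : ℕ} (k : ℝ) (Γ : Set (Plane d)) (φ : 𝓢'(Plane d, ℂ))
    (x : Plane d × ℝ) : ℂ :=
  if h : ∃ w, IsKernelTrace k Γ x w then φ h.choose else 0

/-- `U ∈ H^{1/2}(ℝᵈ)` is an extension of `S_k φ ∈ H^{1/2}(Γ)`, that is, `U|_Γ = S_k φ`, where
`S_k φ = γ^±(χ 𝒮_k φ)|_Γ` for any `χ ∈ 𝒟_{1,Γ}(ℝⁿ)` and either of the traces. -/
def ExtendsSingleLayer {d : ℕ} (k : ℝ) (Γ : Set (Plane d)) (φ : 𝓢'(Plane d, ℂ))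
    (U : sobolev d k (1 / 2)) : Prop :=
  ∀ (σ : ℤˣ) (χ : Plane d × ℝ → ℂ), IsCutoff Γ χ →
    ∃ g : sobolev d k (1 / 2),
      HasTrace σ (fun x ↦ χ x * singleLayerPotential k Γ φ x) g ∧ EqOnScreen Γ U g

end

/-!
The proof is a computation on the Fourier side in the hyperplane. Let `μ(ξ)` (`outRoot`) be the root
of `|2πξ|² - k²` that is nonnegative for `2π|ξ| ≥ k` and equals `-i √(k² - |2πξ|²)` otherwise. The
Weyl representation `fundSol_eq_integral` writes the fundamental solution off the hyperplane as the
superposition of the plane waves `e^{2πi x̃·ξ - |xₙ| μ(ξ)}` with density `1 / (2μ)`. For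
`e^{-κr} / (4πr)` and `K₀(κr) / (2π)` with `κ > 0` it follows by integrating the heat kernel over
time (`weyl_real`); both sides are holomorphic for `Re κ > 0` (`weyl_damped`); and
`κ = ε - ik`, `ε → 0`, gives the outgoing solution (`weyl_outgoing`). Consequently the single-layer
potential of `φ` is the superposition of plane waves with density `φ̂ / (2μ)`
(`singleLayerPotential_eq`).

In general this density is not in a weighted `L²` space, since the square of `1/|μ|` is not integrable
near the sphere `2π|ξ| = k`. Boundedness of `Γ` helps: it makes `φ̂` locally bounded
(`exists_bound_fourierDensity`), so that `φ̂ / (2μ)` is integrable at low frequencies, whereas at high frequencies it has the decay of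
the Fourier transform of an `H^{1/2}` function (`IsWaveDensity`, `isWaveDensity_layerDensity`). Low
frequencies contribute a bounded function to the potential, and high frequencies, whose waves are
evanescent, a function in `L²(ℝⁿ)`, by Plancherel's theorem in each plane parallel to the hyperplane
(`lintegral_wavePotential_sq_le`); the same applies to the formal derivatives. Integration by parts
for single plane waves and truncation in frequency show that these are the weak derivatives in both
half-spaces, and that both traces have the Fourier transform `φ̂ / (2μ)` (`integral_wavePotential_ibp`,
`hasTrace_mul_wavePotential`). After multiplication by a cutoff the traces are in `H^{1/2}(ℝᵈ)`, by
Peetre's and Young's inequalities (`exists_sobolev_mul`), and they are unique on test functions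
(`HasTrace.unique`). Hence `S_k φ` is well defined, and
`⟨S_k φ, ψ⟩ = ∫ φ̂ conj(ψ̂) / (2μ)` (`ExtendsSingleLayer.dualPairing_eq`).

Coercivity is read off from the symbol: `1 / (2μ)` is positive for `2π|ξ| > k` and `i` times a positive
number for `2π|ξ| < k`, and in both cases its modulus is at least `(k² + |2πξ|²)^{-1/2} / 2`. Real and
imaginary parts of `a(φ, φ)` therefore add up to at least `‖φ‖² / 2`, without cancellation, and
`√2 |a| ≥ Re a + Im a` (`sobolevNorm_sq_le_layerForm`).
-/

/-! ### One-dimensional integrals -/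

lemma integrable_cosh_mul_gaussian_sinh {c : ℝ} (hc : 0 < c) :
    Integrable (fun τ : ℝ ↦ Real.cosh (τ / 2) * Real.exp (-4 * c * Real.sinh (τ / 2) ^ 2)) ∧
    ∫ τ : ℝ, Real.cosh (τ / 2) * Real.exp (-4 * c * Real.sinh (τ / 2) ^ 2) =
      Real.sqrt (Real.pi / c) := by
  have himg : (fun τ : ℝ ↦ Real.sinh (τ / 2)) '' Set.univ = Set.univ := by
    rw [Set.image_univ, Set.range_eq_univ]
    intro y
    obtain ⟨x, hx⟩ := Real.sinh_surjective y
    exact ⟨2 * x, by simpa using hx⟩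
  have hder : ∀ τ ∈ Set.univ, HasDerivWithinAt (fun τ : ℝ ↦ Real.sinh (τ / 2))
      (Real.cosh (τ / 2) / 2) Set.univ τ := by
    intro τ _
    have := (Real.hasDerivAt_sinh (τ / 2)).comp τ ((hasDerivAt_id τ).div_const 2)
    exact (this.congr_deriv (by simp [div_eq_mul_inv])).hasDerivWithinAt
  have hinj : Set.InjOn (fun τ : ℝ ↦ Real.sinh (τ / 2)) Set.univ := by
    intro a _ b _ hab
    have := Real.sinh_injective hab
    linarith
  have habs : ∀ τ : ℝ, |Real.cosh (τ / 2) / 2| = Real.cosh (τ / 2) / 2 := fun τ ↦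
    abs_of_pos (by have := Real.cosh_pos (τ / 2); positivity)
  have hI := integrableOn_image_iff_integrableOn_abs_deriv_smul MeasurableSet.univ hder hinj
    (fun v ↦ Real.exp (-(4 * c) * v ^ 2))
  have hE := integral_image_eq_integral_abs_deriv_smul MeasurableSet.univ hder hinj
    (fun v ↦ Real.exp (-(4 * c) * v ^ 2))
  rw [himg] at hI hE
  simp only [habs, smul_eq_mul, integrableOn_univ, Measure.restrict_univ] at hI hE
  have hint := hI.1 (integrable_exp_neg_mul_sq (by positivity))
  rw [integral_gaussian] at hE
  have e : (fun τ : ℝ ↦ Real.cosh (τ / 2) * Real.exp (-4 * c * Real.sinh (τ / 2) ^ 2)) =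
      fun τ ↦ 2 * (Real.cosh (τ / 2) / 2 * Real.exp (-(4 * c) * Real.sinh (τ / 2) ^ 2)) := by
    funext τ; ring_nf
  rw [e]
  refine ⟨hint.const_mul 2, ?_⟩
  rw [integral_const_mul, ← hE]
  have : Real.pi / c = 2 ^ 2 * (Real.pi / (4 * c)) := by field_simp; norm_num
  rw [this, Real.sqrt_mul (by positivity), Real.sqrt_sq (by norm_num)]

lemma exp_neg_two_mul_cosh (c τ : ℝ) : Real.exp (-2 * c * Real.cosh τ) =
    Real.exp (-2 * c) * Real.exp (-4 * c * Real.sinh (τ / 2) ^ 2) := by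
  rw [← Real.exp_add]
  congr 1
  have h : Real.cosh τ = Real.cosh (τ / 2) ^ 2 + Real.sinh (τ / 2) ^ 2 := by
    rw [← Real.cosh_two_mul]; congr 1; ring
  rw [h, Real.cosh_sq]
  ring

/-- For `|p| ≤ 1/2` the integrand is dominated by the one that `integrable_cosh_mul_gaussian_sinh`
evaluates by the substitution `v = sinh (τ/2)`. -/
lemma integrable_exp_mul_exp_cosh {c : ℝ} (hc : 0 < c) {p : ℝ} (hp : |p| ≤ 1 / 2) :
    Integrable (fun τ : ℝ ↦ Real.exp (p * τ) * Real.exp (-2 * c * Real.cosh τ)) := by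
  have h := (integrable_cosh_mul_gaussian_sinh hc).1.const_mul (2 * Real.exp (-2 * c))
  refine h.mono' (by fun_prop) (Filter.Eventually.of_forall fun τ ↦ ?_)
  rw [exp_neg_two_mul_cosh, Real.norm_of_nonneg (by positivity)]
  have h1 : Real.exp (p * τ) ≤ 2 * Real.cosh (τ / 2) := by
    have h2 : p * τ ≤ |τ / 2| := by
      calc p * τ ≤ |p * τ| := le_abs_self _
        _ = |p| * |τ| := abs_mul _ _
        _ ≤ 1 / 2 * |τ| := by gcongr
        _ = |τ / 2| := by rw [abs_div, abs_two]; ring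
    calc Real.exp (p * τ) ≤ Real.exp |τ / 2| := Real.exp_le_exp.2 h2
      _ ≤ 2 * Real.cosh |τ / 2| := by
          rw [Real.cosh_eq]; have := Real.exp_pos (-|τ / 2|); linarith
      _ = _ := by rw [Real.cosh_abs]
  calc _ ≤ 2 * Real.cosh (τ / 2) * (Real.exp (-2 * c) *
        Real.exp (-4 * c * Real.sinh (τ / 2) ^ 2)) := by gcongr
    _ = _ := by ring

lemma integral_exp_half_mul_exp_cosh {c : ℝ} (hc : 0 < c) :
    ∫ τ : ℝ, Real.exp (1 / 2 * τ) * Real.exp (-2 * c * Real.cosh τ) =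
      Real.exp (-2 * c) * Real.sqrt (Real.pi / c) ∧
    ∫ τ : ℝ, Real.exp (-(1 / 2) * τ) * Real.exp (-2 * c * Real.cosh τ) =
      Real.exp (-2 * c) * Real.sqrt (Real.pi / c) := by
  have h1 := integrable_exp_mul_exp_cosh hc (p := 1 / 2) (by norm_num)
  have h2 := integrable_exp_mul_exp_cosh hc (p := -(1 / 2)) (by norm_num)
  have hsymm : ∫ τ : ℝ, Real.exp (-(1 / 2) * τ) * Real.exp (-2 * c * Real.cosh τ) =
      ∫ τ : ℝ, Real.exp (1 / 2 * τ) * Real.exp (-2 * c * Real.cosh τ) := by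
    rw [← integral_neg_eq_self]
    simp
  have hsum : (∫ τ : ℝ, Real.exp (1 / 2 * τ) * Real.exp (-2 * c * Real.cosh τ)) +
      ∫ τ : ℝ, Real.exp (-(1 / 2) * τ) * Real.exp (-2 * c * Real.cosh τ) =
      2 * (Real.exp (-2 * c) * Real.sqrt (Real.pi / c)) := by
    rw [← integral_add h1 h2, ← (integrable_cosh_mul_gaussian_sinh hc).2,
      ← integral_const_mul, ← integral_const_mul]
    congr 1
    funext τ
    rw [exp_neg_two_mul_cosh, Real.cosh_eq]
    ring_nf
  constructor <;> linarith

/-- The translation by `log (A/B) / 2` balances the two exponentials. -/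
lemma exp_translate {A B : ℝ} (hA : 0 < A) (hB : 0 < B) (p τ : ℝ) :
    Real.exp (p * (τ + Real.log (A / B) / 2)) *
      Real.exp (-A * Real.exp (-(τ + Real.log (A / B) / 2)) -
        B * Real.exp (τ + Real.log (A / B) / 2)) =
    (A / B) ^ (p / 2) * (Real.exp (p * τ) * Real.exp (-2 * Real.sqrt (A * B) * Real.cosh τ)) := by
  have hAB : 0 < A / B := by positivity
  have e1 : Real.exp (Real.log (A / B) / 2) = Real.sqrt (A / B) := by
    rw [Real.sqrt_eq_rpow, Real.rpow_def_of_pos hAB]; ring_nf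
  have sA := Real.mul_self_sqrt hA.le
  have sB := Real.mul_self_sqrt hB.le
  have pA := Real.sqrt_pos.2 hA
  have pB := Real.sqrt_pos.2 hB
  rw [Real.rpow_def_of_pos hAB, neg_add, Real.exp_add τ, Real.exp_add (-τ), e1, Real.exp_neg
    (Real.log (A / B) / 2), e1, Real.sqrt_div hA.le, Real.sqrt_mul hA.le, Real.cosh_eq,
    ← Real.exp_add, ← Real.exp_add, ← Real.exp_add]
  congr 1
  have : -A * (Real.exp (-τ) * (√A / √B)⁻¹) - B * (Real.exp τ * (√A / √B)) =
      -2 * (√A * √B) * ((Real.exp τ + Real.exp (-τ)) / 2) := by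
    have h1 : A * (√A / √B)⁻¹ = √A * √B := by
      rw [inv_div]; field_simp; nlinarith
    have h2 : B * (√A / √B) = √A * √B := by
      field_simp; nlinarith
    linear_combination (-Real.exp (-τ)) * h1 - Real.exp τ * h2
  rw [this]
  ring

lemma integrable_exp_bessel {A B : ℝ} (hA : 0 < A) (hB : 0 < B) {p : ℝ} (hp : |p| ≤ 1 / 2) :
    Integrable (fun τ : ℝ ↦ Real.exp (p * τ) *
      Real.exp (-A * Real.exp (-τ) - B * Real.exp τ)) := by
  have h := (integrable_exp_mul_exp_cosh (c := √(A * B)) (by positivity) hp).const_mul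
    ((A / B) ^ (p / 2))
  have h2 : Integrable (fun τ : ℝ ↦ (fun τ : ℝ ↦ Real.exp (p * τ) *
      Real.exp (-A * Real.exp (-τ) - B * Real.exp τ)) (τ + Real.log (A / B) / 2)) := by
    refine h.congr (Filter.Eventually.of_forall fun τ ↦ ?_)
    exact (exp_translate hA hB p τ).symm
  simpa using h2.comp_sub_right (Real.log (A / B) / 2)

lemma integral_exp_bessel {A B : ℝ} (hA : 0 < A) (hB : 0 < B) (p : ℝ) :
    ∫ τ : ℝ, Real.exp (p * τ) * Real.exp (-A * Real.exp (-τ) - B * Real.exp τ) =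
      (A / B) ^ (p / 2) *
        ∫ τ : ℝ, Real.exp (p * τ) * Real.exp (-2 * √(A * B) * Real.cosh τ) := by
  rw [← integral_add_right_eq_self _ (Real.log (A / B) / 2), ← integral_const_mul]
  simp_rw [exp_translate hA hB]

/-- The one-dimensional heat-kernel integral: `∫ e^{τ/2} exp(-(t²/4) e^{-τ} - m² e^τ) dτ`. -/
lemma integral_exp_bessel_half {t m : ℝ} (ht : 0 < t) (hm : 0 < m) :
    ∫ τ : ℝ, Real.exp (1 / 2 * τ) * Real.exp (-(t ^ 2 / 4) * Real.exp (-τ) - m ^ 2 * Real.exp τ) =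
      √Real.pi / m * Real.exp (-t * m) := by
  rw [integral_exp_bessel (by positivity) (by positivity)]
  have h : √(t ^ 2 / 4 * m ^ 2) = t * m / 2 := by
    rw [show t ^ 2 / 4 * m ^ 2 = (t * m / 2) ^ 2 by ring, Real.sqrt_sq (by positivity)]
  rw [h, (integral_exp_half_mul_exp_cosh (by positivity)).1]
  have h2 : (t ^ 2 / 4 / m ^ 2) ^ ((1 / 2 : ℝ) / 2) = √(t / (2 * m)) := by
    rw [show t ^ 2 / 4 / m ^ 2 = (t / (2 * m)) ^ (2 : ℝ) by
      rw [Real.rpow_two]; field_simp; ring, ← Real.rpow_mul (by positivity), Real.sqrt_eq_rpow]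
    norm_num
  rw [h2, show -2 * (t * m / 2) = -t * m by ring]
  have h3 : √(t / (2 * m)) * √(Real.pi / (t * m / 2)) = √Real.pi / m := by
    rw [← Real.sqrt_mul (by positivity), show t / (2 * m) * (Real.pi / (t * m / 2)) =
      Real.pi / m ^ 2 by field_simp, Real.sqrt_div Real.pi_pos.le, Real.sqrt_sq hm.le]
  linear_combination Real.exp (-t * m) * h3

lemma integral_exp_bessel_neg_half {r m : ℝ} (hr : 0 < r) (hm : 0 < m) :
    ∫ τ : ℝ, Real.exp (-(1 / 2) * τ) *
        Real.exp (-(r ^ 2 / 4) * Real.exp (-τ) - m ^ 2 * Real.exp τ) =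
      2 * √Real.pi / r * Real.exp (-r * m) := by
  rw [integral_exp_bessel (by positivity) (by positivity)]
  have h : √(r ^ 2 / 4 * m ^ 2) = r * m / 2 := by
    rw [show r ^ 2 / 4 * m ^ 2 = (r * m / 2) ^ 2 by ring, Real.sqrt_sq (by positivity)]
  rw [h, (integral_exp_half_mul_exp_cosh (by positivity)).2]
  have h2 : (r ^ 2 / 4 / m ^ 2) ^ (-(1 / 2 : ℝ) / 2) = √(2 * m / r) := by
    rw [show r ^ 2 / 4 / m ^ 2 = (2 * m / r) ^ (-2 : ℝ) by
      rw [Real.rpow_neg (by positivity), Real.rpow_two]; field_simp; ring,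
      ← Real.rpow_mul (by positivity), Real.sqrt_eq_rpow]
    norm_num
  rw [h2, show -2 * (r * m / 2) = -r * m by ring]
  have h3 : √(2 * m / r) * √(Real.pi / (r * m / 2)) = 2 * √Real.pi / r := by
    rw [← Real.sqrt_mul (by positivity), show 2 * m / r * (Real.pi / (r * m / 2)) =
      2 ^ 2 * Real.pi / r ^ 2 by field_simp, Real.sqrt_div (by positivity),
      Real.sqrt_sq hr.le, Real.sqrt_mul (by positivity), Real.sqrt_sq (by norm_num)]
  linear_combination Real.exp (-r * m) * h3

/-- Two integral representations of the Macdonald function `2 K₀(x)`, `x > 0`. -/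
lemma integral_exp_neg_mul_cosh {x : ℝ} (hx : 0 < x) :
    ∫ τ : ℝ, Real.exp (-x * Real.cosh τ) =
      2 * (Real.exp (-x) * ∫ u in Set.Ioi (0 : ℝ), Real.exp (-u) / √(u ^ 2 + 2 * x * u)) := by
  have himg : (fun τ : ℝ ↦ x * (Real.cosh τ - 1)) '' Set.Ioi 0 = Set.Ioi 0 := by
    ext u
    constructor
    · rintro ⟨τ, hτ, rfl⟩
      have : 1 < Real.cosh τ := Real.one_lt_cosh.2 (ne_of_gt hτ)
      exact mul_pos hx (by linarith)
    · intro hu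
      have hu' : 0 < u := hu
      have hy : 1 < u / x + 1 := by have : 0 < u / x := by positivity
                                    linarith
      refine ⟨Real.arsinh (√((u / x + 1) ^ 2 - 1)), ?_, ?_⟩
      · exact Real.arsinh_pos_iff.2 (Real.sqrt_pos.2 (by nlinarith))
      · have : Real.cosh (Real.arsinh (√((u / x + 1) ^ 2 - 1))) = u / x + 1 := by
          rw [Real.cosh_arsinh, Real.sq_sqrt (by nlinarith), add_sub_cancel,
            Real.sqrt_sq (by linarith)]
        simp only [this]
        field_simp
        ring
  have hder : ∀ τ ∈ Set.Ioi (0 : ℝ), HasDerivWithinAt (fun τ : ℝ ↦ x * (Real.cosh τ - 1))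
      (x * Real.sinh τ) (Set.Ioi 0) τ := fun τ _ ↦
    (((Real.hasDerivAt_cosh τ).sub_const 1).const_mul x).hasDerivWithinAt
  have hinj : Set.InjOn (fun τ : ℝ ↦ x * (Real.cosh τ - 1)) (Set.Ioi 0) := by
    intro a ha b hb hab
    have h := mul_left_cancel₀ hx.ne' hab
    exact (Real.cosh_strictMonoOn.injOn (Set.mem_Ici.2 (Set.mem_Ioi.1 ha).le)
      (Set.mem_Ici.2 (Set.mem_Ioi.1 hb).le) (by linarith))
  have hE := integral_image_eq_integral_abs_deriv_smul measurableSet_Ioi hder hinj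
    (fun u ↦ Real.exp (-u) / √(u ^ 2 + 2 * x * u))
  rw [himg] at hE
  rw [hE]
  have hcongr : ∫ τ in Set.Ioi (0 : ℝ), |x * Real.sinh τ| • (Real.exp (-(x * (Real.cosh τ - 1))) /
      √((x * (Real.cosh τ - 1)) ^ 2 + 2 * x * (x * (Real.cosh τ - 1)))) =
      ∫ τ in Set.Ioi (0 : ℝ), Real.exp x * Real.exp (-x * Real.cosh τ) := by
    refine setIntegral_congr_fun measurableSet_Ioi fun τ hτ ↦ ?_
    have hs : 0 < Real.sinh τ := Real.sinh_pos_iff.2 hτ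
    have h1 : (x * (Real.cosh τ - 1)) ^ 2 + 2 * x * (x * (Real.cosh τ - 1)) =
        (x * Real.sinh τ) ^ 2 := by
      have := Real.cosh_sq τ
      linear_combination x ^ 2 * this
    simp only [h1, Real.sqrt_sq (mul_pos hx hs).le, abs_of_pos (mul_pos hx hs), smul_eq_mul]
    rw [← Real.exp_add, mul_div_cancel₀ _ (mul_pos hx hs).ne']
    ring_nf
  rw [hcongr, integral_const_mul, ← mul_assoc (Real.exp (-x)), ← Real.exp_add, neg_add_cancel,
    Real.exp_zero, one_mul]
  have := integral_comp_abs (f := fun τ ↦ Real.exp (-x * Real.cosh τ))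
  simpa using this

/-- Holomorphy of a parametric integral whose integrand is holomorphic in the parameter and locally
dominated. -/
lemma differentiableOn_integral_of_locally_dominated {α : Type*} [MeasurableSpace α]
    {μ : Measure α} {D : Set ℂ} (hD : IsOpen D) {F : ℂ → α → ℂ}
    (hmeas : ∀ z ∈ D, AEStronglyMeasurable (F z) μ)
    (hdiff : ∀ᵐ a ∂μ, DifferentiableOn ℂ (F · a) D)
    (hbound : ∀ z ∈ D, ∃ r > 0, ∃ g : α → ℝ, Integrable g μ ∧
      ∀ᵐ a ∂μ, ∀ w ∈ D, dist w z < r → ‖F w a‖ ≤ g a) :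
    DifferentiableOn ℂ (fun z ↦ ∫ a, F z a ∂μ) D := by
  intro z hz
  obtain ⟨r, hr, g, hg, hle⟩ := hbound z hz
  obtain ⟨r', hr', hball⟩ := Metric.isOpen_iff.1 hD z hz
  set ρ := min r r' / 4 with hρ
  have hρ0 : 0 < ρ := by positivity
  have hρr : 4 * ρ ≤ r := by rw [hρ]; linarith [min_le_left r r']
  have hρr' : 4 * ρ ≤ r' := by rw [hρ]; linarith [min_le_right r r']
  have hmem : ∀ w, dist w z < 3 * ρ → w ∈ D := fun w hw ↦ hball (by
    rw [Metric.mem_ball]; linarith)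
  have hF'meas : AEStronglyMeasurable (fun a ↦ deriv (F · a) z) μ := by
    have hu : Filter.Tendsto (fun n : ℕ ↦ (ρ / (n + 1) : ℝ)) Filter.atTop (𝓝 0) :=
      tendsto_const_div_atTop_nhds_zero_nat ρ |>.comp (Filter.tendsto_add_atTop_nat 1) |>.congr
        (fun n ↦ by simp)
    have hu0 : ∀ n : ℕ, 0 < (ρ / (n + 1) : ℝ) := fun n ↦ by positivity
    have huρ : ∀ n : ℕ, (ρ / (n + 1) : ℝ) ≤ ρ := fun n ↦ by
      apply div_le_self hρ0.le; linarith [n.cast_nonneg (α := ℝ)]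
    refine aestronglyMeasurable_of_tendsto_ae Filter.atTop
      (f := fun (n : ℕ) a ↦ ((ρ / (n + 1) : ℝ) : ℂ)⁻¹ * (F (z + (ρ / (n + 1) : ℝ)) a - F z a)) ?_ ?_
    · intro n
      refine ((hmeas _ (hmem _ ?_)).sub (hmeas z hz)).const_mul _
      rw [dist_eq_norm, add_sub_cancel_left, Complex.norm_real, Real.norm_of_nonneg (hu0 n).le]
      linarith [huρ n]
    · filter_upwards [hdiff] with a ha
      have hd : HasDerivAt (F · a) (deriv (F · a) z) z :=
        ((ha z hz).differentiableAt (hD.mem_nhds hz)).hasDerivAt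
      have := hd.tendsto_slope_zero
      have hu' : Filter.Tendsto (fun n : ℕ ↦ ((ρ / (n + 1) : ℝ) : ℂ)) Filter.atTop (𝓝[≠] 0) := by
        rw [tendsto_nhdsWithin_iff]
        refine ⟨(Complex.continuous_ofReal.tendsto' 0 0 rfl).comp hu,
          Filter.Eventually.of_forall fun n ↦ ?_⟩
        exact Complex.ofReal_ne_zero.2 (hu0 n).ne'
      simpa [Function.comp_def] using this.comp hu'
  have hint : Integrable (F z) μ := hg.mono' (hmeas z hz) (by
    filter_upwards [hle] with a ha using ha z hz (by simpa using hr))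
  have key := hasDerivAt_integral_of_dominated_loc_of_deriv_le (μ := μ) (F := F)
    (F' := fun w a ↦ deriv (F · a) w) (x₀ := z) (s := Metric.ball z ρ)
    (bound := fun a ↦ g a / ρ) (Metric.ball_mem_nhds z hρ0)
    (Filter.eventually_of_mem (hD.mem_nhds hz) hmeas) hint hF'meas ?_ (hg.div_const ρ) ?_
  · exact key.2.differentiableAt.differentiableWithinAt
  · filter_upwards [hle, hdiff] with a ha hda w hw
    rw [Metric.mem_ball] at hw
    refine Complex.norm_deriv_le_of_forall_mem_sphere_norm_le hρ0 ?_ ?_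
    · refine DifferentiableOn.diffContOnCl (hda.mono ?_)
      intro y hy
      have hy' := Metric.closure_ball_subset_closedBall hy
      rw [Metric.mem_closedBall] at hy'
      exact hmem y (by linarith [dist_triangle y w z])
    · intro y hy
      rw [Metric.mem_sphere] at hy
      have : dist y z < 3 * ρ := by linarith [dist_triangle y w z]
      exact ha y (hmem y this) (by linarith)
  · filter_upwards [hdiff] with a ha w hw
    rw [Metric.mem_ball] at hw
    have hwD := hmem w (by linarith)
    exact ((ha w hwD).differentiableAt (hD.mem_nhds hwD)).hasDerivAt

/-! ### The square root of the Helmholtz symbol -/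

/-- The root `μ(ξ)` of `|2πξ|² - k²` for which `e^{-tμ}`, `t > 0`, is outgoing or decaying. It is
written with real square roots, which vanish at negative arguments, so that `μ ≥ 0` for
`|2πξ| ≥ k` and `μ = -i √(k² - |2πξ|²)` for `|2πξ| ≤ k`. -/
noncomputable def outRoot {d : ℕ} (k : ℝ) (ξ : Plane d) : ℂ :=
  (√((2 * Real.pi * ‖ξ‖) ^ 2 - k ^ 2) : ℂ) - Complex.I * (√(k ^ 2 - (2 * Real.pi * ‖ξ‖) ^ 2) : ℂ)

section outRoot
variable {d : ℕ} (k : ℝ) (ξ : Plane d)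

lemma outRoot_re : (outRoot k ξ).re = √((2 * Real.pi * ‖ξ‖) ^ 2 - k ^ 2) := by
  simp [outRoot]

lemma outRoot_im : (outRoot k ξ).im = -√(k ^ 2 - (2 * Real.pi * ‖ξ‖) ^ 2) := by
  simp [outRoot]

lemma outRoot_re_nonneg : 0 ≤ (outRoot k ξ).re := by
  rw [outRoot_re]; positivity

lemma continuous_outRoot : Continuous (fun ξ : Plane d ↦ outRoot k ξ) := by
  unfold outRoot; fun_prop

lemma norm_outRoot : ‖outRoot k ξ‖ = √|(2 * Real.pi * ‖ξ‖) ^ 2 - k ^ 2| := by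
  rw [Complex.norm_eq_sqrt_sq_add_sq, outRoot_re, outRoot_im]
  congr 1
  rcases le_total (k ^ 2) ((2 * Real.pi * ‖ξ‖) ^ 2) with h | h
  · rw [Real.sqrt_eq_zero_of_nonpos (sub_nonpos.2 h), Real.sq_sqrt (sub_nonneg.2 h),
      abs_of_nonneg (sub_nonneg.2 h)]
    ring
  · rw [Real.sqrt_eq_zero_of_nonpos (sub_nonpos.2 h), neg_sq, Real.sq_sqrt (sub_nonneg.2 h),
      abs_of_nonpos (sub_nonpos.2 h)]
    ring

lemma norm_exp_neg_mul_outRoot (t : ℝ) :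
    ‖Complex.exp (-(t : ℂ) * outRoot k ξ)‖ = Real.exp (-t * (outRoot k ξ).re) := by
  rw [Complex.norm_exp]; simp

end outRoot

lemma integrable_exp_neg_abs_div_sqrt {c : ℝ} (hc : 0 < c) :
    Integrable (fun x : ℝ ↦ Real.exp (-c * |x|) / √|x|) := by
  have h1 : IntegrableOn (fun x : ℝ ↦ Real.exp (-c * |x|) / √|x|) (Set.Ioi 0) := by
    have h := integrableOn_rpow_mul_exp_neg_mul_rpow (s := -(1 / 2)) (p := 1) (b := c)
      (by norm_num) one_pos hc
    refine h.congr_fun (fun x hx ↦ ?_) measurableSet_Ioi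
    have hx' : 0 < x := hx
    simp only [Real.rpow_one, abs_of_pos hx']
    rw [Real.rpow_neg hx'.le, ← Real.sqrt_eq_rpow]
    field_simp
  have h2 : IntegrableOn (fun x : ℝ ↦ Real.exp (-c * |x|) / √|x|) (Set.Iio 0) := by
    have := (Measure.measurePreserving_neg (volume : Measure ℝ)).integrableOn_comp_preimage
      (MeasurableEquiv.neg ℝ).measurableEmbedding
      (f := fun x : ℝ ↦ Real.exp (-c * |x|) / √|x|) (s := Set.Ioi 0)
    have h3 := this.2 h1
    simpa [Function.comp_def] using h3
  have h3 := (integrableOn_Iic_iff_integrableOn_Iio (by simp)).2 h2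
  rw [← integrableOn_univ, ← Set.Iic_union_Ioi (a := (0 : ℝ))]
  exact h3.union h1

lemma one_div_sqrt_abs_sq_sub_sq_le {k y : ℝ} (hk : 0 < k) (hy : 0 ≤ y) :
    1 / √|y ^ 2 - k ^ 2| ≤ 1 / √k * (1 / √|y - k|) := by
  rcases eq_or_ne y k with rfl | hne
  · simp
  · have h0 : 0 < |y - k| := abs_pos.2 (sub_ne_zero.2 hne)
    rw [one_div_mul_one_div,
      ← Real.sqrt_mul (by positivity)]
    rw [one_div_le_one_div (Real.sqrt_pos.2 ?_) (by positivity)]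
    · refine Real.sqrt_le_sqrt ?_
      rw [show y ^ 2 - k ^ 2 = (y - k) * (y + k) by ring, abs_mul, abs_of_nonneg (a := y + k)
        (by positivity)]
      rw [mul_comm]
      gcongr
      linarith
    · rw [show y ^ 2 - k ^ 2 = (y - k) * (y + k) by ring, abs_mul, abs_of_nonneg (a := y + k)
        (by positivity)]
      positivity

lemma abs_le_of_nonneg_sub {k y : ℝ} (hk : 0 < k) (hy : 0 ≤ y) :
    |y - k| - k ≤ √(y ^ 2 - k ^ 2) := by
  rcases le_total k y with h | h
  · rw [abs_of_nonneg (sub_nonneg.2 h)]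
    have : y - k ≤ √(y ^ 2 - k ^ 2) := by
      apply Real.le_sqrt_of_sq_le
      nlinarith
    linarith
  · rw [abs_of_nonpos (sub_nonpos.2 h)]
    linarith [Real.sqrt_nonneg (y ^ 2 - k ^ 2)]

lemma pow_le_mul_exp {c : ℝ} (hc : 0 < c) (n : ℕ) {x : ℝ} (hx : 0 ≤ x) :
    x ^ n ≤ n.factorial / c ^ n * Real.exp (c * x) := by
  have := Real.pow_div_factorial_le_exp (c * x) (by positivity) n
  rw [div_mul_eq_mul_div, le_div_iff₀ (by positivity)]
  rw [div_le_iff₀ (by positivity), mul_pow] at this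
  linarith

/-- The symbol of the single-layer potential at height `t > 0` is integrable with all its moments;
the singularity on the sphere `|2πξ| = k` is of order `1/2`. -/
lemma integrable_pow_mul_exp_neg_outRoot {d : ℕ} (hd : 0 < d) {k t : ℝ} (hk : 0 < k) (ht : 0 < t)
    (n : ℕ) : Integrable (fun ξ : Plane d ↦
      ‖ξ‖ ^ n * (Real.exp (-t * (outRoot k ξ).re) / ‖outRoot k ξ‖)) := by
  have : Nonempty (Fin d) := ⟨⟨0, hd⟩⟩
  have : Nontrivial (Plane d) := inferInstance
  simp_rw [outRoot_re, norm_outRoot]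
  refine (integrable_fun_norm_addHaar (volume : Measure (Plane d)) (f := fun r : ℝ ↦ r ^ n *
    (Real.exp (-t * √((2 * Real.pi * r) ^ 2 - k ^ 2)) / √|(2 * Real.pi * r) ^ 2 - k ^ 2|))).2 ?_
  rw [finrank_euclideanSpace_fin]
  set m := d - 1 + n with hm
  have hpi := Real.pi_pos
  set C : ℝ := m.factorial / (t * Real.pi) ^ m with hC
  have hC0 : 0 ≤ C := by positivity
  have hint : Integrable (fun r : ℝ ↦ C * Real.exp (t * k / 2 + t * k) * (1 / √k) *
      (Real.exp (-(t / 2) * |2 * Real.pi * r - k|) / √|2 * Real.pi * r - k|)) := by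
    refine Integrable.const_mul ?_ _
    have := (integrable_exp_neg_abs_div_sqrt (c := t / 2) (by positivity)).comp_sub_right k
    exact (this.comp_mul_left' (R := 2 * Real.pi) (by positivity))
  refine hint.integrableOn.mono' ?_ ?_
  · refine Measurable.aestronglyMeasurable ?_
    fun_prop
  · refine (ae_restrict_iff' measurableSet_Ioi).2 (Filter.Eventually.of_forall fun r hr ↦ ?_)
    have hr0 : 0 < r := hr
    rw [smul_eq_mul, ← mul_assoc, ← pow_add, ← hm, Real.norm_of_nonneg (by positivity)]
    have hy : 0 ≤ 2 * Real.pi * r := by positivity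
    have e1 : r ^ m ≤ C * Real.exp (t * Real.pi * r) := pow_le_mul_exp (by positivity) m hr0.le
    have e2 : Real.exp (t * Real.pi * r) ≤
        Real.exp (t * k / 2) * Real.exp (t / 2 * |2 * Real.pi * r - k|) := by
      rw [← Real.exp_add, Real.exp_le_exp]
      nlinarith [le_abs_self (2 * Real.pi * r - k)]
    have e3 : Real.exp (-t * √((2 * Real.pi * r) ^ 2 - k ^ 2)) ≤
        Real.exp (t * k) * Real.exp (-t * |2 * Real.pi * r - k|) := by
      rw [← Real.exp_add, Real.exp_le_exp]
      nlinarith [abs_le_of_nonneg_sub hk hy]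
    have e4 := one_div_sqrt_abs_sq_sub_sq_le hk hy
    calc r ^ m * (Real.exp (-t * √((2 * Real.pi * r) ^ 2 - k ^ 2)) /
          √|(2 * Real.pi * r) ^ 2 - k ^ 2|)
        = r ^ m * (Real.exp (-t * √((2 * Real.pi * r) ^ 2 - k ^ 2)) *
          (1 / √|(2 * Real.pi * r) ^ 2 - k ^ 2|)) := by rw [mul_one_div]
      _ ≤ (C * (Real.exp (t * k / 2) * Real.exp (t / 2 * |2 * Real.pi * r - k|))) *
          ((Real.exp (t * k) * Real.exp (-t * |2 * Real.pi * r - k|)) *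
          (1 / √k * (1 / √|2 * Real.pi * r - k|))) := by
          gcongr
          exact e1.trans (by gcongr)
      _ = C * (Real.exp (t * k / 2) * Real.exp (t * k)) * (1 / √k) *
          ((Real.exp (t / 2 * |2 * Real.pi * r - k|) * Real.exp (-t * |2 * Real.pi * r - k|)) /
            √|2 * Real.pi * r - k|) := by ring
      _ = _ := by rw [← Real.exp_add, ← Real.exp_add]; ring_nf

lemma ae_outRoot_ne_zero {d : ℕ} (hd : 0 < d) {k : ℝ} (hk : 0 < k) :
    ∀ᵐ ξ : Plane d, (2 * Real.pi * ‖ξ‖) ^ 2 ≠ k ^ 2 := by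
  have : Nonempty (Fin d) := ⟨⟨0, hd⟩⟩
  have h := Measure.addHaar_sphere (volume : Measure (Plane d)) 0 (k / (2 * Real.pi))
  rw [measure_eq_zero_iff_ae_notMem] at h
  filter_upwards [h] with ξ hξ heq
  apply hξ
  have := (sq_eq_sq₀ (by positivity) hk.le).1 heq
  rw [mem_sphere_zero_iff_norm, ← this]
  field_simp

/-! ### The principal square root -/

lemma sq_cpow_half (w : ℂ) : (w ^ (1 / 2 : ℂ)) ^ 2 = w := by
  simp

lemma cpow_half_re_nonneg (w : ℂ) : 0 ≤ (w ^ (1 / 2 : ℂ)).re := by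
  rcases eq_or_ne w 0 with rfl | hw
  · simp
  · rw [Complex.cpow_def_of_ne_zero hw, Complex.exp_re]
    have h : (Complex.log w * (1 / 2)).im = w.arg / 2 := by
      rw [one_div, ← Complex.log_im w]
      have : (Complex.log w * (2 : ℂ)⁻¹) = ((1 / 2 : ℝ) : ℂ) * Complex.log w := by
        push_cast; ring
      rw [this, Complex.im_ofReal_mul]; ring
    rw [h]
    refine mul_nonneg (Real.exp_nonneg _) (Real.cos_nonneg_of_mem_Icc ⟨?_, ?_⟩)
    · linarith [Complex.neg_pi_lt_arg w, Real.pi_pos]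
    · linarith [Complex.arg_le_pi w]

lemma norm_cpow_half (w : ℂ) : ‖w ^ (1 / 2 : ℂ)‖ = √‖w‖ := by
  rw [eq_comm, Real.sqrt_eq_iff_mul_self_eq (norm_nonneg _) (norm_nonneg _), ← norm_mul, ← sq,
    sq_cpow_half]

lemma sqrt_re_le_cpow_half_re (w : ℂ) : √w.re ≤ (w ^ (1 / 2 : ℂ)).re := by
  refine Real.sqrt_le_iff.2 ⟨cpow_half_re_nonneg w, ?_⟩
  have := congrArg Complex.re (sq_cpow_half w)
  rw [sq, Complex.mul_re] at this
  nlinarith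

/-- Below the branch cut the principal square root is given by a formula that is continuous up to
the cut. -/
lemma cpow_half_of_im_neg {w : ℂ} (hw : w.im < 0) :
    w ^ (1 / 2 : ℂ) = (√((‖w‖ + w.re) / 2) : ℂ) - Complex.I * (√((‖w‖ - w.re) / 2) : ℂ) := by
  set q := w ^ (1 / 2 : ℂ) with hq
  have h1 := congrArg Complex.re (sq_cpow_half w)
  have h2 := congrArg Complex.im (sq_cpow_half w)
  have h3 : q.re ^ 2 + q.im ^ 2 = ‖w‖ := by
    have := norm_cpow_half w
    rw [← hq] at this
    have h4 : ‖q‖ ^ 2 = ‖w‖ := by rw [this, Real.sq_sqrt (norm_nonneg _)]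
    rw [← h4, Complex.sq_norm, Complex.normSq_apply]; ring
  rw [← hq, sq] at h1 h2
  simp only [Complex.mul_re, Complex.mul_im] at h1 h2
  have hre : 0 ≤ q.re := cpow_half_re_nonneg w
  have him : q.im ≤ 0 := by nlinarith
  have e1 : √((‖w‖ + w.re) / 2) = q.re := by
    rw [← h3, ← h1, show (q.re ^ 2 + q.im ^ 2 + (q.re * q.re - q.im * q.im)) / 2 = q.re ^ 2 by ring,
      Real.sqrt_sq hre]
  have e2 : √((‖w‖ - w.re) / 2) = -q.im := by
    rw [← h3, ← h1, show (q.re ^ 2 + q.im ^ 2 - (q.re * q.re - q.im * q.im)) / 2 = (-q.im) ^ 2 by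
      ring, Real.sqrt_sq (by linarith)]
  rw [e1, e2]
  apply Complex.ext <;> simp

/-! ### The Weyl representation of the fundamental solution -/

lemma exp_mul_outgoing_eq_integral {t m : ℝ} (ht : 0 < t) (hm : 0 < m) :
    Real.exp (-t * m) / (2 * m) = 1 / (2 * √Real.pi) * ∫ τ : ℝ, Real.exp (1 / 2 * τ) *
      Real.exp (-(t ^ 2 / 4) * Real.exp (-τ) - m ^ 2 * Real.exp τ) := by
  rw [integral_exp_bessel_half ht hm]
  have : √Real.pi ≠ 0 := (Real.sqrt_pos.2 Real.pi_pos).ne'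
  field_simp

lemma gaussian_integral_plane {d : ℕ} (z : Plane d) (τ : ℝ) :
    ∫ ξ : Plane d, Complex.exp (2 * Real.pi * Complex.I * (inner ℝ z ξ : ℝ)) *
      (Real.exp (-((2 * Real.pi * ‖ξ‖) ^ 2) * Real.exp τ) : ℂ) =
    ((4 * Real.pi) ^ (-(d : ℝ) / 2) * (Real.exp (-(d : ℝ) / 2 * τ) *
      Real.exp (-(‖z‖ ^ 2 / 4) * Real.exp (-τ))) : ℝ) := by
  have hpi := Real.pi_pos
  have hb : 0 < ((4 * Real.pi ^ 2 * Real.exp τ : ℝ) : ℂ).re := by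
    rw [Complex.ofReal_re]; positivity
  have h := GaussianFourier.integral_cexp_neg_mul_sq_norm_add hb (2 * Real.pi * Complex.I) z
  have e : ∀ ξ : Plane d, Complex.exp (2 * Real.pi * Complex.I * (inner ℝ z ξ : ℝ)) *
      (Real.exp (-((2 * Real.pi * ‖ξ‖) ^ 2) * Real.exp τ) : ℂ) =
      Complex.exp (-((4 * Real.pi ^ 2 * Real.exp τ : ℝ) : ℂ) * ‖ξ‖ ^ 2 +
        2 * Real.pi * Complex.I * (inner ℝ z ξ : ℝ)) := by
    intro ξ
    rw [Complex.ofReal_exp, ← Complex.exp_add]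
    congr 1
    push_cast
    ring
  simp_rw [e]
  rw [h, finrank_euclideanSpace_fin]
  have e1 : ((Real.pi : ℂ) / ((4 * Real.pi ^ 2 * Real.exp τ : ℝ) : ℂ)) =
      (((4 * Real.pi * Real.exp τ)⁻¹ : ℝ) : ℂ) := by
    rw [← Complex.ofReal_div]
    congr 1
    field_simp
  have e2 : (2 * Real.pi * Complex.I) ^ 2 * (‖z‖ : ℂ) ^ 2 /
      (4 * ((4 * Real.pi ^ 2 * Real.exp τ : ℝ) : ℂ)) =
      ((-(‖z‖ ^ 2 / 4) * Real.exp (-τ) : ℝ) : ℂ) := by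
    rw [mul_pow, Complex.I_sq, Real.exp_neg]
    have h1 : (Real.pi : ℂ) ≠ 0 := by exact_mod_cast hpi.ne'
    have h2 : (Real.exp τ : ℂ) ≠ 0 := by exact_mod_cast (Real.exp_pos τ).ne'
    push_cast
    push_cast at h2
    field_simp
    ring
  have e3 : ((d : ℂ) / 2) = ((d / 2 : ℝ) : ℂ) := by push_cast; rfl
  rw [e1, e2, e3, ← Complex.ofReal_cpow (by positivity), ← Complex.ofReal_exp, ← Complex.ofReal_mul]
  congr 1
  rw [← mul_assoc]
  congr 1
  rw [Real.inv_rpow (by positivity), Real.mul_rpow (by positivity) (by positivity), mul_inv, neg_div,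
    Real.rpow_neg (by positivity)]
  congr 1
  rw [← Real.exp_mul, ← Real.exp_neg]
  ring_nf

lemma integrable_gaussian_plane {d : ℕ} (τ : ℝ) :
    Integrable (fun ξ : Plane d ↦ Real.exp (-((2 * Real.pi * ‖ξ‖) ^ 2) * Real.exp τ)) := by
  have hpi := Real.pi_pos
  have h := GaussianFourier.integrable_cexp_neg_mul_sq_norm_add (V := Plane d)
    (b := ((4 * Real.pi ^ 2 * Real.exp τ : ℝ) : ℂ)) (by rw [Complex.ofReal_re]; positivity) 0 0
  refine h.norm.congr (Filter.Eventually.of_forall fun ξ ↦ ?_)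
  simp only [zero_mul, add_zero]
  rw [show -((4 * Real.pi ^ 2 * Real.exp τ : ℝ) : ℂ) * (‖ξ‖ : ℂ) ^ 2 =
    ((-((2 * Real.pi * ‖ξ‖) ^ 2) * Real.exp τ : ℝ) : ℂ) by push_cast; ring, ← Complex.ofReal_exp,
    Complex.norm_real, Real.norm_of_nonneg (Real.exp_nonneg _)]

/-- The Fourier representation of the exponentially decaying fundamental solution, for a real
damping parameter `κ`; the heat kernel is integrated over time `e^τ`. -/
lemma weyl_real {d : ℕ} (hd : d = 1 ∨ d = 2) {κ t : ℝ} (hκ : 0 < κ) (ht : 0 < t) (z : Plane d) :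
    ∫ ξ : Plane d, Complex.exp (2 * Real.pi * Complex.I * (inner ℝ z ξ : ℝ)) *
      ((Real.exp (-t * √(κ ^ 2 + (2 * Real.pi * ‖ξ‖) ^ 2)) /
        (2 * √(κ ^ 2 + (2 * Real.pi * ‖ξ‖) ^ 2)) : ℝ) : ℂ) =
    ((1 / (2 * √Real.pi) * ((4 * Real.pi) ^ (-(d : ℝ) / 2) * ∫ τ : ℝ,
      Real.exp ((1 - d) / 2 * τ) *
        Real.exp (-((‖z‖ ^ 2 + t ^ 2) / 4) * Real.exp (-τ) - κ ^ 2 * Real.exp τ)) : ℝ) : ℂ) := by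
  have hpi := Real.pi_pos
  have hp : |((1 : ℝ) - d) / 2| ≤ 1 / 2 := by rcases hd with rfl | rfl <;> norm_num
  set h : ℝ → ℝ := fun τ ↦ Real.exp (1 / 2 * τ) *
    Real.exp (-(t ^ 2 / 4) * Real.exp (-τ) - κ ^ 2 * Real.exp τ) with hh
  have hh0 : ∀ τ, 0 ≤ h τ := fun τ ↦ by positivity
  set Φ : Plane d → ℝ → ℂ := fun ξ τ ↦
    Complex.exp (2 * Real.pi * Complex.I * (inner ℝ z ξ : ℝ)) *
      (Real.exp (-((2 * Real.pi * ‖ξ‖) ^ 2) * Real.exp τ) : ℂ) * (h τ : ℂ) with hΦ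
  have hnorm : ∀ ξ τ, ‖Φ ξ τ‖ = Real.exp (-((2 * Real.pi * ‖ξ‖) ^ 2) * Real.exp τ) * h τ := by
    intro ξ τ
    have : ‖Complex.exp (2 * Real.pi * Complex.I * (inner ℝ z ξ : ℝ))‖ = 1 := by
      rw [show 2 * (Real.pi : ℂ) * Complex.I * (inner ℝ z ξ : ℝ) =
        ((2 * Real.pi * inner ℝ z ξ : ℝ) : ℂ) * Complex.I by push_cast; ring,
        Complex.norm_exp_ofReal_mul_I]
    rw [hΦ]
    simp only [norm_mul, this, one_mul, Complex.norm_real, Real.norm_of_nonneg (hh0 τ),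
      Real.norm_of_nonneg (Real.exp_nonneg _)]
  have hcont : Continuous (Function.uncurry Φ) := by
    simp only [hΦ, hh, Function.uncurry_def]
    fun_prop
  have hgauss : ∀ τ : ℝ, ∫ ξ : Plane d, Real.exp (-((2 * Real.pi * ‖ξ‖) ^ 2) * Real.exp τ) =
      (4 * Real.pi) ^ (-(d : ℝ) / 2) * Real.exp (-(d : ℝ) / 2 * τ) := by
    intro τ
    have := gaussian_integral_plane (d := d) 0 τ
    simp only [inner_zero_left, Complex.ofReal_zero, mul_zero, Complex.exp_zero, one_mul, norm_zero,
      ne_eq, OfNat.ofNat_ne_zero, not_false_eq_true, zero_pow, zero_div, neg_zero, zero_mul,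
      Real.exp_zero, mul_one] at this
    rw [integral_complex_ofReal] at this
    exact_mod_cast this
  have hcomb : ∀ τ (r : ℝ), Real.exp (-(d : ℝ) / 2 * τ) *
      Real.exp (-(r ^ 2 / 4) * Real.exp (-τ)) * h τ = Real.exp ((1 - d) / 2 * τ) *
        Real.exp (-((r ^ 2 + t ^ 2) / 4) * Real.exp (-τ) - κ ^ 2 * Real.exp τ) := by
    intro τ r
    rw [hh]
    simp only [← Real.exp_add]
    ring_nf
  have hint : Integrable (Function.uncurry Φ) (volume.prod volume) := by
    rw [integrable_prod_iff' hcont.aestronglyMeasurable]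
    constructor
    · refine Filter.Eventually.of_forall fun τ ↦ ?_
      rw [← integrable_norm_iff]
      · simp only [Function.uncurry_apply_pair, hnorm]
        exact (integrable_gaussian_plane τ).mul_const _
      · exact (hcont.comp (by fun_prop : Continuous fun ξ : Plane d ↦ (ξ, τ))).aestronglyMeasurable
    · simp only [Function.uncurry_apply_pair, hnorm]
      simp_rw [integral_mul_const, hgauss]
      have := (integrable_exp_bessel (A := t ^ 2 / 4) (B := κ ^ 2) (by positivity) (by positivity)
        hp).const_mul ((4 * Real.pi) ^ (-(d : ℝ) / 2))
      refine this.congr (Filter.Eventually.of_forall fun τ ↦ ?_)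
      have := hcomb τ 0
      simp only [ne_eq, OfNat.ofNat_ne_zero, not_false_eq_true, zero_pow, zero_div, neg_zero,
        zero_mul, Real.exp_zero, mul_one, zero_add] at this
      simp only
      rw [mul_assoc, this]
  have hswap := integral_integral_swap hint
  -- Integration over `τ` gives the symbol, integration over `ξ` the kernel.
  have hL : ∀ ξ, ∫ τ, Φ ξ τ = 2 * √Real.pi *
      (Complex.exp (2 * Real.pi * Complex.I * (inner ℝ z ξ : ℝ)) *
      ((Real.exp (-t * √(κ ^ 2 + (2 * Real.pi * ‖ξ‖) ^ 2)) /
        (2 * √(κ ^ 2 + (2 * Real.pi * ‖ξ‖) ^ 2)) : ℝ) : ℂ)) := by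
    intro ξ
    rw [exp_mul_outgoing_eq_integral ht (by positivity), Real.sq_sqrt (by positivity)]
    have : ∀ τ, Φ ξ τ = Complex.exp (2 * Real.pi * Complex.I * (inner ℝ z ξ : ℝ)) *
        ((Real.exp (1 / 2 * τ) * Real.exp (-(t ^ 2 / 4) * Real.exp (-τ) -
          (κ ^ 2 + (2 * Real.pi * ‖ξ‖) ^ 2) * Real.exp τ) : ℝ) : ℂ) := by
      intro τ
      rw [hΦ, hh]
      simp only
      rw [mul_assoc, ← Complex.ofReal_mul]
      congr 2
      simp only [← Real.exp_add]
      ring_nf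
    simp_rw [this]
    rw [integral_const_mul, integral_complex_ofReal]
    have hs : (√Real.pi : ℂ) ≠ 0 := by exact_mod_cast (Real.sqrt_pos.2 hpi).ne'
    push_cast
    field_simp
  have hR : ∀ τ, ∫ ξ, Φ ξ τ = (((4 * Real.pi) ^ (-(d : ℝ) / 2) * (Real.exp ((1 - d) / 2 * τ) *
        Real.exp (-((‖z‖ ^ 2 + t ^ 2) / 4) * Real.exp (-τ) - κ ^ 2 * Real.exp τ)) : ℝ) : ℂ) := by
    intro τ
    simp only [hΦ]
    rw [integral_mul_const, gaussian_integral_plane, ← Complex.ofReal_mul, mul_assoc, hcomb]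
  simp_rw [hL, hR] at hswap
  rw [integral_const_mul, integral_complex_ofReal, integral_const_mul] at hswap
  have hs : (√Real.pi : ℂ) ≠ 0 := by exact_mod_cast (Real.sqrt_pos.2 hpi).ne'
  rw [Complex.ofReal_mul, ← hswap]
  push_cast
  field_simp

/-- The fundamental solution of `-Δ + κ²` in `ℝ^{d+1}`, `d = 1, 2`, as a function of the distance
`r`. The integral for `d = 1` converges for `Re κ ≥ 0`, `κ ≠ 0`, without rotating the contour. -/
noncomputable def dampedKernel (d : ℕ) (κ : ℂ) (r : ℝ) : ℂ :=
  if d = 2 then Complex.exp (-κ * r) / (4 * Real.pi * r)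
  else 1 / (2 * Real.pi) * (Complex.exp (-κ * r) *
    ∫ u in Set.Ioi (0 : ℝ), (Real.exp (-u) : ℂ) / ((u : ℂ) ^ 2 + 2 * (κ * r) * u) ^ (1 / 2 : ℂ))

lemma dampedKernel_ofReal {d : ℕ} (hd : d = 1 ∨ d = 2) {κ r : ℝ} (hκ : 0 < κ) (hr : 0 < r) :
    ((1 / (2 * √Real.pi) * ((4 * Real.pi) ^ (-(d : ℝ) / 2) * ∫ τ : ℝ,
      Real.exp ((1 - d) / 2 * τ) *
        Real.exp (-(r ^ 2 / 4) * Real.exp (-τ) - κ ^ 2 * Real.exp τ)) : ℝ) : ℂ) =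
    dampedKernel d κ r := by
  have hpi := Real.pi_pos
  have hspi : √Real.pi ≠ 0 := (Real.sqrt_pos.2 hpi).ne'
  rcases hd with rfl | rfl
  · have h1 : 1 / (2 * √Real.pi) * (4 * Real.pi) ^ (-((1 : ℕ) : ℝ) / 2) = 1 / (4 * Real.pi) := by
      rw [show -((1 : ℕ) : ℝ) / 2 = -(1 / 2) by norm_num, Real.rpow_neg (by positivity),
        ← Real.sqrt_eq_rpow, Real.sqrt_mul (by positivity),
        show (4 : ℝ) = 2 ^ 2 by norm_num, Real.sqrt_sq (by norm_num)]
      field_simp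
      rw [Real.sq_sqrt hpi.le]
    have h2 : ((1 : ℝ) - ((1 : ℕ) : ℝ)) / 2 = 0 := by norm_num
    rw [← mul_assoc, h1, h2, integral_exp_bessel (by positivity) (by positivity)]
    have h3 : √(r ^ 2 / 4 * κ ^ 2) = κ * r / 2 := by
      rw [show r ^ 2 / 4 * κ ^ 2 = (κ * r / 2) ^ 2 by ring, Real.sqrt_sq (by positivity)]
    simp only [zero_div, Real.rpow_zero, one_mul, zero_mul, Real.exp_zero, h3]
    have h4 : ∫ τ : ℝ, Real.exp (-2 * (κ * r / 2) * Real.cosh τ) =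
        ∫ τ : ℝ, Real.exp (-(κ * r) * Real.cosh τ) := by
      congr 1; funext τ; ring_nf
    rw [h4, integral_exp_neg_mul_cosh (by positivity), dampedKernel, if_neg (by norm_num)]
    have h5 : ∫ u in Set.Ioi (0 : ℝ), (Real.exp (-u) : ℂ) /
        ((u : ℂ) ^ 2 + 2 * ((κ : ℂ) * r) * u) ^ (1 / 2 : ℂ) =
        ((∫ u in Set.Ioi (0 : ℝ), Real.exp (-u) / √(u ^ 2 + 2 * (κ * r) * u) : ℝ) : ℂ) := by
      rw [← integral_complex_ofReal]
      refine setIntegral_congr_fun measurableSet_Ioi fun u hu ↦ ?_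
      have hu0 : 0 < u := hu
      rw [Complex.ofReal_div, Real.sqrt_eq_rpow, Complex.ofReal_cpow (by positivity)]
      push_cast
      rfl
    rw [h5]
    push_cast
    rw [neg_mul]
    ring
  · have h1 : 1 / (2 * √Real.pi) * (4 * Real.pi) ^ (-((2 : ℕ) : ℝ) / 2) * (2 * √Real.pi) =
        1 / (4 * Real.pi) := by
      rw [show -((2 : ℕ) : ℝ) / 2 = -1 by norm_num, Real.rpow_neg_one]
      field_simp
    have h2 : ((1 : ℝ) - ((2 : ℕ) : ℝ)) / 2 = -(1 / 2) := by norm_num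
    rw [h2, integral_exp_bessel_neg_half hr hκ, dampedKernel, if_pos rfl]
    have h3 : 1 / (2 * √Real.pi) * ((4 * Real.pi) ^ (-((2 : ℕ) : ℝ) / 2) *
        (2 * √Real.pi / r * Real.exp (-r * κ))) = Real.exp (-κ * r) / (4 * Real.pi * r) := by
      rw [show -r * κ = -κ * r by ring]
      linear_combination (Real.exp (-κ * r) / r) * h1
    rw [h3]
    push_cast
    rfl

lemma isOpen_re_pos : IsOpen {κ : ℂ | 0 < κ.re} := isOpen_lt continuous_const Complex.continuous_re

lemma integrableOn_exp_neg_div_sqrt :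
    IntegrableOn (fun u : ℝ ↦ Real.exp (-u) / √u) (Set.Ioi 0) := by
  refine ((integrable_exp_neg_abs_div_sqrt one_pos).integrableOn (s := Set.Ioi 0)).congr_fun
    (fun u hu ↦ ?_) measurableSet_Ioi
  simp [abs_of_pos (Set.mem_Ioi.1 hu)]

/-- Domination of the integrand of the two-dimensional kernel away from `κ = 0`. -/
lemma norm_macdonald_integrand_le {z : ℂ} {u δ : ℝ} (hu : 0 < u) (hδ : 0 < δ)
    (hz : δ ≤ ‖(u : ℂ) + 2 * z‖) :
    ‖(Real.exp (-u) : ℂ) / ((u : ℂ) ^ 2 + 2 * z * u) ^ (1 / 2 : ℂ)‖ ≤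
      1 / √δ * (Real.exp (-u) / √u) := by
  rw [norm_div, Complex.norm_real, Real.norm_of_nonneg (Real.exp_nonneg _), norm_cpow_half,
    show (u : ℂ) ^ 2 + 2 * z * u = (u : ℂ) * (u + 2 * z) by ring, norm_mul, Complex.norm_real,
    Real.norm_of_nonneg hu.le, Real.sqrt_mul hu.le]
  have h1 : √δ ≤ √‖(u : ℂ) + 2 * z‖ := Real.sqrt_le_sqrt hz
  have h2 := Real.sqrt_pos.2 hδ
  have h3 := Real.sqrt_pos.2 hu
  calc Real.exp (-u) / (√u * √‖(u : ℂ) + 2 * z‖) ≤ Real.exp (-u) / (√u * √δ) := by gcongr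
    _ = _ := by field_simp

lemma aestronglyMeasurable_macdonald_integrand (z : ℂ) (ν : Measure ℝ) :
    AEStronglyMeasurable (fun u : ℝ ↦ (Real.exp (-u) : ℂ) /
      ((u : ℂ) ^ 2 + 2 * z * u) ^ (1 / 2 : ℂ)) ν := by
  refine Measurable.aestronglyMeasurable ?_
  refine Measurable.div (by fun_prop) ?_
  exact Measurable.pow_const (by fun_prop) _

lemma differentiableOn_dampedKernel (d : ℕ) {r : ℝ} (hr : 0 < r) :
    DifferentiableOn ℂ (fun κ ↦ dampedKernel d κ r) {κ : ℂ | 0 < κ.re} := by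
  unfold dampedKernel
  split_ifs with h
  · fun_prop
  · refine (DifferentiableOn.mul (by fun_prop) ?_).const_mul _
    refine differentiableOn_integral_of_locally_dominated isOpen_re_pos
      (fun z _ ↦ aestronglyMeasurable_macdonald_integrand _ _) ?_ ?_
    · refine (ae_restrict_iff' measurableSet_Ioi).2 (Filter.Eventually.of_forall fun u hu ↦ ?_)
      have hu0 : 0 < u := hu
      intro κ hκ
      have hκ0 : 0 < κ.re := hκ
      have hpos : 0 < ((u : ℂ) ^ 2 + 2 * (κ * r) * u).re := by
        have : (u : ℂ) ^ 2 + 2 * (κ * r) * u = (u ^ 2 : ℝ) + ((2 * r * u : ℝ) : ℂ) * κ := by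
          push_cast; ring
        rw [this, Complex.add_re, Complex.re_ofReal_mul, Complex.ofReal_re]
        positivity
      have hs : (u : ℂ) ^ 2 + 2 * (κ * r) * u ∈ Complex.slitPlane := Or.inl hpos
      have hne : (u : ℂ) ^ 2 + 2 * (κ * r) * u ≠ 0 := Complex.slitPlane_ne_zero hs
      refine DifferentiableAt.differentiableWithinAt ?_
      refine DifferentiableAt.div (by fun_prop) ?_ ?_
      · exact DifferentiableAt.cpow (by fun_prop) (by fun_prop) hs
      · rw [Complex.cpow_ne_zero_iff]; exact Or.inl hne
    · intro κ hκ
      have hκ0 : 0 < κ.re := hκ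
      refine ⟨κ.re / 2, by positivity, fun u ↦ 1 / √(κ.re * r) * (Real.exp (-u) / √u),
        integrableOn_exp_neg_div_sqrt.const_mul _, ?_⟩
      refine (ae_restrict_iff' measurableSet_Ioi).2 (Filter.Eventually.of_forall fun u hu ↦ ?_)
      have hu0 : 0 < u := hu
      intro w _ hwκ
      refine norm_macdonald_integrand_le hu0 (by positivity) ?_
      have h1 : κ.re / 2 ≤ w.re := by
        have := (Complex.abs_re_le_norm (w - κ)).trans (le_of_lt (by rwa [← dist_eq_norm]))
        rw [Complex.sub_re] at this
        linarith [neg_le_of_abs_le this]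
      refine le_trans ?_ (Complex.re_le_norm _)
      have : ((u : ℂ) + 2 * (w * r)).re = u + 2 * r * w.re := by
        have : (u : ℂ) + 2 * (w * r) = u + ((2 * r : ℝ) : ℂ) * w := by push_cast; ring
        rw [this, Complex.add_re, Complex.re_ofReal_mul, Complex.ofReal_re]
      rw [this]
      nlinarith

/-- The Fourier multiplier `e^{-tq} / (2q)`, `q² = κ² + |2πξ|²`, of the damped kernel. -/
noncomputable def dampedSymbol {d : ℕ} (t : ℝ) (κ : ℂ) (ξ : Plane d) : ℂ :=
  Complex.exp (-(t : ℂ) * (κ ^ 2 + ((2 * Real.pi * ‖ξ‖) ^ 2 : ℝ)) ^ (1 / 2 : ℂ)) /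
    (2 * (κ ^ 2 + ((2 * Real.pi * ‖ξ‖) ^ 2 : ℝ)) ^ (1 / 2 : ℂ))

lemma norm_exp_inner {d : ℕ} (z ξ : Plane d) :
    ‖Complex.exp (2 * Real.pi * Complex.I * (inner ℝ z ξ : ℝ))‖ = 1 := by
  rw [show 2 * (Real.pi : ℂ) * Complex.I * (inner ℝ z ξ : ℝ) =
    ((2 * Real.pi * inner ℝ z ξ : ℝ) : ℂ) * Complex.I by push_cast; ring,
    Complex.norm_exp_ofReal_mul_I]

lemma norm_dampedSymbol {d : ℕ} (t : ℝ) (κ : ℂ) (ξ : Plane d) : ‖dampedSymbol t κ ξ‖ =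
    Real.exp (-t * ((κ ^ 2 + ((2 * Real.pi * ‖ξ‖) ^ 2 : ℝ)) ^ (1 / 2 : ℂ)).re) /
      (2 * √‖κ ^ 2 + ((2 * Real.pi * ‖ξ‖) ^ 2 : ℝ)‖) := by
  rw [dampedSymbol, norm_div, Complex.norm_exp, norm_mul, norm_cpow_half]
  simp

lemma measurable_dampedSymbol {d : ℕ} (t : ℝ) (κ : ℂ) :
    Measurable (fun ξ : Plane d ↦ dampedSymbol t κ ξ) := by
  have h : Measurable (fun ξ : Plane d ↦
      (κ ^ 2 + ((2 * Real.pi * ‖ξ‖) ^ 2 : ℝ) : ℂ) ^ (1 / 2 : ℂ)) :=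
    Measurable.pow_const (by fun_prop) _
  unfold dampedSymbol
  fun_prop

lemma mem_slitPlane_sq_add {κ : ℂ} (hκ : 0 < κ.re) {a : ℝ} (ha : 0 ≤ a) :
    κ ^ 2 + (a : ℂ) ∈ Complex.slitPlane := by
  rw [Complex.mem_slitPlane_iff]
  by_cases h : κ.im = 0
  · left
    rw [sq, Complex.add_re, Complex.mul_re, h, Complex.ofReal_re]
    nlinarith
  · right
    rw [sq, Complex.add_im, Complex.mul_im, Complex.ofReal_im]
    have : κ.re * κ.im ≠ 0 := mul_ne_zero hκ.ne' h
    intro h0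
    apply this
    linarith

lemma sq_re_le_norm_sq_add {κ : ℂ} (hκ : 0 < κ.re) {a : ℝ} (ha : 0 ≤ a) :
    κ.re ^ 2 ≤ ‖κ ^ 2 + (a : ℂ)‖ := by
  have h : κ ^ 2 + (a : ℂ) = (κ - Complex.I * √a) * (κ + Complex.I * √a) := by
    have : (√a : ℂ) ^ 2 = a := by rw [← Complex.ofReal_pow, Real.sq_sqrt ha]
    linear_combination -this + ((√a : ℂ) ^ 2) * Complex.I_sq
  rw [h, norm_mul, sq]
  have h1 : κ.re ≤ ‖κ - Complex.I * √a‖ := by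
    refine le_trans (le_of_eq ?_) (Complex.re_le_norm _); simp
  have h2 : κ.re ≤ ‖κ + Complex.I * √a‖ := by
    refine le_trans (le_of_eq ?_) (Complex.re_le_norm _); simp
  gcongr

lemma integrable_exp_neg_mul_norm {d : ℕ} {c : ℝ} (hc : 0 < c) :
    Integrable (fun ξ : Plane d ↦ Real.exp (-c * ‖ξ‖)) := by
  have hint := integrable_one_add_norm (E := Plane d) (μ := volume) (r := (d + 1 : ℕ)) (by
    rw [finrank_euclideanSpace_fin]; push_cast; linarith)
  have h2 := hint.const_mul ((d + 1).factorial / c ^ (d + 1) * Real.exp c)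
  refine h2.mono' (by fun_prop) (Filter.Eventually.of_forall fun ξ ↦ ?_)
  rw [Real.norm_of_nonneg (Real.exp_nonneg _), Real.rpow_neg (by positivity), Real.rpow_natCast]
  have h := pow_le_mul_exp hc (d + 1) (x := 1 + ‖ξ‖) (by positivity)
  rw [← div_eq_mul_inv, le_div_iff₀ (by positivity)]
  calc Real.exp (-c * ‖ξ‖) * (1 + ‖ξ‖) ^ (d + 1) ≤ Real.exp (-c * ‖ξ‖) *
        ((d + 1).factorial / c ^ (d + 1) * Real.exp (c * (1 + ‖ξ‖))) := by gcongr
    _ = (d + 1).factorial / c ^ (d + 1) * (Real.exp (-c * ‖ξ‖) * Real.exp (c * (1 + ‖ξ‖))) := by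
        ring
    _ = _ := by rw [← Real.exp_add]; ring_nf

lemma differentiableOn_integral_dampedSymbol {d : ℕ} {t : ℝ} (ht : 0 < t) (z : Plane d) :
    DifferentiableOn ℂ (fun κ ↦ ∫ ξ : Plane d,
      Complex.exp (2 * Real.pi * Complex.I * (inner ℝ z ξ : ℝ)) * dampedSymbol t κ ξ)
      {κ : ℂ | 0 < κ.re} := by
  refine differentiableOn_integral_of_locally_dominated isOpen_re_pos ?_ ?_ ?_
  · intro κ _
    exact ((by fun_prop : Measurable fun ξ : Plane d ↦
      Complex.exp (2 * Real.pi * Complex.I * (inner ℝ z ξ : ℝ))).mul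
        (measurable_dampedSymbol t κ)).aestronglyMeasurable
  · refine Filter.Eventually.of_forall fun ξ ↦ ?_
    intro κ hκ
    have hs := mem_slitPlane_sq_add (a := (2 * Real.pi * ‖ξ‖) ^ 2) hκ (by positivity)
    have hd : DifferentiableAt ℂ (fun κ : ℂ ↦
        (κ ^ 2 + ((2 * Real.pi * ‖ξ‖) ^ 2 : ℝ) : ℂ) ^ (1 / 2 : ℂ)) κ :=
      DifferentiableAt.cpow (by fun_prop) (by fun_prop) hs
    have hne : (κ ^ 2 + ((2 * Real.pi * ‖ξ‖) ^ 2 : ℝ) : ℂ) ^ (1 / 2 : ℂ) ≠ 0 := by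
      rw [Complex.cpow_ne_zero_iff]; exact Or.inl (Complex.slitPlane_ne_zero hs)
    refine DifferentiableAt.differentiableWithinAt ?_
    unfold dampedSymbol
    refine DifferentiableAt.const_mul ?_ _
    refine DifferentiableAt.div (DifferentiableAt.cexp (hd.const_mul _)) (hd.const_mul _) ?_
    exact mul_ne_zero two_ne_zero hne
  · intro κ hκ
    have hκ0 : 0 < κ.re := hκ
    set M := ‖κ‖ + κ.re / 2 with hM
    refine ⟨κ.re / 2, by positivity, fun ξ ↦ Real.exp (t * M) / κ.re *
      Real.exp (-(t * (2 * Real.pi)) * ‖ξ‖),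
      (integrable_exp_neg_mul_norm (by have := Real.pi_pos; positivity)).const_mul _, ?_⟩
    refine Filter.Eventually.of_forall fun ξ w hw hwκ ↦ ?_
    have hw0 : 0 < w.re := hw
    rw [norm_mul, norm_exp_inner, one_mul, norm_dampedSymbol]
    have h1 : κ.re / 2 ≤ w.re := by
      have := (Complex.abs_re_le_norm (w - κ)).trans (le_of_lt (by rwa [← dist_eq_norm]))
      rw [Complex.sub_re] at this
      linarith [neg_le_of_abs_le this]
    have h2 : ‖w‖ ≤ M := by
      have := norm_sub_norm_le w κ
      rw [dist_eq_norm] at hwκ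
      linarith
    have h3 : κ.re / 2 ≤ √‖w ^ 2 + ((2 * Real.pi * ‖ξ‖) ^ 2 : ℝ)‖ := by
      apply Real.le_sqrt_of_sq_le
      refine le_trans ?_ (sq_re_le_norm_sq_add hw0 (by positivity))
      gcongr
    have h4 : 2 * Real.pi * ‖ξ‖ - M ≤ ((w ^ 2 + ((2 * Real.pi * ‖ξ‖) ^ 2 : ℝ)) ^ (1 / 2 : ℂ)).re := by
      refine le_trans ?_ (sqrt_re_le_cpow_half_re _)
      have hnn : ‖w‖ ^ 2 = w.re ^ 2 + w.im ^ 2 := by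
        rw [Complex.sq_norm, Complex.normSq_apply]; ring
      have hre : (w ^ 2 + ((2 * Real.pi * ‖ξ‖) ^ 2 : ℝ)).re =
          w.re ^ 2 - w.im ^ 2 + (2 * Real.pi * ‖ξ‖) ^ 2 := by
        rw [sq w, Complex.add_re, Complex.mul_re, Complex.ofReal_re]; ring
      rw [hre]
      have hpi := Real.pi_pos
      have hy : 0 ≤ 2 * Real.pi * ‖ξ‖ := by positivity
      have hw1 : 0 ≤ ‖w‖ := norm_nonneg w
      rcases le_total (2 * Real.pi * ‖ξ‖) M with hl | hl
      · exact le_trans (by linarith) (Real.sqrt_nonneg _)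
      · apply Real.le_sqrt_of_sq_le
        nlinarith [sq_nonneg w.re]
    calc _ ≤ Real.exp (-t * (2 * Real.pi * ‖ξ‖ - M)) / (2 * (κ.re / 2)) := by
          gcongr ?_ / (2 * ?_)
          rw [Real.exp_le_exp]
          nlinarith
      _ = _ := by
        simp only
        rw [mul_div_cancel₀ _ two_ne_zero, div_mul_eq_mul_div, ← Real.exp_add]
        ring_nf

/-- The Weyl representation for complex damping, by analytic continuation from `κ > 0`. -/
lemma weyl_damped {d : ℕ} (hd : d = 1 ∨ d = 2) {t : ℝ} (ht : 0 < t) (z : Plane d) {κ : ℂ}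
    (hκ : 0 < κ.re) :
    ∫ ξ : Plane d, Complex.exp (2 * Real.pi * Complex.I * (inner ℝ z ξ : ℝ)) * dampedSymbol t κ ξ =
      dampedKernel d κ (√(‖z‖ ^ 2 + t ^ 2)) := by
  have hr : 0 < √(‖z‖ ^ 2 + t ^ 2) := by positivity
  have hconv : IsPreconnected {κ : ℂ | 0 < κ.re} :=
    (convex_halfSpace_re_gt 0).isPreconnected
  have hreal : ∀ x : ℝ, 0 < x → ∫ ξ : Plane d,
      Complex.exp (2 * Real.pi * Complex.I * (inner ℝ z ξ : ℝ)) * dampedSymbol t x ξ =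
      dampedKernel d x (√(‖z‖ ^ 2 + t ^ 2)) := by
    intro x hx
    rw [← dampedKernel_ofReal hd hx hr, Real.sq_sqrt (by positivity), ← weyl_real hd hx ht z]
    congr 1
    funext ξ
    congr 1
    rw [dampedSymbol, ← Complex.ofReal_pow, ← Complex.ofReal_add, Real.sqrt_eq_rpow]
    push_cast
    rw [Complex.ofReal_cpow (by positivity)]
    push_cast
    rfl
  refine AnalyticOnNhd.eqOn_of_preconnected_of_frequently_eq
    ((differentiableOn_integral_dampedSymbol ht z).analyticOnNhd isOpen_re_pos)
    ((differentiableOn_dampedKernel d hr).analyticOnNhd isOpen_re_pos) hconv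
    (z₀ := 1) (by simp) ?_ hκ
  have hu : Filter.Tendsto (fun n : ℕ ↦ (1 : ℂ) + (((n : ℝ) + 1)⁻¹ : ℝ)) Filter.atTop (𝓝[≠] 1) := by
    rw [tendsto_nhdsWithin_iff]
    constructor
    · have h0 : Filter.Tendsto (fun n : ℕ ↦ ((n : ℝ) + 1)⁻¹) Filter.atTop (𝓝 0) := by
        simpa using tendsto_one_div_add_atTop_nhds_zero_nat (𝕜 := ℝ)
      have h1 : Filter.Tendsto (fun n : ℕ ↦ ((((n : ℝ) + 1)⁻¹ : ℝ) : ℂ)) Filter.atTop (𝓝 0) :=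
        (Complex.continuous_ofReal.tendsto' 0 0 rfl).comp h0
      simpa using h1.const_add 1
    · refine Filter.Eventually.of_forall fun n ↦ ?_
      have : ((n : ℝ) + 1)⁻¹ ≠ 0 := by positivity
      intro h
      rw [Set.mem_singleton_iff, add_eq_left, Complex.ofReal_eq_zero] at h
      exact this h
  refine hu.frequently (Filter.Frequently.of_forall fun n ↦ ?_)
  have := hreal (1 + ((n : ℝ) + 1)⁻¹) (by positivity)
  push_cast at this ⊢
  exact this

/-- The Fourier symbol `e^{-tμ} / (2μ)` of the single-layer potential at height `t`. -/
noncomputable def layerSymbol {d : ℕ} (k t : ℝ) (ξ : Plane d) : ℂ :=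
  Complex.exp (-(t : ℂ) * outRoot k ξ) / (2 * outRoot k ξ)

lemma norm_layerSymbol {d : ℕ} (k t : ℝ) (ξ : Plane d) : ‖layerSymbol k t ξ‖ =
    1 / 2 * (Real.exp (-t * (outRoot k ξ).re) / ‖outRoot k ξ‖) := by
  rw [layerSymbol, norm_div, norm_exp_neg_mul_outRoot, norm_mul, Complex.norm_ofNat]
  ring

lemma measurable_layerSymbol {d : ℕ} (k t : ℝ) : Measurable (fun ξ : Plane d ↦ layerSymbol k t ξ) := by
  have := (continuous_outRoot (d := d) k).measurable
  unfold layerSymbol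
  fun_prop

lemma integrable_pow_mul_layerSymbol {d : ℕ} (hd : 0 < d) {k t : ℝ} (hk : 0 < k) (ht : 0 < t)
    (n : ℕ) : Integrable (fun ξ : Plane d ↦ ‖ξ‖ ^ n * ‖layerSymbol k t ξ‖) := by
  refine ((integrable_pow_mul_exp_neg_outRoot hd hk ht n).const_mul (1 / 2)).congr
    (Filter.Eventually.of_forall fun ξ ↦ ?_)
  simp only [norm_layerSymbol]
  ring

lemma integrable_layerSymbol {d : ℕ} (hd : 0 < d) {k t : ℝ} (hk : 0 < k) (ht : 0 < t) :
    Integrable (fun ξ : Plane d ↦ layerSymbol k t ξ) := by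
  rw [← integrable_norm_iff (measurable_layerSymbol k t).aestronglyMeasurable]
  simpa using integrable_pow_mul_layerSymbol hd hk ht 0

/-- The damping parameters `ε - ik`, `ε = 1 / (n + 1)`, of the limiting absorption argument. -/
lemma tendsto_damping (k : ℝ) :
    Filter.Tendsto (fun n : ℕ ↦ ((((n : ℝ) + 1)⁻¹ : ℝ) : ℂ) - Complex.I * k) Filter.atTop
      (𝓝 (-Complex.I * k)) := by
  have h0 : Filter.Tendsto (fun n : ℕ ↦ ((n : ℝ) + 1)⁻¹) Filter.atTop (𝓝 0) := by
    simpa using tendsto_one_div_add_atTop_nhds_zero_nat (𝕜 := ℝ)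
  have h1 : Filter.Tendsto (fun n : ℕ ↦ ((((n : ℝ) + 1)⁻¹ : ℝ) : ℂ)) Filter.atTop (𝓝 0) :=
    (Complex.continuous_ofReal.tendsto' 0 0 rfl).comp h0
  simpa using h1.sub_const (Complex.I * k)

lemma damping_sq_add (ε k a : ℝ) : ((ε : ℂ) - Complex.I * k) ^ 2 + (a : ℂ) =
    ((ε ^ 2 + (a - k ^ 2) : ℝ) : ℂ) + ((-(2 * ε * k) : ℝ) : ℂ) * Complex.I := by
  push_cast
  linear_combination ((k : ℂ) ^ 2) * Complex.I_sq

lemma abs_sub_sq_le_norm_damping (ε k a : ℝ) (ha : 0 ≤ a) :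
    |a - k ^ 2| ≤ ‖((ε : ℂ) - Complex.I * k) ^ 2 + (a : ℂ)‖ := by
  rw [damping_sq_add]
  refine abs_le_of_sq_le_sq ?_ (norm_nonneg _)
  rw [Complex.sq_norm, Complex.normSq_apply]
  simp only [Complex.add_re, Complex.ofReal_re, Complex.re_ofReal_mul, Complex.I_re, mul_zero,
    add_zero, Complex.add_im, Complex.ofReal_im, Complex.im_ofReal_mul, Complex.I_im, mul_one,
    zero_add]
  nlinarith [sq_nonneg (ε ^ 2), mul_nonneg (sq_nonneg ε) ha, mul_nonneg (sq_nonneg ε) (sq_nonneg k)]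

/-- The symbols with damping `ε - ik` are dominated by the symbol without damping, uniformly in `ε`:
both `|κ² + |2πξ|²|` and the real part of its root are smallest for `ε = 0`. -/
lemma norm_dampedSymbol_le {d : ℕ} {ε k t : ℝ} (ht : 0 < t) {ξ : Plane d}
    (hξ : (2 * Real.pi * ‖ξ‖) ^ 2 ≠ k ^ 2) :
    ‖dampedSymbol t ((ε : ℂ) - Complex.I * k) ξ‖ ≤ ‖layerSymbol k t ξ‖ := by
  rw [norm_dampedSymbol, norm_layerSymbol, outRoot_re, norm_outRoot]
  have h1 := abs_sub_sq_le_norm_damping ε k ((2 * Real.pi * ‖ξ‖) ^ 2) (by positivity)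
  have h2 : 0 < √|(2 * Real.pi * ‖ξ‖) ^ 2 - k ^ 2| :=
    Real.sqrt_pos.2 (abs_pos.2 (sub_ne_zero.2 hξ))
  have h3 : √((2 * Real.pi * ‖ξ‖) ^ 2 - k ^ 2) ≤
      ((((ε : ℂ) - Complex.I * k) ^ 2 + ((2 * Real.pi * ‖ξ‖) ^ 2 : ℝ)) ^ (1 / 2 : ℂ)).re := by
    refine le_trans (Real.sqrt_le_sqrt ?_) (sqrt_re_le_cpow_half_re _)
    rw [damping_sq_add]
    simp only [Complex.add_re, Complex.ofReal_re, Complex.re_ofReal_mul, Complex.I_re, mul_zero,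
      add_zero]
    nlinarith [sq_nonneg ε]
  calc _ ≤ Real.exp (-t * √((2 * Real.pi * ‖ξ‖) ^ 2 - k ^ 2)) /
        (2 * √|(2 * Real.pi * ‖ξ‖) ^ 2 - k ^ 2|) := by
        gcongr ?_ / (2 * ?_)
        · rw [Real.exp_le_exp]; nlinarith
        · exact Real.sqrt_le_sqrt h1
    _ = _ := by field_simp

/-- For `κ = ε - ik` the number `κ² + |2πξ|²` lies below the real axis, so its principal root tends to
the root `μ` with nonpositive imaginary part, also where the limit lies on the branch cut. -/
lemma tendsto_dampedSymbol {d : ℕ} {k t : ℝ} (hk : 0 < k) {ξ : Plane d}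
    (hξ : (2 * Real.pi * ‖ξ‖) ^ 2 ≠ k ^ 2) :
    Filter.Tendsto (fun n : ℕ ↦ dampedSymbol t (((((n : ℝ) + 1)⁻¹ : ℝ) : ℂ) - Complex.I * k) ξ)
      Filter.atTop (𝓝 (layerSymbol k t ξ)) := by
  set a := (2 * Real.pi * ‖ξ‖) ^ 2 with ha
  set w : ℕ → ℂ := fun n ↦ (((((n : ℝ) + 1)⁻¹ : ℝ) : ℂ) - Complex.I * k) ^ 2 + (a : ℝ) with hw
  have hwim : ∀ n, (w n).im < 0 := by
    intro n
    rw [hw]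
    simp only
    rw [damping_sq_add]
    simp only [Complex.add_im, Complex.ofReal_im, Complex.im_ofReal_mul, Complex.I_im, mul_one,
      zero_add]
    have : 0 < ((n : ℝ) + 1)⁻¹ := by positivity
    have := mul_pos this hk
    linarith
  have hwlim : Filter.Tendsto w Filter.atTop (𝓝 ((a - k ^ 2 : ℝ) : ℂ)) := by
    have h := ((tendsto_damping k).pow 2).add_const (a : ℂ)
    have e : (-Complex.I * k) ^ 2 + (a : ℂ) = ((a - k ^ 2 : ℝ) : ℂ) := by
      push_cast
      linear_combination ((k : ℂ) ^ 2) * Complex.I_sq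
    rwa [e] at h
  have hq : Filter.Tendsto (fun n ↦ w n ^ (1 / 2 : ℂ)) Filter.atTop (𝓝 (outRoot k ξ)) := by
    have hcont : Continuous (fun w : ℂ ↦ (√((‖w‖ + w.re) / 2) : ℂ) -
        Complex.I * (√((‖w‖ - w.re) / 2) : ℂ)) := by fun_prop
    have h := (hcont.tendsto _).comp hwlim
    have e : (√((‖((a - k ^ 2 : ℝ) : ℂ)‖ + ((a - k ^ 2 : ℝ) : ℂ).re) / 2) : ℂ) -
        Complex.I * (√((‖((a - k ^ 2 : ℝ) : ℂ)‖ - ((a - k ^ 2 : ℝ) : ℂ).re) / 2) : ℂ) =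
        outRoot k ξ := by
      rw [outRoot, Complex.norm_real, Complex.ofReal_re, Real.norm_eq_abs, ← ha]
      rcases le_total (k ^ 2) a with h | h
      · rw [abs_of_nonneg (sub_nonneg.2 h), Real.sqrt_eq_zero_of_nonpos (sub_nonpos.2 h)]
        simp
      · rw [abs_of_nonpos (sub_nonpos.2 h), Real.sqrt_eq_zero_of_nonpos (sub_nonpos.2 h),
          show (-(a - k ^ 2) - (a - k ^ 2)) / 2 = k ^ 2 - a by ring]
        simp
    rw [e] at h
    refine h.congr fun n ↦ ?_
    simp only [Function.comp_apply]
    rw [cpow_half_of_im_neg (hwim n)]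
  have hne : (2 : ℂ) * outRoot k ξ ≠ 0 := by
    refine mul_ne_zero two_ne_zero ?_
    rw [← norm_ne_zero_iff, norm_outRoot]
    exact (Real.sqrt_pos.2 (abs_pos.2 (sub_ne_zero.2 hξ))).ne'
  unfold dampedSymbol layerSymbol
  exact Filter.Tendsto.div ((Complex.continuous_exp.tendsto _).comp (hq.const_mul (-(t : ℂ))))
    (hq.const_mul 2) hne

lemma tendsto_dampedKernel (d : ℕ) {k r : ℝ} (hk : 0 < k) (hr : 0 < r) :
    Filter.Tendsto (fun n : ℕ ↦ dampedKernel d (((((n : ℝ) + 1)⁻¹ : ℝ) : ℂ) - Complex.I * k) r)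
      Filter.atTop (𝓝 (dampedKernel d (-Complex.I * k) r)) := by
  have hexp : Filter.Tendsto (fun n : ℕ ↦
      Complex.exp (-(((((n : ℝ) + 1)⁻¹ : ℝ) : ℂ) - Complex.I * k) * r)) Filter.atTop
      (𝓝 (Complex.exp (-(-Complex.I * k) * r))) :=
    (Complex.continuous_exp.tendsto _).comp (((tendsto_damping k).neg).mul_const (r : ℂ))
  unfold dampedKernel
  split_ifs with h
  · exact hexp.div_const _
  · refine (hexp.mul ?_).const_mul _
    refine tendsto_integral_of_dominated_convergence
      (fun u ↦ 1 / √(2 * k * r) * (Real.exp (-u) / √u))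
      (fun n ↦ aestronglyMeasurable_macdonald_integrand _ _)
      (integrableOn_exp_neg_div_sqrt.const_mul _) ?_ ?_
    · intro n
      refine (ae_restrict_iff' measurableSet_Ioi).2 (Filter.Eventually.of_forall fun u hu ↦ ?_)
      refine norm_macdonald_integrand_le hu (by positivity) ?_
      refine le_trans (le_of_eq ?_) (Complex.abs_im_le_norm _)
      simp
      rw [abs_of_pos hk, abs_of_pos hr]
      ring
    · refine (ae_restrict_iff' measurableSet_Ioi).2 (Filter.Eventually.of_forall fun u hu ↦ ?_)
      have hu0 : 0 < u := hu
      have hs : (u : ℂ) ^ 2 + 2 * (-Complex.I * k * r) * u ∈ Complex.slitPlane := by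
        rw [Complex.mem_slitPlane_iff]
        right
        have e : (u : ℂ) ^ 2 + 2 * (-Complex.I * k * r) * u =
            ((u ^ 2 : ℝ) : ℂ) + ((-(2 * k * r * u) : ℝ) : ℂ) * Complex.I := by push_cast; ring
        rw [e]
        simp only [Complex.add_im, Complex.ofReal_im, Complex.im_ofReal_mul, Complex.I_im, mul_one,
          zero_add]
        have : 0 < 2 * k * r * u := by positivity
        linarith
      refine Filter.Tendsto.div tendsto_const_nhds ?_ ?_
      · refine ((continuousAt_cpow_const hs).tendsto).comp ?_
        exact (((((tendsto_damping k).mul_const (r : ℂ)).const_mul 2).mul_const (u : ℂ)).const_add _)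
      · rw [Complex.cpow_ne_zero_iff]; exact Or.inl (Complex.slitPlane_ne_zero hs)

/-- The Weyl representation of the outgoing fundamental solution at height `t > 0`. -/
lemma weyl_outgoing {d : ℕ} (hd : d = 1 ∨ d = 2) {k t : ℝ} (hk : 0 < k) (ht : 0 < t)
    (z : Plane d) :
    ∫ ξ : Plane d, Complex.exp (2 * Real.pi * Complex.I * (inner ℝ z ξ : ℝ)) * layerSymbol k t ξ =
      dampedKernel d (-Complex.I * k) (√(‖z‖ ^ 2 + t ^ 2)) := by
  have hd0 : 0 < d := by omega
  refine tendsto_nhds_unique ?_ (tendsto_dampedKernel d hk (r := √(‖z‖ ^ 2 + t ^ 2))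
    (by positivity))
  have heq : ∀ n : ℕ, ∫ ξ : Plane d, Complex.exp (2 * Real.pi * Complex.I * (inner ℝ z ξ : ℝ)) *
      dampedSymbol t (((((n : ℝ) + 1)⁻¹ : ℝ) : ℂ) - Complex.I * k) ξ =
      dampedKernel d (((((n : ℝ) + 1)⁻¹ : ℝ) : ℂ) - Complex.I * k) (√(‖z‖ ^ 2 + t ^ 2)) := by
    intro n
    refine weyl_damped hd ht z ?_
    have : 0 < ((n : ℝ) + 1)⁻¹ := by positivity
    rw [Complex.sub_re, Complex.ofReal_re]
    simpa using this
  simp_rw [← heq]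
  refine tendsto_integral_of_dominated_convergence (fun ξ ↦ ‖layerSymbol k t ξ‖) ?_
    (integrable_layerSymbol hd0 hk ht).norm ?_ ?_
  · intro n
    exact ((by fun_prop : Measurable fun ξ : Plane d ↦
      Complex.exp (2 * Real.pi * Complex.I * (inner ℝ z ξ : ℝ))).mul
        (measurable_dampedSymbol t _)).aestronglyMeasurable
  · intro n
    filter_upwards [ae_outRoot_ne_zero hd0 hk] with ξ hξ
    rw [norm_mul, norm_exp_inner, one_mul]
    exact norm_dampedSymbol_le ht hξ
  · filter_upwards [ae_outRoot_ne_zero hd0 hk] with ξ hξ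
    exact (tendsto_dampedSymbol hk hξ).const_mul _

/-- The integral defining `H₀⁽¹⁾(x)` after the substitution `u = xs`, as the kernel `K₀(κr) / (2π)`
at `κr = -ix`. -/
lemma hankelH0_eq {x : ℝ} (hx : 0 < x) : Complex.I / 4 * hankelH0 x =
    1 / (2 * Real.pi) * (Complex.exp (Complex.I * x) *
      ∫ u in Set.Ioi (0 : ℝ), (Real.exp (-u) : ℂ) /
        ((u : ℂ) ^ 2 + 2 * (-Complex.I * x) * u) ^ (1 / 2 : ℂ)) := by
  have hsub := integral_comp_mul_left_Ioi (fun u : ℝ ↦ (Real.exp (-u) : ℂ) /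
    ((u : ℂ) ^ 2 + 2 * (-Complex.I * x) * u) ^ (1 / 2 : ℂ)) 0 hx
  rw [mul_zero] at hsub
  have hI : ∫ s in Set.Ioi (0 : ℝ),
      (Real.exp (-x * s) : ℂ) * ((s : ℂ) ^ 2 - 2 * Complex.I * s) ^ (-(1 / 2) : ℂ) =
      (x : ℂ) * ∫ s in Set.Ioi (0 : ℝ), (Real.exp (-(x * s)) : ℂ) /
    (((x * s : ℝ) : ℂ) ^ 2 + 2 * (-Complex.I * x) * ((x * s : ℝ) : ℂ)) ^ (1 / 2 : ℂ) := by
    rw [← integral_const_mul]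
    refine setIntegral_congr_fun measurableSet_Ioi fun s hs ↦ ?_
    have hs0 : 0 < s := hs
    have hx' : (x : ℂ) ≠ 0 := by exact_mod_cast hx.ne'
    have e1 : ((x * s : ℝ) : ℂ) ^ 2 + 2 * (-Complex.I * x) * ((x * s : ℝ) : ℂ) =
        ((x ^ 2 : ℝ) : ℂ) * ((s : ℂ) ^ 2 - 2 * Complex.I * s) := by push_cast; ring
    have e2 : (((x ^ 2 : ℝ) : ℂ) * ((s : ℂ) ^ 2 - 2 * Complex.I * s)) ^ (1 / 2 : ℂ) =
        x * ((s : ℂ) ^ 2 - 2 * Complex.I * s) ^ (1 / 2 : ℂ) := by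
      have hne : (s : ℂ) ^ 2 - 2 * Complex.I * s ≠ 0 := by
        intro h0
        have := congrArg Complex.im h0
        simp [sq] at this
        exact hs0.ne' this
      rw [Complex.cpow_def_of_ne_zero (mul_ne_zero (by exact_mod_cast (pow_pos hx 2).ne') hne),
        Complex.log_ofReal_mul (pow_pos hx 2) hne, add_mul, Complex.exp_add,
        ← Complex.cpow_def_of_ne_zero hne]
      congr 1
      rw [Real.log_pow]
      push_cast
      rw [show (2 : ℂ) * (Real.log x : ℂ) * (1 / 2) = (Real.log x : ℂ) by ring, ← Complex.ofReal_exp,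
        Real.exp_log hx]
    rw [e1, e2, Complex.cpow_neg, neg_mul]
    field_simp
  rw [hankelH0, hI, hsub]
  have hx' : (x : ℂ) ≠ 0 := by exact_mod_cast hx.ne'
  have hpi : (Real.pi : ℂ) ≠ 0 := by exact_mod_cast Real.pi_pos.ne'
  rw [Complex.real_smul]
  push_cast
  field_simp
  norm_num

lemma fundSol_eq_dampedKernel {d : ℕ} {k : ℝ} (hk : 0 < k) {x y : Plane d × ℝ}
    (hxy : 0 < euclDist x y) :
    fundSol k x y = dampedKernel d (-Complex.I * k) (euclDist x y) := by
  unfold fundSol dampedKernel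
  split_ifs with h
  · ring_nf
  · rw [hankelH0_eq (by positivity)]
    push_cast
    ring_nf

/-- Off the plane of the screen the fundamental solution is an absolutely convergent superposition
of outgoing plane waves and evanescent waves. -/
lemma fundSol_eq_integral {d : ℕ} (hd : d = 1 ∨ d = 2) {k : ℝ} (hk : 0 < k) (x : Plane d × ℝ)
    (hx : x.2 ≠ 0) (y : Plane d) :
    fundSol k x (y, 0) = ∫ ξ : Plane d,
      Complex.exp (2 * Real.pi * Complex.I * (inner ℝ (x.1 - y) ξ : ℝ)) * layerSymbol k |x.2| ξ := by
  have ht : 0 < |x.2| := abs_pos.2 hx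
  rw [weyl_outgoing hd hk ht]
  have : euclDist x (y, 0) = √(‖x.1 - y‖ ^ 2 + |x.2| ^ 2) := by simp [euclDist]
  rw [← this]
  refine fundSol_eq_dampedKernel hk ?_
  rw [this]
  positivity

/-- All moments of the symbol in the Weyl representation are integrable, so that the kernel is smooth
on the hyperplane. -/
lemma contDiff_fundSol {d : ℕ} (hd : d = 1 ∨ d = 2) {k : ℝ} (hk : 0 < k) (x : Plane d × ℝ)
    (hx : x.2 ≠ 0) : ContDiff ℝ ∞ (fun y : Plane d ↦ fundSol k x (y, 0)) := by
  have ht : 0 < |x.2| := abs_pos.2 hx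
  have h : (fun y : Plane d ↦ fundSol k x (y, 0)) = fun y ↦ (𝓕 (fun ξ : Plane d ↦
      layerSymbol k |x.2| ξ)) (y - x.1) := by
    funext y
    rw [fundSol_eq_integral hd hk x hx, Real.fourier_eq']
    congr 1
    funext ξ
    rw [smul_eq_mul]
    congr 2
    rw [real_inner_comm, ← neg_sub y x.1, inner_neg_right]
    push_cast
    ring
  rw [h]
  have h2 : ContDiff ℝ ∞ (𝓕 (fun ξ : Plane d ↦ layerSymbol k |x.2| ξ)) :=
    Real.contDiff_fourier fun n _ ↦ integrable_pow_mul_layerSymbol (by omega) hk ht n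
  exact h2.comp (contDiff_id.sub contDiff_const)

/-! ### Sobolev distributions as Fourier densities -/

/-- The Bessel weight `(k² + |2πξ|²)^{s/2}`. -/
noncomputable def besselWeight {d : ℕ} (k s : ℝ) (ξ : Plane d) : ℝ :=
  (k ^ 2 + (2 * Real.pi * ‖ξ‖) ^ 2) ^ (s / 2)

section besselWeight
variable {d : ℕ} {k : ℝ}

lemma besselWeight_pos (hk : 0 < k) (s : ℝ) (ξ : Plane d) : 0 < besselWeight k s ξ := by
  unfold besselWeight; positivity

lemma besselWeight_mul (hk : 0 < k) (s s' : ℝ) (ξ : Plane d) :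
    besselWeight k s ξ * besselWeight k s' ξ = besselWeight k (s + s') ξ := by
  unfold besselWeight
  rw [← Real.rpow_add (by positivity)]
  ring_nf

lemma besselWeight_zero (ξ : Plane d) : besselWeight k 0 ξ = 1 := by
  simp [besselWeight]

lemma besselWeight_mul_neg (hk : 0 < k) (s : ℝ) (ξ : Plane d) :
    besselWeight k s ξ * besselWeight k (-s) ξ = 1 := by
  rw [besselWeight_mul hk, add_neg_cancel, besselWeight_zero]

lemma besselWeight_neg_mul (hk : 0 < k) (s : ℝ) (ξ : Plane d) :
    besselWeight k (-s) ξ * besselWeight k s ξ = 1 := by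
  rw [mul_comm, besselWeight_mul_neg hk]

lemma continuous_besselWeight (hk : 0 < k) (s : ℝ) :
    Continuous (fun ξ : Plane d ↦ besselWeight k s ξ) := by
  unfold besselWeight
  refine Continuous.rpow_const (by fun_prop) fun ξ ↦ Or.inl ?_
  positivity

lemma hasTemperateGrowth_besselWeight (hk : 0 < k) (s : ℝ) :
    (fun ξ : Plane d ↦ ((besselWeight k s ξ : ℝ) : ℂ)).HasTemperateGrowth := by
  have h1 : (fun ξ : Plane d ↦ (k ^ 2) ^ (s / 2) *
      (1 + ‖((2 * Real.pi / k) • ContinuousLinearMap.id ℝ (Plane d)) ξ‖ ^ 2) ^ (s / 2)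
      ).HasTemperateGrowth := by
    refine Function.HasTemperateGrowth.mul (.const _) ?_
    exact (Function.hasTemperateGrowth_one_add_norm_sq_rpow (Plane d) (s / 2)).comp
      (ContinuousLinearMap.hasTemperateGrowth _)
  have h2 : (fun ξ : Plane d ↦ besselWeight k s ξ).HasTemperateGrowth := by
    convert h1 using 2 with ξ
    rw [besselWeight, ← Real.mul_rpow (by positivity) (by positivity)]
    congr 1
    simp only [smul_apply, ContinuousLinearMap.id_apply, norm_smul]
    rw [Real.norm_of_nonneg (by have := Real.pi_pos; positivity)]
    field_simp
  exact Function.HasTemperateGrowth.comp (g := Complex.ofReal) (by fun_prop) h2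

end besselWeight

lemma besselJ_eq {d : ℕ} (k s : ℝ) : besselJ (d := d) k s =
    fourierMultiplierCLM ℂ (fun ξ : Plane d ↦ ((besselWeight k s ξ : ℝ) : ℂ)) := rfl

lemma besselJ_besselJ {d : ℕ} {k : ℝ} (hk : 0 < k) (s : ℝ) (u : 𝓢'(Plane d, ℂ)) :
    besselJ k s (besselJ k (-s) u) = u := by
  rw [besselJ_eq, besselJ_eq, fourierMultiplierCLM_fourierMultiplierCLM_apply
    (hasTemperateGrowth_besselWeight hk _) (hasTemperateGrowth_besselWeight hk _)]
  have : ((fun ξ : Plane d ↦ ((besselWeight k (-s) ξ : ℝ) : ℂ)) *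
      fun ξ : Plane d ↦ ((besselWeight k s ξ : ℝ) : ℂ)) = fun _ ↦ 1 := by
    funext ξ
    rw [Pi.mul_apply, ← Complex.ofReal_mul, besselWeight_neg_mul hk, Complex.ofReal_one]
  rw [this, fourierMultiplierCLM_const]
  simp

lemma iotaL2_apply {d : ℕ} (f : Lp ℂ 2 (volume : Measure (Plane d))) (w : 𝓢(Plane d, ℂ)) :
    iotaL2 d f w = ∫ x, w x * f x := by
  change Lp.toTemperedDistribution f w = _
  rw [Lp.toTemperedDistribution_apply]
  rfl

/-- The Fourier transform of `u ∈ H^s(ℝᵈ)`, which is a function; it is determined up to a null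
set. -/
noncomputable def fourierDensity {d : ℕ} {k s : ℝ} (u : sobolev d k s) (ξ : Plane d) : ℂ :=
  besselWeight k (-s) ξ * (𝓕 (sobolevRep u) : Lp ℂ 2 (volume : Measure (Plane d))) ξ

section density
variable {d : ℕ} {k s : ℝ}

lemma besselWeight_mul_fourierDensity (hk : 0 < k) (u : sobolev d k s) (ξ : Plane d) :
    (besselWeight k s ξ : ℂ) * fourierDensity u ξ =
      (𝓕 (sobolevRep u) : Lp ℂ 2 (volume : Measure (Plane d))) ξ := by
  rw [fourierDensity, ← mul_assoc, ← Complex.ofReal_mul, besselWeight_mul_neg hk,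
    Complex.ofReal_one, one_mul]

lemma aestronglyMeasurable_fourierDensity (hk : 0 < k) (u : sobolev d k s) :
    AEStronglyMeasurable (fourierDensity u) volume :=
  (Complex.continuous_ofReal.comp (continuous_besselWeight hk _)).aestronglyMeasurable.mul
    (Lp.memLp _).1

lemma memLp_fourierDensity (hk : 0 < k) (u : sobolev d k s) :
    MemLp (fun ξ ↦ (besselWeight k s ξ : ℂ) * fourierDensity u ξ) 2 volume := by
  simp_rw [besselWeight_mul_fourierDensity hk]
  exact Lp.memLp _

lemma eLpNorm_fourierDensity (hk : 0 < k) (u : sobolev d k s) :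
    eLpNorm (fun ξ ↦ (besselWeight k s ξ : ℂ) * fourierDensity u ξ) 2 volume =
      ENNReal.ofReal (sobolevNorm u) := by
  simp_rw [besselWeight_mul_fourierDensity hk]
  rw [sobolevNorm, ← Lp.norm_fourier_eq, Lp.norm_def, ENNReal.ofReal_toReal (Lp.eLpNorm_ne_top _)]

lemma sobolevNorm_sq (hk : 0 < k) (u : sobolev d k s) :
    sobolevNorm u ^ 2 = ∫ ξ, besselWeight k (2 * s) ξ * ‖fourierDensity u ξ‖ ^ 2 := by
  have h := L2.integral_inner_eq_sq_eLpNorm (𝕜 := ℂ)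
    (𝓕 (sobolevRep u) : Lp ℂ 2 (volume : Measure (Plane d)))
  have h1 : (inner ℂ (𝓕 (sobolevRep u)) (𝓕 (sobolevRep u) : Lp ℂ 2 (volume : Measure (Plane d)))
      : ℂ) = ((sobolevNorm u ^ 2 : ℝ) : ℂ) := by
    rw [Lp.inner_fourier_eq, inner_self_eq_norm_sq_to_K, sobolevNorm]; push_cast; rfl
  rw [L2.inner_def] at h1
  have h2 : ∫ ξ, inner ℂ ((𝓕 (sobolevRep u) : Lp ℂ 2 (volume : Measure (Plane d))) ξ)
      ((𝓕 (sobolevRep u) : Lp ℂ 2 (volume : Measure (Plane d))) ξ) =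
      ((∫ ξ, besselWeight k (2 * s) ξ * ‖fourierDensity u ξ‖ ^ 2 : ℝ) : ℂ) := by
    rw [← integral_complex_ofReal]
    congr 1
    funext ξ
    rw [inner_self_eq_norm_sq_to_K, ← besselWeight_mul_fourierDensity hk, norm_mul,
      Complex.norm_real, Real.norm_of_nonneg (besselWeight_pos hk _ _).le, two_mul,
      ← besselWeight_mul hk]
    push_cast
    simp only [Complex.coe_algebraMap]
    ring
  rw [h2] at h1
  exact_mod_cast h1.symm

/-- A distribution in `H^s` acts on Schwartz functions through its Fourier density. -/
lemma sobolev_apply (hk : 0 < k) (u : sobolev d k s) (w : 𝓢(Plane d, ℂ)) :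
    (u : 𝓢'(Plane d, ℂ)) w = ∫ ξ, fourierDensity u ξ * (𝓕⁻ w) ξ := by
  have h : (u : 𝓢'(Plane d, ℂ)) = besselJ k (-s) (iotaL2 d (sobolevRep u)) := by
    rw [iotaL2_sobolevRep]
    have := besselJ_besselJ hk (-s) (u : 𝓢'(Plane d, ℂ))
    rw [neg_neg] at this
    exact this.symm
  have hF : ∀ v, (iotaL2 d (sobolevRep u)) (𝓕 v) = iotaL2 d (𝓕 (sobolevRep u)) v := by
    intro v
    have := Lp.fourier_toTemperedDistribution_eq (sobolevRep u)
    exact congrArg (fun T : 𝓢'(Plane d, ℂ) ↦ T v) this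
  rw [h, besselJ_eq, fourierMultiplierCLM_apply_apply, hF, iotaL2_apply]
  congr 1
  funext ξ
  rw [SchwartzMap.smulLeftCLM_apply_apply (hasTemperateGrowth_besselWeight hk _), fourierDensity,
    smul_eq_mul]
  ring

/-- Every function with the right weighted integrability is the Fourier density of a distribution
in `H^s`. -/
lemma exists_sobolev_of_density (hk : 0 < k) {H : Plane d → ℂ}
    (hH : MemLp (fun ξ ↦ (besselWeight k s ξ : ℂ) * H ξ) 2 volume) :
    ∃ u : sobolev d k s, fourierDensity u =ᵐ[volume] H := by
  set h : Lp ℂ 2 (volume : Measure (Plane d)) := hH.toLp with hh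
  set T : 𝓢'(Plane d, ℂ) := besselJ k (-s) (iotaL2 d (𝓕⁻ h)) with hT
  have hJ : besselJ k s T = iotaL2 d (𝓕⁻ h) := besselJ_besselJ hk s _
  refine ⟨⟨T, ⟨𝓕⁻ h, hJ.symm⟩⟩, ?_⟩
  have hrep : sobolevRep (⟨T, ⟨𝓕⁻ h, hJ.symm⟩⟩ : sobolev d k s) = 𝓕⁻ h :=
    iotaL2_injective d ((iotaL2_sobolevRep _).trans hJ)
  filter_upwards [hH.coeFn_toLp] with ξ hξ
  rw [fourierDensity, hrep, fourier_fourierInv_eq, hh, hξ, ← mul_assoc, ← Complex.ofReal_mul,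
    besselWeight_neg_mul hk, Complex.ofReal_one, one_mul]

lemma fourierDensity_schwartz (hk : 0 < k) (u : sobolev d k s) (φ : 𝓢(Plane d, ℂ))
    (hu : (u : 𝓢'(Plane d, ℂ)) = SchwartzMap.toTemperedDistributionCLM (Plane d) ℂ volume φ) :
    fourierDensity u =ᵐ[volume] fun ξ ↦ (𝓕 φ) ξ := by
  have hg := hasTemperateGrowth_besselWeight (d := d) hk s
  set φ' : 𝓢(Plane d, ℂ) := SchwartzMap.fourierMultiplierCLM ℂ
    (fun ξ : Plane d ↦ ((besselWeight k s ξ : ℝ) : ℂ)) φ with hφ'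
  have hrep : sobolevRep u = φ'.toLp 2 := by
    apply iotaL2_injective d
    rw [iotaL2_sobolevRep, hu, besselJ_eq, fourierMultiplierCLM_toTemperedDistributionCLM_eq hg]
    exact (Lp.toTemperedDistribution_toLp_eq φ').symm
  have hF : 𝓕 φ' = SchwartzMap.smulLeftCLM ℂ
      (fun ξ : Plane d ↦ ((besselWeight k s ξ : ℝ) : ℂ)) (𝓕 φ) := by
    rw [hφ', SchwartzMap.fourierMultiplierCLM_apply, fourier_fourierInv_eq]
  have h2 : 𝓕 (sobolevRep u) = (𝓕 φ').toLp 2 := by rw [hrep, SchwartzMap.toLp_fourier_eq]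
  filter_upwards [(𝓕 φ').coeFn_toLp 2 volume] with ξ hξ
  rw [fourierDensity, h2, hξ, hF, SchwartzMap.smulLeftCLM_apply_apply hg, smul_eq_mul, ← mul_assoc,
    ← Complex.ofReal_mul, besselWeight_neg_mul hk, Complex.ofReal_one, one_mul]

lemma dualPairing_eq_integral (hk : 0 < k) (u : sobolev d k s) (v : sobolev d k (-s)) :
    dualPairing u v = ∫ ξ, fourierDensity u ξ * starRingEnd ℂ (fourierDensity v ξ) := by
  rw [dualPairing, ← Lp.inner_fourier_eq, L2.inner_def]
  congr 1
  funext ξ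
  rw [← besselWeight_mul_fourierDensity hk u, ← besselWeight_mul_fourierDensity hk v,
    RCLike.inner_apply, map_mul, Complex.conj_ofReal]
  have := besselWeight_mul_neg hk s ξ
  have h2 : (besselWeight k s ξ : ℂ) * (besselWeight k (-s) ξ : ℂ) = 1 := by exact_mod_cast this
  linear_combination (fourierDensity u ξ * starRingEnd ℂ (fourierDensity v ξ)) * h2

lemma fourierDensity_add (u v : sobolev d k s) :
    fourierDensity (u + v) =ᵐ[volume] fun ξ ↦ fourierDensity u ξ + fourierDensity v ξ := by
  have h : 𝓕 (sobolevRep (u + v)) = 𝓕 (sobolevRep u) + 𝓕 (sobolevRep v) := by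
    rw [map_add, FourierAdd.fourier_add]
  filter_upwards [Lp.coeFn_add (𝓕 (sobolevRep u)) (𝓕 (sobolevRep v))] with ξ hξ
  rw [fourierDensity, h, hξ, Pi.add_apply, mul_add]
  rfl

lemma fourierDensity_smul (c : ℂ) (u : sobolev d k s) :
    fourierDensity (c • u) =ᵐ[volume] fun ξ ↦ c * fourierDensity u ξ := by
  have h : 𝓕 (sobolevRep (c • u)) = c • 𝓕 (sobolevRep u) := by
    rw [map_smul, FourierSMul.fourier_smul]
  filter_upwards [Lp.coeFn_smul c (𝓕 (sobolevRep u))] with ξ hξ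
  rw [fourierDensity, h, hξ, Pi.smul_apply, smul_eq_mul, fourierDensity]
  ring

lemma fourierDensity_sub (u v : sobolev d k s) :
    fourierDensity (u - v) =ᵐ[volume] fun ξ ↦ fourierDensity u ξ - fourierDensity v ξ := by
  filter_upwards [fourierDensity_add u ((-1 : ℂ) • v), fourierDensity_smul (-1) v] with ξ h1 h2
  rw [sub_eq_add_neg, show -v = (-1 : ℂ) • v by simp, h1, h2]
  ring

/-- Functions in the dual weighted space integrate Fourier densities, with the norm bound. -/
lemma integrable_mul_fourierDensity (hk : 0 < k) {q : Plane d → ℂ}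
    (hq : MemLp (fun ξ ↦ (besselWeight k (-s) ξ : ℂ) * q ξ) 2 volume) (u : sobolev d k s) :
    Integrable (fun ξ ↦ q ξ * fourierDensity u ξ) ∧
    ‖∫ ξ, q ξ * fourierDensity u ξ‖ ≤
      (eLpNorm (fun ξ ↦ (besselWeight k (-s) ξ : ℂ) * q ξ) 2 volume).toReal * sobolevNorm u := by
  have hu := memLp_fourierDensity hk u
  have e : (fun ξ ↦ q ξ * fourierDensity u ξ) = fun ξ ↦ ((besselWeight k (-s) ξ : ℂ) * q ξ) *
      ((besselWeight k s ξ : ℂ) * fourierDensity u ξ) := by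
    funext ξ
    have := besselWeight_mul_neg hk s ξ
    have h2 : (besselWeight k s ξ : ℂ) * (besselWeight k (-s) ξ : ℂ) = 1 := by exact_mod_cast this
    linear_combination (-(q ξ * fourierDensity u ξ)) * h2
  rw [e]
  refine ⟨hq.integrable_mul hu, ?_⟩
  have h1 : eLpNorm (fun ξ ↦ ((besselWeight k (-s) ξ : ℂ) * q ξ) *
      ((besselWeight k s ξ : ℂ) * fourierDensity u ξ)) 1 volume ≤
      eLpNorm (fun ξ ↦ (besselWeight k (-s) ξ : ℂ) * q ξ) 2 volume *
      eLpNorm (fun ξ ↦ (besselWeight k s ξ : ℂ) * fourierDensity u ξ) 2 volume := by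
    have := eLpNorm_smul_le_mul_eLpNorm (p := 2) (q := 2) (r := 1) hu.1 hq.1
    exact this
  rw [eLpNorm_fourierDensity hk] at h1
  calc _ ≤ ∫ ξ, ‖((besselWeight k (-s) ξ : ℂ) * q ξ) *
      ((besselWeight k s ξ : ℂ) * fourierDensity u ξ)‖ := norm_integral_le_integral_norm _
    _ = (eLpNorm (fun ξ ↦ ((besselWeight k (-s) ξ : ℂ) * q ξ) *
      ((besselWeight k s ξ : ℂ) * fourierDensity u ξ)) 1 volume).toReal := by
        rw [eLpNorm_one_eq_lintegral_enorm]
        exact integral_norm_eq_lintegral_enorm (hq.1.mul hu.1)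
    _ ≤ _ := by
        have := ENNReal.toReal_mono (ENNReal.mul_ne_top hq.2.ne ENNReal.ofReal_ne_top) h1
        rwa [ENNReal.toReal_mul, ENNReal.toReal_ofReal (by exact norm_nonneg _ : 0 ≤ sobolevNorm u)]
          at this

end density

/-! ### Approximation by test functions, and low frequencies -/

lemma fourier_comp_sub {d : ℕ} (f : 𝓢(Plane d, ℂ)) (η x : Plane d) :
    (𝓕 (SchwartzMap.compSubConstCLM ℂ η f)) x =
      Complex.exp (-(2 * Real.pi * Complex.I * (inner ℝ x η : ℝ))) * (𝓕 f) x := by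
  rw [SchwartzMap.fourier_coe, SchwartzMap.fourier_coe, Real.fourier_eq', Real.fourier_eq',
    ← integral_const_mul, ← integral_add_right_eq_self _ η]
  congr 1
  funext v
  simp only [SchwartzMap.compSubConstCLM_apply, add_sub_cancel_right, smul_eq_mul]
  rw [← mul_assoc, ← Complex.exp_add, inner_add_left, real_inner_comm x η]
  congr 2
  push_cast
  ring

lemma fourierInv_comp_sub {d : ℕ} (f : 𝓢(Plane d, ℂ)) (η x : Plane d) :
    (𝓕⁻ (SchwartzMap.compSubConstCLM ℂ η f)) x =
      Complex.exp (2 * Real.pi * Complex.I * (inner ℝ x η : ℝ)) * (𝓕⁻ f) x := by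
  rw [SchwartzMap.fourierInv_coe, SchwartzMap.fourierInv_coe, Real.fourierInv_eq',
    Real.fourierInv_eq', ← integral_const_mul, ← integral_add_right_eq_self _ η]
  congr 1
  funext v
  simp only [SchwartzMap.compSubConstCLM_apply, add_sub_cancel_right, smul_eq_mul]
  rw [← mul_assoc, ← Complex.exp_add, inner_add_left, real_inner_comm x η]
  congr 2
  push_cast
  ring

/-- Peetre's inequality for the weight of order `1/2`. -/
lemma exists_besselWeight_half_le (d : ℕ) {k : ℝ} (hk : 0 < k) : ∃ C : ℝ, 0 < C ∧
    ∀ ξ η : Plane d, besselWeight k (1 / 2) ξ ≤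
      C * (1 + ‖ξ - η‖) * besselWeight k (1 / 2) η := by
  set M : ℝ := 2 + 8 * Real.pi ^ 2 / k ^ 2 with hM
  have hM1 : 1 ≤ M := by
    have : 0 ≤ 8 * Real.pi ^ 2 / k ^ 2 := by positivity
    linarith
  refine ⟨M ^ ((1 / 2 : ℝ) / 2), by positivity, fun ξ η ↦ ?_⟩
  have h1 : k ^ 2 + (2 * Real.pi * ‖ξ‖) ^ 2 ≤
      M * (1 + ‖ξ - η‖) ^ 2 * (k ^ 2 + (2 * Real.pi * ‖η‖) ^ 2) := by
    have htri : ‖ξ‖ ≤ ‖ξ - η‖ + ‖η‖ := by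
      simpa using norm_add_le (ξ - η) η
    have hsq : ‖ξ‖ ^ 2 ≤ 2 * ‖ξ - η‖ ^ 2 + 2 * ‖η‖ ^ 2 := by
      nlinarith [norm_nonneg ξ, norm_nonneg η, norm_nonneg (ξ - η), sq_nonneg (‖ξ - η‖ - ‖η‖)]
    have e1 : M * k ^ 2 = 2 * k ^ 2 + 8 * Real.pi ^ 2 := by rw [hM]; field_simp
    have e2 : 1 ≤ (1 + ‖ξ - η‖) ^ 2 := by nlinarith [norm_nonneg (ξ - η)]
    have e3 : ‖ξ - η‖ ^ 2 ≤ (1 + ‖ξ - η‖) ^ 2 := by nlinarith [norm_nonneg (ξ - η)]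
    have hpi : 0 ≤ 4 * Real.pi ^ 2 := by positivity
    have e4 : (2 * Real.pi * ‖η‖) ^ 2 * 2 ≤ M * (1 + ‖ξ - η‖) ^ 2 * (2 * Real.pi * ‖η‖) ^ 2 := by
      have : 2 ≤ M * (1 + ‖ξ - η‖) ^ 2 := by
        have : 2 ≤ M := by rw [hM]; have : 0 ≤ 8 * Real.pi ^ 2 / k ^ 2 := by positivity
                           linarith
        nlinarith
      nlinarith [sq_nonneg (2 * Real.pi * ‖η‖)]
    have e5 : k ^ 2 + 8 * Real.pi ^ 2 * ‖ξ - η‖ ^ 2 ≤ M * (1 + ‖ξ - η‖) ^ 2 * k ^ 2 := by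
      have : M * (1 + ‖ξ - η‖) ^ 2 * k ^ 2 = (2 * k ^ 2 + 8 * Real.pi ^ 2) * (1 + ‖ξ - η‖) ^ 2 := by
        rw [← e1]; ring
      rw [this]
      nlinarith [sq_nonneg k, mul_nonneg hpi (sub_nonneg.2 e3), mul_nonneg (sq_nonneg k)
        (sub_nonneg.2 e2)]
    nlinarith
  unfold besselWeight
  calc _ ≤ (M * (1 + ‖ξ - η‖) ^ 2 * (k ^ 2 + (2 * Real.pi * ‖η‖) ^ 2)) ^ ((1 / 2 : ℝ) / 2) :=
        Real.rpow_le_rpow (by positivity) h1 (by norm_num)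
    _ = M ^ ((1 / 2 : ℝ) / 2) * (1 + ‖ξ - η‖) ^ (1 / 2 : ℝ) *
        (k ^ 2 + (2 * Real.pi * ‖η‖) ^ 2) ^ ((1 / 2 : ℝ) / 2) := by
        rw [Real.mul_rpow (by positivity) (by positivity), Real.mul_rpow (by positivity)
          (by positivity), ← Real.rpow_natCast (1 + ‖ξ - η‖), ← Real.rpow_mul (by positivity)]
        norm_num
    _ ≤ _ := by
        gcongr
        calc (1 + ‖ξ - η‖) ^ (1 / 2 : ℝ) ≤ (1 + ‖ξ - η‖) ^ (1 : ℝ) :=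
              Real.rpow_le_rpow_of_exponent_le (by linarith [norm_nonneg (ξ - η)]) (by norm_num)
          _ = _ := Real.rpow_one _

lemma memLp_one_add_norm_mul {d : ℕ} (f : 𝓢(Plane d, ℂ)) (p : ENNReal) :
    MemLp (fun ξ ↦ ((1 + ‖ξ‖ : ℝ) : ℂ) * f ξ) p volume := by
  have h1 : MemLp (fun ξ ↦ ((1 + ‖ξ‖ ^ 2 : ℝ) : ℂ) * f ξ) p volume := by
    have hg : (fun ξ : Plane d ↦ ((1 + ‖ξ‖ ^ 2 : ℝ) : ℂ)).HasTemperateGrowth :=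
      Function.HasTemperateGrowth.comp (g := Complex.ofReal) (by fun_prop)
        ((Function.HasTemperateGrowth.const 1).add (by fun_prop))
    have := (SchwartzMap.smulLeftCLM ℂ (fun ξ : Plane d ↦ ((1 + ‖ξ‖ ^ 2 : ℝ) : ℂ)) f).memLp p volume
    refine this.ae_eq (Filter.Eventually.of_forall fun ξ ↦ ?_)
    rw [SchwartzMap.smulLeftCLM_apply_apply hg, smul_eq_mul]
  refine (h1.const_mul 2).mono (by fun_prop) (Filter.Eventually.of_forall fun ξ ↦ ?_)
  rw [norm_mul, norm_mul, norm_mul, Complex.norm_real, Complex.norm_real,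
    Real.norm_of_nonneg (by positivity), Real.norm_of_nonneg (by positivity), Complex.norm_ofNat,
    ← mul_assoc]
  gcongr
  nlinarith [sq_nonneg (‖ξ‖ - 1), norm_nonneg ξ]

/-- A Schwartz cutoff that equals `1` on a bounded set. -/
lemma exists_schwartz_cutoff {d : ℕ} {Γ : Set (Plane d)} (hΓ : Bornology.IsBounded Γ) :
    ∃ cut : 𝓢(Plane d, ℂ), ∀ x ∈ Γ, cut x = 1 := by
  obtain ⟨R, hR, hΓR⟩ := hΓ.subset_closedBall_lt 0 0
  let b : ContDiffBump (0 : Plane d) := ⟨R, R + 1, hR, by linarith⟩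
  have hc : HasCompactSupport (fun x ↦ ((b x : ℝ) : ℂ)) :=
    b.hasCompactSupport.comp_left (g := Complex.ofReal) rfl
  have hs : ContDiff ℝ ∞ (fun x ↦ ((b x : ℝ) : ℂ)) :=
    Complex.ofRealCLM.contDiff.comp b.contDiff
  refine ⟨hc.toSchwartzMap hs, fun x hx ↦ ?_⟩
  change ((b x : ℝ) : ℂ) = 1
  rw [b.one_of_mem_closedBall (hΓR hx), Complex.ofReal_one]

lemma sobolevNorm_sub_le {d : ℕ} {k s : ℝ} (u v : sobolev d k s) :
    sobolevNorm v ≤ sobolevNorm u + sobolevNorm (u - v) := by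
  unfold sobolevNorm
  rw [map_sub]
  have := norm_sub_norm_le (sobolevRep v) (sobolevRep u)
  rw [norm_sub_rev] at this
  linarith

/-- Elements of `H̃^s(Γ)` are limits of test functions. -/
lemma exists_testFunction_seq {d : ℕ} {k s : ℝ} {Γ : Set (Plane d)} {φ : sobolev d k s}
    (hφ : φ ∈ sobolevTilde k s Γ) :
    ∃ (u : ℕ → sobolev d k s) (θ : ℕ → 𝓢(Plane d, ℂ)),
      (∀ n, θ n ∈ testFunctions Γ ∧ (u n : 𝓢'(Plane d, ℂ)) =
        SchwartzMap.toTemperedDistributionCLM (Plane d) ℂ volume (θ n)) ∧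
      Filter.Tendsto (fun n ↦ sobolevNorm (φ - u n)) Filter.atTop (𝓝 0) := by
  have h : sobolevRep φ ∈ closure (((testSobolev k s Γ).map sobolevRep :
      Submodule ℂ (Lp ℂ 2 (volume : Measure (Plane d)))) : Set _) := hφ
  rw [mem_closure_iff_seq_limit] at h
  obtain ⟨x, hx, hlim⟩ := h
  choose u hu hux using hx
  choose θ hθ hθu using hu
  refine ⟨u, θ, fun n ↦ ⟨hθ n, (hθu n).symm⟩, ?_⟩
  have := (tendsto_iff_norm_sub_tendsto_zero.1 hlim)
  refine this.congr fun n ↦ ?_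
  rw [← hux n, sobolevNorm, map_sub, norm_sub_rev]

lemma tendsto_integral_mul_fourierDensity {d : ℕ} {k s : ℝ} (hk : 0 < k) {q : Plane d → ℂ}
    (hq : MemLp (fun ξ ↦ (besselWeight k (-s) ξ : ℂ) * q ξ) 2 volume) {φ : sobolev d k s}
    {u : ℕ → sobolev d k s}
    (hu : Filter.Tendsto (fun n ↦ sobolevNorm (φ - u n)) Filter.atTop (𝓝 0)) :
    Filter.Tendsto (fun n ↦ ∫ ξ, q ξ * fourierDensity (u n) ξ) Filter.atTop
      (𝓝 (∫ ξ, q ξ * fourierDensity φ ξ)) := by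
  rw [tendsto_iff_norm_sub_tendsto_zero]
  have hlim := hu.const_mul
    (eLpNorm (fun ξ ↦ (besselWeight k (-s) ξ : ℂ) * q ξ) 2 volume).toReal
  rw [mul_zero] at hlim
  refine squeeze_zero (fun _ ↦ norm_nonneg _) (fun n ↦ ?_) hlim
  refine le_trans (le_of_eq ?_) (integrable_mul_fourierDensity hk hq (φ - u n)).2
  rw [norm_sub_rev, ← integral_sub (integrable_mul_fourierDensity hk hq φ).1
    (integrable_mul_fourierDensity hk hq (u n)).1]
  congr 1
  refine integral_congr_ae ?_
  filter_upwards [fourierDensity_sub φ (u n)] with ξ hξ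
  rw [hξ, mul_sub]

lemma exists_ae_tendsto_fourierDensity {d : ℕ} {k s : ℝ} (hk : 0 < k) {φ : sobolev d k s}
    {u : ℕ → sobolev d k s}
    (hu : Filter.Tendsto (fun n ↦ sobolevNorm (φ - u n)) Filter.atTop (𝓝 0)) :
    ∃ ns : ℕ → ℕ, StrictMono ns ∧ ∀ᵐ ξ, Filter.Tendsto (fun n ↦ fourierDensity (u (ns n)) ξ)
      Filter.atTop (𝓝 (fourierDensity φ ξ)) := by
  have h1 : TendstoInMeasure volume
      (fun n ξ ↦ (besselWeight k s ξ : ℂ) * fourierDensity (u n) ξ) Filter.atTop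
      (fun ξ ↦ (besselWeight k s ξ : ℂ) * fourierDensity φ ξ) := by
    refine tendstoInMeasure_of_tendsto_eLpNorm (p := 2) (by norm_num)
      (fun n ↦ (memLp_fourierDensity hk (u n)).1) (memLp_fourierDensity hk φ).1 ?_
    have h2 : ∀ n, eLpNorm ((fun ξ ↦ (besselWeight k s ξ : ℂ) * fourierDensity (u n) ξ) -
        fun ξ ↦ (besselWeight k s ξ : ℂ) * fourierDensity φ ξ) 2 volume =
        ENNReal.ofReal (sobolevNorm (φ - u n)) := by
      intro n
      rw [← eLpNorm_fourierDensity hk, eLpNorm_sub_comm]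
      refine eLpNorm_congr_ae ?_
      filter_upwards [fourierDensity_sub φ (u n)] with ξ hξ
      rw [hξ, Pi.sub_apply, mul_sub]
    simp_rw [h2]
    simpa using ENNReal.tendsto_ofReal hu
  obtain ⟨ns, hns, hae⟩ := h1.exists_seq_tendsto_ae
  refine ⟨ns, hns, ?_⟩
  filter_upwards [hae] with ξ hξ
  have h3 := hξ.const_mul ((besselWeight k s ξ : ℂ)⁻¹)
  have hne : (besselWeight k s ξ : ℂ) ≠ 0 := by exact_mod_cast (besselWeight_pos hk s ξ).ne'
  simpa [inv_mul_cancel_left₀ hne] using h3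

/-- The Fourier transform of a test function on `Γ` is bounded at bounded frequencies by the
`H^{-1/2}` norm: it is the pairing with a modulated cutoff. -/
lemma exists_bound_fourier_testFunction {d : ℕ} {k : ℝ} (hk : 0 < k) {Γ : Set (Plane d)}
    (hΓ : Bornology.IsBounded Γ) (R : ℝ) :
    ∃ C : ℝ, 0 ≤ C ∧ ∀ (u : sobolev d k (-(1 / 2))) (θ : 𝓢(Plane d, ℂ)), θ ∈ testFunctions Γ →
      (u : 𝓢'(Plane d, ℂ)) = SchwartzMap.toTemperedDistributionCLM (Plane d) ℂ volume θ →
      ∀ ξ : Plane d, ‖ξ‖ ≤ R → ‖(𝓕 θ) ξ‖ ≤ C * sobolevNorm u := by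
  obtain ⟨cut, hcut⟩ := exists_schwartz_cutoff hΓ
  obtain ⟨C, hC, hpeetre⟩ := exists_besselWeight_half_le d hk
  set W : ℝ := (k ^ 2 + (2 * Real.pi * R) ^ 2) ^ ((1 / 2 : ℝ) / 2) with hW
  have hpi := Real.pi_pos
  have hWnn : 0 ≤ W := by positivity
  have hm := (memLp_one_add_norm_mul (𝓕⁻ cut) 2).const_mul ((C * W : ℝ) : ℂ)
  refine ⟨(eLpNorm (fun ξ ↦ ((C * W : ℝ) : ℂ) * (((1 + ‖ξ‖ : ℝ) : ℂ) * (𝓕⁻ cut) ξ)) 2 volume).toReal,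
    ENNReal.toReal_nonneg, fun u θ hθ hu ξ hξ ↦ ?_⟩
  set h : 𝓢(Plane d, ℂ) := SchwartzMap.compSubConstCLM ℂ ξ (𝓕⁻ cut) with hh
  have hmτ : MemLp (fun η ↦ ((C * W : ℝ) : ℂ) * (((1 + ‖η - ξ‖ : ℝ) : ℂ) * (𝓕⁻ cut) (η - ξ))) 2
      volume := hm.comp_measurePreserving (measurePreserving_sub_right volume ξ)
  have hle : ∀ η, ‖(besselWeight k (-(-(1 / 2))) η : ℂ) * h η‖ ≤
      ‖((C * W : ℝ) : ℂ) * (((1 + ‖η - ξ‖ : ℝ) : ℂ) * (𝓕⁻ cut) (η - ξ))‖ := by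
    intro η
    rw [neg_neg, norm_mul, norm_mul, norm_mul, Complex.norm_real, Complex.norm_real,
      Complex.norm_real, Real.norm_of_nonneg (besselWeight_pos hk _ _).le,
      Real.norm_of_nonneg (by positivity), Real.norm_of_nonneg (by positivity), hh,
      SchwartzMap.compSubConstCLM_apply, ← mul_assoc]
    gcongr
    have h1 : besselWeight k (1 / 2) ξ ≤ W := by
      unfold besselWeight
      exact Real.rpow_le_rpow (by positivity) (by gcongr) (by norm_num)
    calc _ ≤ C * (1 + ‖η - ξ‖) * besselWeight k (1 / 2) ξ := hpeetre η ξ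
      _ ≤ C * (1 + ‖η - ξ‖) * W := by gcongr
      _ = _ := by ring
  have hq : MemLp (fun η ↦ (besselWeight k (-(-(1 / 2))) η : ℂ) * h η) 2 volume := by
    refine hmτ.mono ?_ (Filter.Eventually.of_forall hle)
    exact ((Complex.continuous_ofReal.comp (continuous_besselWeight hk _)).mul
      h.continuous).aestronglyMeasurable
  -- Since the cutoff is `1` on `Γ`, the value `θ̂(ξ)` is the integral of `θ` against the cutoff
  -- modulated by `e^{-2πi x·ξ}`, and `h` is the inverse Fourier transform of the latter.
  have hval : (𝓕 θ) ξ = ∫ η, h η * fourierDensity u η := by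
    have e1 : ∫ η, h η * fourierDensity u η = ∫ η, (𝓕 θ) η * h η := by
      refine integral_congr_ae ?_
      filter_upwards [fourierDensity_schwartz hk u θ hu] with η hη
      rw [hη, mul_comm]
    rw [e1, SchwartzMap.integral_fourier_mul_eq, SchwartzMap.fourier_coe, Real.fourier_eq']
    congr 1
    funext x
    rw [hh, fourier_comp_sub, fourier_fourierInv_eq, smul_eq_mul]
    by_cases hx : θ x = 0
    · simp [hx]
    · rw [hcut x (hθ.2 (subset_tsupport _ hx)), mul_one, mul_comm]
      congr 2
      push_cast
      ring
  rw [hval]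
  refine (integrable_mul_fourierDensity hk hq u).2.trans ?_
  refine mul_le_mul_of_nonneg_right ?_ (norm_nonneg _)
  refine ENNReal.toReal_mono hm.2.ne ?_
  refine (eLpNorm_mono hle).trans (le_of_eq ?_)
  exact eLpNorm_comp_measurePreserving hm.1 (measurePreserving_sub_right volume ξ)

/-- Boundedness of `Γ` makes the Fourier densities of elements of `H̃^{-1/2}(Γ)` locally bounded. -/
lemma exists_bound_fourierDensity {d : ℕ} {k : ℝ} (hk : 0 < k) {Γ : Set (Plane d)}
    (hΓ : Bornology.IsBounded Γ) (R : ℝ) :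
    ∃ C : ℝ, 0 ≤ C ∧ ∀ φ ∈ sobolevTilde k (-(1 / 2)) Γ, ∀ᵐ ξ : Plane d,
      ‖ξ‖ ≤ R → ‖fourierDensity φ ξ‖ ≤ C * sobolevNorm φ := by
  obtain ⟨C, hC, hb⟩ := exists_bound_fourier_testFunction hk hΓ R
  refine ⟨C, hC, fun φ hφ ↦ ?_⟩
  obtain ⟨u, θ, hu, hlim⟩ := exists_testFunction_seq hφ
  obtain ⟨ns, hns, hae⟩ := exists_ae_tendsto_fourierDensity hk hlim
  have hall : ∀ᵐ ξ, ∀ n, fourierDensity (u n) ξ = (𝓕 (θ n)) ξ :=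
    ae_all_iff.2 fun n ↦ fourierDensity_schwartz hk (u n) (θ n) (hu n).2
  filter_upwards [hae, hall] with ξ h1 h2 hξ
  have h3 : Filter.Tendsto (fun n ↦ C * (sobolevNorm φ + sobolevNorm (φ - u (ns n)))) Filter.atTop
      (𝓝 (C * (sobolevNorm φ + 0))) :=
    ((hlim.comp hns.tendsto_atTop).const_add _).const_mul _
  rw [add_zero] at h3
  refine le_of_tendsto_of_tendsto' h1.norm h3 fun n ↦ ?_
  rw [h2]
  refine (hb (u (ns n)) (θ (ns n)) (hu _).1 (hu _).2 ξ hξ).trans ?_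
  gcongr
  exact sobolevNorm_sub_le _ _

/-! ### Multiplication by Schwartz functions in `H^{1/2}` -/

/-- The Cauchy–Schwarz inequality for weighted lower integrals. -/
lemma lintegral_mul_sq_le {α : Type*} [MeasurableSpace α] {μ : Measure α} {A b : α → ENNReal}
    (hA : AEMeasurable A μ) (hb : AEMeasurable b μ) :
    (∫⁻ x, A x * b x ∂μ) ^ 2 ≤ (∫⁻ x, A x ∂μ) * ∫⁻ x, A x * b x ^ 2 ∂μ := by
  have h := ENNReal.lintegral_mul_le_Lp_mul_Lq μ (p := 2) (q := 2)
    Real.HolderConjugate.two_two (hA.pow_const (1 / 2 : ℝ)) ((hA.pow_const (1 / 2 : ℝ)).mul hb)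
  have e0 : ∀ x : ENNReal, x ^ (1 / 2 : ℝ) * x ^ (1 / 2 : ℝ) = x := fun x ↦ by
    rw [← ENNReal.rpow_add_of_nonneg _ _ (by norm_num) (by norm_num)]; norm_num
  have e1 : ∫⁻ x, ((fun x ↦ A x ^ (1 / 2 : ℝ)) * ((fun x ↦ A x ^ (1 / 2 : ℝ)) * b)) x ∂μ =
      ∫⁻ x, A x * b x ∂μ := by
    refine lintegral_congr fun x ↦ ?_
    simp only [Pi.mul_apply]
    rw [← mul_assoc, e0]
  have e2 : ∫⁻ x, (A x ^ (1 / 2 : ℝ)) ^ (2 : ℝ) ∂μ = ∫⁻ x, A x ∂μ := by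
    refine lintegral_congr fun x ↦ ?_
    rw [← ENNReal.rpow_mul]; norm_num
  have e3 : ∫⁻ x, ((fun x ↦ A x ^ (1 / 2 : ℝ)) * b) x ^ (2 : ℝ) ∂μ = ∫⁻ x, A x * b x ^ 2 ∂μ := by
    refine lintegral_congr fun x ↦ ?_
    rw [Pi.mul_apply, ENNReal.mul_rpow_of_nonneg _ _ (by norm_num), ← ENNReal.rpow_mul]
    norm_num
  rw [e1, e2, e3] at h
  calc (∫⁻ x, A x * b x ∂μ) ^ 2 ≤ ((∫⁻ x, A x ∂μ) ^ (1 / (2 : ℝ)) *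
        (∫⁻ x, A x * b x ^ 2 ∂μ) ^ (1 / (2 : ℝ))) ^ 2 := by gcongr
    _ = _ := by rw [mul_pow, sq, sq, e0, e0]

/-- Young's inequality `L¹ ∗ L² ⊆ L²` for nonnegative functions. -/
lemma lintegral_conv_sq_le {d : ℕ} {A b : Plane d → ENNReal} (hA : Measurable A)
    (hb : AEMeasurable b) :
    ∫⁻ ξ, (∫⁻ η, A (ξ - η) * b η) ^ 2 ≤ (∫⁻ ξ, A ξ) ^ 2 * ∫⁻ η, b η ^ 2 := by
  have hsub : ∀ ξ : Plane d, ∫⁻ η, A (ξ - η) = ∫⁻ η, A η := fun ξ ↦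
    lintegral_sub_left_eq_self A ξ
  calc ∫⁻ ξ, (∫⁻ η, A (ξ - η) * b η) ^ 2
      ≤ ∫⁻ ξ, (∫⁻ η, A η) * ∫⁻ η, A (ξ - η) * b η ^ 2 := by
        refine lintegral_mono fun ξ ↦ ?_
        have := lintegral_mul_sq_le (μ := volume) (A := fun η ↦ A (ξ - η)) (b := b)
          (by fun_prop) hb
        rwa [hsub ξ] at this
    _ = (∫⁻ η, A η) * ∫⁻ ξ, ∫⁻ η, A (ξ - η) * b η ^ 2 := by
        refine lintegral_const_mul'' _ ?_
        refine AEMeasurable.lintegral_prod_right' (f := fun p : Plane d × Plane d ↦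
          A (p.1 - p.2) * b p.2 ^ 2) ?_
        exact AEMeasurable.mul (hA.comp (by fun_prop)).aemeasurable (hb.comp_snd.pow_const 2)
    _ = (∫⁻ η, A η) * ∫⁻ η, ∫⁻ ξ, A (ξ - η) * b η ^ 2 := by
        rw [lintegral_lintegral_swap]
        exact AEMeasurable.mul (hA.comp (by fun_prop)).aemeasurable (hb.comp_snd.pow_const 2)
    _ = (∫⁻ η, A η) * ∫⁻ η, (∫⁻ ξ, A ξ) * b η ^ 2 := by
        congr 1
        refine lintegral_congr fun η ↦ ?_
        rw [lintegral_mul_const _ (by fun_prop), lintegral_sub_right_eq_self A η]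
    _ = _ := by
        rw [lintegral_const_mul'' _ (hb.pow_const 2), ← mul_assoc, sq]

/-- Young's inequality `L² ∗ L¹ ⊆ L²` for nonnegative functions. -/
lemma lintegral_conv_sq_le' {d : ℕ} {A b : Plane d → ENNReal} (hA : Measurable A)
    (hb : AEMeasurable b) :
    ∫⁻ ξ, (∫⁻ η, A (ξ - η) * b η) ^ 2 ≤ (∫⁻ ξ, A ξ ^ 2) * (∫⁻ η, b η) ^ 2 := by
  calc ∫⁻ ξ, (∫⁻ η, A (ξ - η) * b η) ^ 2
      ≤ ∫⁻ ξ, (∫⁻ η, b η) * ∫⁻ η, b η * A (ξ - η) ^ 2 := by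
        refine lintegral_mono fun ξ ↦ ?_
        have := lintegral_mul_sq_le (μ := volume) (A := b) (b := fun η ↦ A (ξ - η)) hb
          (by fun_prop)
        simpa only [mul_comm] using this
    _ = (∫⁻ η, b η) * ∫⁻ ξ, ∫⁻ η, b η * A (ξ - η) ^ 2 := by
        refine lintegral_const_mul'' _ ?_
        refine AEMeasurable.lintegral_prod_right' (f := fun p : Plane d × Plane d ↦
          b p.2 * A (p.1 - p.2) ^ 2) ?_
        exact AEMeasurable.mul hb.comp_snd ((hA.comp (by fun_prop)).pow_const 2).aemeasurable
    _ = (∫⁻ η, b η) * ∫⁻ η, ∫⁻ ξ, b η * A (ξ - η) ^ 2 := by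
        rw [lintegral_lintegral_swap]
        exact AEMeasurable.mul hb.comp_snd ((hA.comp (by fun_prop)).pow_const 2).aemeasurable
    _ = (∫⁻ η, b η) * ∫⁻ η, b η * ∫⁻ ξ, A ξ ^ 2 := by
        congr 1
        refine lintegral_congr fun η ↦ ?_
        rw [lintegral_const_mul _ (by fun_prop), lintegral_sub_right_eq_self (fun ξ ↦ A ξ ^ 2) η]
    _ = _ := by
        rw [lintegral_mul_const'' _ hb, ← mul_assoc, sq, mul_comm]

lemma memLp_two_iff_lintegral {α : Type*} [MeasurableSpace α] {μ : Measure α} {f : α → ℂ}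
    (hf : AEStronglyMeasurable f μ) : MemLp f 2 μ ↔ ∫⁻ x, ‖f x‖ₑ ^ 2 ∂μ < ⊤ := by
  rw [MemLp, and_iff_right hf, eLpNorm_lt_top_iff_lintegral_rpow_enorm_lt_top (by norm_num)
    (by norm_num)]
  simp

/-- Integrability on a product by Tonelli and Cauchy–Schwarz, if the inner integrals are dominated by
the product of two square integrable functions. -/
lemma integrable_uncurry_of_lintegral_le_mul {α β : Type*} [MeasurableSpace α]
    [MeasurableSpace β] {μ : Measure α} {ν : Measure β} [SFinite ν] {F : α → β → ℂ}
    (hF : AEStronglyMeasurable (Function.uncurry F) (μ.prod ν)) {q K : α → ENNReal}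
    (hq : AEMeasurable q μ) (hK : AEMeasurable K μ) (hq2 : ∫⁻ x, q x ^ 2 ∂μ < ⊤)
    (hK2 : ∫⁻ x, K x ^ 2 ∂μ < ⊤) (h : ∀ x, ∫⁻ y, ‖F x y‖ₑ ∂ν ≤ q x * K x) :
    Integrable (Function.uncurry F) (μ.prod ν) := by
  refine ⟨hF, ?_⟩
  rw [HasFiniteIntegral, lintegral_prod _ hF.enorm]
  refine lt_of_le_of_lt (lintegral_mono h) ?_
  refine lt_of_le_of_lt (ENNReal.lintegral_mul_le_Lp_mul_Lq μ Real.HolderConjugate.two_two hq hK) ?_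
  refine ENNReal.mul_lt_top ?_ ?_
  · refine ENNReal.rpow_lt_top_of_nonneg (by norm_num) ?_
    simpa using hq2.ne
  · refine ENNReal.rpow_lt_top_of_nonneg (by norm_num) ?_
    simpa using hK2.ne

lemma memLp_besselWeight_mul {d : ℕ} {k : ℝ} (hk : 0 < k) (s : ℝ) (f : 𝓢(Plane d, ℂ)) :
    MemLp (fun ξ ↦ (besselWeight k s ξ : ℂ) * f ξ) 2 volume := by
  have := (SchwartzMap.smulLeftCLM ℂ (fun ξ : Plane d ↦ ((besselWeight k s ξ : ℝ) : ℂ)) f).memLp 2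
    volume
  refine this.ae_eq (Filter.Eventually.of_forall fun ξ ↦ ?_)
  rw [SchwartzMap.smulLeftCLM_apply_apply (hasTemperateGrowth_besselWeight hk s), smul_eq_mul]

/-- The Fourier transform maps multiplication by `w₀` to convolution with `𝓕 w₀`; in the dual form
needed for distributions. -/
lemma fourierInv_mul_eq_integral {d : ℕ} (w₀ w : 𝓢(Plane d, ℂ)) (η : Plane d) :
    ∫ ξ, (𝓕 w₀) (ξ - η) * (𝓕⁻ w) ξ = (𝓕⁻ (SchwartzMap.smulLeftCLM ℂ w₀ w)) η := by
  have h := SchwartzMap.integral_fourierInv_mul_eq (SchwartzMap.compSubConstCLM ℂ η (𝓕 w₀)) w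
  simp only [SchwartzMap.compSubConstCLM_apply] at h
  rw [← h, SchwartzMap.fourierInv_coe (SchwartzMap.smulLeftCLM ℂ w₀ w), Real.fourierInv_eq']
  congr 1
  funext x
  rw [fourierInv_comp_sub, fourierInv_fourier_eq,
    SchwartzMap.smulLeftCLM_apply_apply w₀.hasTemperateGrowth, smul_eq_mul, smul_eq_mul, ← mul_assoc]
  congr 3
  push_cast
  ring

lemma aestronglyMeasurable_of_besselWeight_mul {d : ℕ} {k s : ℝ} (hk : 0 < k) {c : Plane d → ℂ}
    (h : AEStronglyMeasurable (fun ξ ↦ (besselWeight k s ξ : ℂ) * c ξ) volume) :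
    AEStronglyMeasurable c volume := by
  refine ((Complex.continuous_ofReal.comp
    (continuous_besselWeight hk (-s))).aestronglyMeasurable.mul h).congr
    (Filter.Eventually.of_forall fun ξ ↦ ?_)
  simp only [Pi.mul_apply, Function.comp_apply]
  rw [← mul_assoc, ← Complex.ofReal_mul, besselWeight_neg_mul hk, Complex.ofReal_one, one_mul]

/-- Peetre's inequality and Young's inequality: the convolution of a Schwartz function with a
density in the sum of the weighted spaces `L¹` and `L²` converges absolutely and is weighted
`L²`. -/
lemma exists_convolution_majorant {d : ℕ} {k : ℝ} (hk : 0 < k) {c₁ c₂ : Plane d → ℂ}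
    (h₁ : Integrable (fun ξ ↦ (besselWeight k (1 / 2) ξ : ℂ) * c₁ ξ))
    (h₂ : MemLp (fun ξ ↦ (besselWeight k (1 / 2) ξ : ℂ) * c₂ ξ) 2 volume) (w : 𝓢(Plane d, ℂ)) :
    ∃ K : Plane d → ENNReal, AEMeasurable K ∧ ∫⁻ ξ, K ξ ^ 2 < ⊤ ∧ ∀ ξ,
      ∫⁻ η, ‖(besselWeight k (1 / 2) ξ : ℂ) * (w (ξ - η) * (c₁ η + c₂ η))‖ₑ ≤ K ξ := by
  obtain ⟨C, hC, hpeetre⟩ := exists_besselWeight_half_le d hk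
  set A : Plane d → ENNReal := fun ζ ↦ ‖(C : ℂ) * (((1 + ‖ζ‖ : ℝ) : ℂ) * w ζ)‖ₑ with hA
  have hAm : Measurable A := by rw [hA]; exact Continuous.measurable (by fun_prop)
  have hA1 : ∫⁻ ζ, A ζ < ⊤ :=
    ((memLp_one_iff_integrable.1 (memLp_one_add_norm_mul w 1)).const_mul (C : ℂ)).2
  have hA2 : ∫⁻ ζ, A ζ ^ 2 < ⊤ :=
    (memLp_two_iff_lintegral (by fun_prop)).1 ((memLp_one_add_norm_mul w 2).const_mul (C : ℂ))
  set b₁ : Plane d → ENNReal := fun η ↦ ‖(besselWeight k (1 / 2) η : ℂ) * c₁ η‖ₑ with hb₁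
  set b₂ : Plane d → ENNReal := fun η ↦ ‖(besselWeight k (1 / 2) η : ℂ) * c₂ η‖ₑ with hb₂
  have hb₁m : AEMeasurable b₁ := h₁.1.enorm
  have hb₂m : AEMeasurable b₂ := h₂.1.enorm
  set K : Plane d → ENNReal := fun ξ ↦ ∫⁻ η, A (ξ - η) * (b₁ η + b₂ η) with hK
  have hKm : AEMeasurable K := by
    refine AEMeasurable.lintegral_prod_right' (f := fun p : Plane d × Plane d ↦
      A (p.1 - p.2) * (b₁ p.2 + b₂ p.2)) ?_
    exact AEMeasurable.mul (hAm.comp (by fun_prop)).aemeasurable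
      (hb₁m.comp_snd.add hb₂m.comp_snd)
  have hK2 : ∫⁻ ξ, K ξ ^ 2 < ⊤ := by
    have e : ∀ ξ, K ξ = (∫⁻ η, A (ξ - η) * b₁ η) + ∫⁻ η, A (ξ - η) * b₂ η := by
      intro ξ
      rw [hK]
      simp only [mul_add]
      exact lintegral_add_left' (AEMeasurable.mul (by fun_prop) hb₁m) _
    have hsq : ∀ x y : ENNReal, (x + y) ^ 2 ≤ 2 * (x ^ 2 + y ^ 2) := by
      intro x y
      have := ENNReal.rpow_add_le_mul_rpow_add_rpow x y (p := 2) (by norm_num)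
      norm_num at this
      simpa using this
    calc ∫⁻ ξ, K ξ ^ 2 ≤ ∫⁻ ξ, 2 * ((∫⁻ η, A (ξ - η) * b₁ η) ^ 2 +
          (∫⁻ η, A (ξ - η) * b₂ η) ^ 2) := lintegral_mono fun ξ ↦ by rw [e]; exact hsq _ _
      _ = 2 * ((∫⁻ ξ, (∫⁻ η, A (ξ - η) * b₁ η) ^ 2) + ∫⁻ ξ, (∫⁻ η, A (ξ - η) * b₂ η) ^ 2) := by
          rw [lintegral_const_mul' _ _ (by norm_num), lintegral_add_left']
          refine AEMeasurable.pow_const ?_ 2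
          refine AEMeasurable.lintegral_prod_right' (f := fun p : Plane d × Plane d ↦
            A (p.1 - p.2) * b₁ p.2) ?_
          exact AEMeasurable.mul (hAm.comp (by fun_prop)).aemeasurable hb₁m.comp_snd
      _ ≤ 2 * ((∫⁻ ξ, A ξ ^ 2) * (∫⁻ η, b₁ η) ^ 2 + (∫⁻ ξ, A ξ) ^ 2 * ∫⁻ η, b₂ η ^ 2) := by
          gcongr
          · exact lintegral_conv_sq_le' hAm hb₁m
          · exact lintegral_conv_sq_le hAm hb₂m
      _ < ⊤ := by
          have hb1 : ∫⁻ η, b₁ η < ⊤ := h₁.2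
          have hb2 : ∫⁻ η, b₂ η ^ 2 < ⊤ := (memLp_two_iff_lintegral h₂.1).1 h₂
          exact ENNReal.mul_lt_top (by norm_num) (ENNReal.add_lt_top.2
            ⟨ENNReal.mul_lt_top hA2 (ENNReal.pow_lt_top hb1),
              ENNReal.mul_lt_top (ENNReal.pow_lt_top hA1) hb2⟩)
  refine ⟨K, hKm, hK2, fun ξ ↦ lintegral_mono fun η ↦ ?_⟩
  have hpt : ∀ ξ η, ‖(besselWeight k (1 / 2) ξ : ℂ) * (w (ξ - η) * (c₁ η + c₂ η))‖ₑ ≤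
      A (ξ - η) * (b₁ η + b₂ η) := by
    intro ξ η
    have h1 : ‖(besselWeight k (1 / 2) ξ : ℂ) * (w (ξ - η) * (c₁ η + c₂ η))‖ₑ ≤
        A (ξ - η) * ‖(besselWeight k (1 / 2) η : ℂ) * (c₁ η + c₂ η)‖ₑ := by
      rw [hA]
      simp only
      rw [← enorm_mul, enorm_le_iff_norm_le]
      simp only [norm_mul, Complex.norm_real]
      rw [Real.norm_of_nonneg (besselWeight_pos hk _ _).le,
        Real.norm_of_nonneg (besselWeight_pos hk _ _).le, Real.norm_of_nonneg hC.le,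
        Real.norm_of_nonneg (by positivity)]
      calc besselWeight k (1 / 2) ξ * (‖w (ξ - η)‖ * ‖c₁ η + c₂ η‖) ≤
          (C * (1 + ‖ξ - η‖) * besselWeight k (1 / 2) η) * (‖w (ξ - η)‖ * ‖c₁ η + c₂ η‖) := by
            gcongr; exact hpeetre ξ η
        _ = _ := by ring
    refine h1.trans ?_
    gcongr
    rw [mul_add]
    exact enorm_add_le _ _
  exact hpt ξ η

/-- If the density `c` lies locally in the `H^{1/2}` class, in the sense that it is the sum of a
weighted `L¹` and a weighted `L²` function, then the product of the corresponding distribution with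
a Schwartz function lies in `H^{1/2}(ℝᵈ)`. -/
lemma exists_sobolev_mul {d : ℕ} {k : ℝ} (hk : 0 < k) {c₁ c₂ : Plane d → ℂ}
    (h₁ : Integrable (fun ξ ↦ (besselWeight k (1 / 2) ξ : ℂ) * c₁ ξ))
    (h₂ : MemLp (fun ξ ↦ (besselWeight k (1 / 2) ξ : ℂ) * c₂ ξ) 2 volume) (w₀ : 𝓢(Plane d, ℂ)) :
    ∃ g : sobolev d k (1 / 2), ∀ w : 𝓢(Plane d, ℂ), (g : 𝓢'(Plane d, ℂ)) w =
      ∫ ξ, (c₁ ξ + c₂ ξ) * (𝓕⁻ (SchwartzMap.smulLeftCLM ℂ w₀ w)) ξ := by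
  obtain ⟨K, hKm, hK2, hKb⟩ := exists_convolution_majorant hk h₁ h₂ (𝓕 w₀)
  have hmeasW : ∀ s : ℝ, Continuous (fun ξ : Plane d ↦ (besselWeight k s ξ : ℂ)) := fun s ↦
    Complex.continuous_ofReal.comp (continuous_besselWeight hk s)
  have hcm : AEStronglyMeasurable (fun ξ ↦ c₁ ξ + c₂ ξ) volume :=
    (aestronglyMeasurable_of_besselWeight_mul hk h₁.1).add
      (aestronglyMeasurable_of_besselWeight_mul hk h₂.1)
  set H : Plane d → ℂ := fun ξ ↦ ∫ η, (𝓕 w₀) (ξ - η) * (c₁ η + c₂ η) with hH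
  have hprodm : AEStronglyMeasurable (fun p : Plane d × Plane d ↦ (𝓕 w₀) (p.1 - p.2) * (c₁ p.2 + c₂ p.2))
      (volume.prod volume) :=
    ((𝓕 w₀).continuous.comp (by fun_prop)).aestronglyMeasurable.mul hcm.comp_snd
  have hHm : AEStronglyMeasurable H volume := hprodm.integral_prod_right'
  have hHL : MemLp (fun ξ ↦ (besselWeight k (1 / 2) ξ : ℂ) * H ξ) 2 volume := by
    refine (memLp_two_iff_lintegral ((hmeasW _).aestronglyMeasurable.mul hHm)).2 ?_
    refine lt_of_le_of_lt (lintegral_mono fun ξ ↦ ?_) hK2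
    refine pow_le_pow_left' ?_ 2
    rw [hH]
    simp only [Pi.mul_apply]
    rw [← integral_const_mul]
    exact (enorm_integral_le_lintegral_enorm _).trans (hKb ξ)
  obtain ⟨g, hg⟩ := exists_sobolev_of_density hk hHL
  refine ⟨g, fun w ↦ ?_⟩
  rw [sobolev_apply hk]
  have e1 : ∫ ξ, fourierDensity g ξ * (𝓕⁻ w) ξ =
      ∫ ξ, ∫ η, (𝓕 w₀) (ξ - η) * (c₁ η + c₂ η) * (𝓕⁻ w) ξ := by
    refine integral_congr_ae ?_
    filter_upwards [hg] with ξ hξ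
    rw [hξ, hH, integral_mul_const]
  have hint : Integrable (Function.uncurry fun ξ η ↦ (𝓕 w₀) (ξ - η) * (c₁ η + c₂ η) * (𝓕⁻ w) ξ)
      (volume.prod volume) := by
    have hm : AEStronglyMeasurable (Function.uncurry fun ξ η ↦ (𝓕 w₀) (ξ - η) * (c₁ η + c₂ η) * (𝓕⁻ w) ξ)
        (volume.prod volume) :=
      hprodm.mul ((𝓕⁻ w).continuous.comp continuous_fst).aestronglyMeasurable
    set q : Plane d → ENNReal := fun ξ ↦ ‖(besselWeight k (-(1 / 2)) ξ : ℂ) * (𝓕⁻ w) ξ‖ₑ with hq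
    have hqm : AEMeasurable q := by
      refine Continuous.aemeasurable ?_
      exact ((hmeasW _).mul (𝓕⁻ w).continuous).enorm
    have hq2 : ∫⁻ ξ, q ξ ^ 2 < ⊤ :=
      have hS := memLp_besselWeight_mul hk (-(1 / 2)) (𝓕⁻ w)
      (memLp_two_iff_lintegral hS.1).1 hS
    have hbound : ∀ ξ, ∫⁻ η, ‖(𝓕 w₀) (ξ - η) * (c₁ η + c₂ η) * (𝓕⁻ w) ξ‖ₑ ≤ q ξ * K ξ := by
      intro ξ
      refine le_trans ?_ (mul_le_mul_right (hKb ξ) _)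
      rw [← lintegral_const_mul' _ _ enorm_ne_top]
      refine lintegral_mono fun η ↦ le_of_eq ?_
      simp only
      rw [← enorm_mul]
      congr 1
      have : (besselWeight k (1 / 2) ξ : ℂ) * (besselWeight k (-(1 / 2)) ξ : ℂ) = 1 := by
        exact_mod_cast besselWeight_mul_neg hk (1 / 2) ξ
      linear_combination (-((𝓕 w₀) (ξ - η) * (c₁ η + c₂ η) * (𝓕⁻ w) ξ)) * this
    exact integrable_uncurry_of_lintegral_le_mul hm hqm hKm hq2 hK2 hbound
  rw [e1, integral_integral_swap hint]
  congr 1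
  funext η
  rw [← fourierInv_mul_eq_integral, ← integral_const_mul]
  congr 1
  funext ξ
  ring

/-! ### Superpositions of plane waves and `L²` estimates -/

/-- An `L¹ ∩ L²` form of Plancherel's theorem: the inverse Fourier integral does not increase the
`L²` norm. -/
lemma lintegral_fourierInv_sq_le {d : ℕ} {f : Plane d → ℂ} (hf : Integrable f)
    (hf2 : MemLp f 2 volume) : ∫⁻ x, ‖(𝓕⁻ f) x‖ₑ ^ 2 ≤ ∫⁻ ξ, ‖f ξ‖ₑ ^ 2 := by
  set F : Lp ℂ 2 (volume : Measure (Plane d)) := hf2.toLp with hF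
  have hcont : Continuous (𝓕⁻ f) := by
    have h : 𝓕⁻ f = fun x ↦ 𝓕 f (-x) := by funext x; exact Real.fourierInv_eq_fourier_neg f x
    rw [h]
    exact (VectorFourier.fourierIntegral_continuous Real.continuous_fourierChar
      (L := innerₗ (Plane d)) continuous_inner hf).comp continuous_neg
  have hae : 𝓕⁻ f =ᵐ[volume] (𝓕⁻ F : Lp ℂ 2 (volume : Measure (Plane d))) := by
    rw [← sub_ae_eq_zero]
    refine ae_eq_zero_of_integral_contDiff_smul_eq_zero ?_ fun g hg hgc ↦ ?_
    · exact hcont.locallyIntegrable.sub ((Lp.memLp _).locallyIntegrable (by norm_num))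
    have hg₁ : HasCompactSupport (Complex.ofRealCLM ∘ g) := hgc.comp_left rfl
    have hg₂ : ContDiff ℝ ∞ (Complex.ofRealCLM ∘ g) := by fun_prop
    set w : 𝓢(Plane d, ℂ) := hg₁.toSchwartzMap hg₂ with hw
    have hwg : ∀ x, w x = (g x : ℂ) := fun x ↦ rfl
    have h1 : ∫ x, w x * (𝓕⁻ f) x = ∫ ξ, (𝓕⁻ w) ξ * f ξ := by
      have h := VectorFourier.integral_fourierIntegral_smul_eq_flip (L := -innerₗ (Plane d))
        (μ := volume) (ν := volume) Real.continuous_fourierChar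
        (by simp only [LinearMap.neg_apply, innerₗ_apply_apply]; fun_prop)
        (w.integrable (μ := volume)) hf
      rw [SchwartzMap.fourierInv_coe]
      simp only [smul_eq_mul] at h
      rw [show (-innerₗ (Plane d)).flip = -innerₗ (Plane d) by
        ext x y; simp [real_inner_comm]] at h
      exact h.symm
    have h2 : ∫ x, w x * (𝓕⁻ F : Lp ℂ 2 (volume : Measure (Plane d))) x =
        ∫ ξ, (𝓕⁻ w) ξ * f ξ := by
      have h := congrArg (fun T : 𝓢'(Plane d, ℂ) ↦ T w)
        (Lp.fourierInv_toTemperedDistribution_eq F)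
      have h3 : iotaL2 d F (𝓕⁻ w) = iotaL2 d (𝓕⁻ F) w := h
      rw [iotaL2_apply, iotaL2_apply] at h3
      rw [← h3]
      refine integral_congr_ae ?_
      filter_upwards [hf2.coeFn_toLp] with ξ hξ
      rw [hF, hξ]
    have i1 : Integrable (fun x ↦ w x * (𝓕⁻ f) x) := by
      exact (w.continuous.mul hcont).integrable_of_hasCompactSupport hg₁.mul_right
    have i2 : Integrable (fun x ↦ w x * (𝓕⁻ F : Lp ℂ 2 (volume : Measure (Plane d))) x) :=
      (w.memLp 2 volume).integrable_mul (Lp.memLp _)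
    have h4 : (fun x ↦ g x • (𝓕⁻ f - (𝓕⁻ F : Lp ℂ 2 (volume : Measure (Plane d)))) x) = fun x ↦
        w x * (𝓕⁻ f) x - w x * (𝓕⁻ F : Lp ℂ 2 (volume : Measure (Plane d))) x := by
      funext x
      rw [hwg, Pi.sub_apply, Complex.real_smul, mul_sub]
    rw [h4, integral_sub i1 i2, h1, h2, sub_self]
  have hsq : ∀ G : Lp ℂ 2 (volume : Measure (Plane d)), ∫⁻ x, ‖G x‖ₑ ^ 2 = ‖G‖ₑ ^ 2 := by
    intro G
    rw [Lp.enorm_def, eLpNorm_eq_lintegral_rpow_enorm_toReal (by norm_num) (by norm_num),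
      ← ENNReal.rpow_natCast, ← ENNReal.rpow_mul]
    norm_num
  calc ∫⁻ x, ‖(𝓕⁻ f) x‖ₑ ^ 2
      = ∫⁻ x, ‖(𝓕⁻ F : Lp ℂ 2 (volume : Measure (Plane d))) x‖ₑ ^ 2 := by
        refine lintegral_congr_ae ?_
        filter_upwards [hae] with x hx
        rw [hx]
    _ = ‖F‖ₑ ^ 2 := by
        rw [hsq, ← enorm_norm, ← Lp.norm_fourier_eq, fourier_fourierInv_eq, enorm_norm]
    _ = ∫⁻ ξ, ‖F ξ‖ₑ ^ 2 := (hsq F).symm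
    _ ≤ _ := le_of_eq <| by
        refine lintegral_congr_ae ?_
        filter_upwards [hf2.coeFn_toLp] with ξ hξ
        rw [hF, hξ]

/-- The plane wave `e^{2πi x̃·ξ - |xₙ| μ(ξ)}`, outgoing or evanescent, which solves the Helmholtz
equation off the hyperplane. -/
noncomputable def planeWave {d : ℕ} (k : ℝ) (x : Plane d × ℝ) (ξ : Plane d) : ℂ :=
  Complex.exp (2 * Real.pi * Complex.I * (inner ℝ x.1 ξ : ℝ)) *
    Complex.exp (-(|x.2| : ℝ) * outRoot k ξ)

/-- The superposition of plane waves with density `b`. -/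
noncomputable def wavePotential {d : ℕ} (k : ℝ) (b : Plane d → ℂ) (x : Plane d × ℝ) : ℂ :=
  ∫ ξ, b ξ * planeWave k x ξ

section waves
variable {d : ℕ} {k : ℝ}

lemma norm_planeWave (x : Plane d × ℝ) (ξ : Plane d) :
    ‖planeWave k x ξ‖ = Real.exp (-|x.2| * (outRoot k ξ).re) := by
  rw [planeWave, norm_mul, norm_exp_inner, one_mul, norm_exp_neg_mul_outRoot]

lemma norm_planeWave_le_one (x : Plane d × ℝ) (ξ : Plane d) : ‖planeWave k x ξ‖ ≤ 1 := by
  rw [norm_planeWave, Real.exp_le_one_iff]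
  have := outRoot_re_nonneg k ξ
  have := abs_nonneg x.2
  nlinarith

lemma continuous_planeWave :
    Continuous (fun p : (Plane d × ℝ) × Plane d ↦ planeWave k p.1 p.2) := by
  have := continuous_outRoot (d := d) k
  unfold planeWave
  fun_prop

lemma aestronglyMeasurable_wavePotential {b : Plane d → ℂ} (hb : AEStronglyMeasurable b volume) :
    AEStronglyMeasurable (wavePotential k b) volume := by
  have h : AEStronglyMeasurable (fun p : (Plane d × ℝ) × Plane d ↦ b p.2 * planeWave k p.1 p.2)
      (volume.prod volume) := hb.comp_snd.mul continuous_planeWave.aestronglyMeasurable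
  exact h.integral_prod_right'

lemma integrable_mul_planeWave {b : Plane d → ℂ} (hb : Integrable b) (x : Plane d × ℝ) :
    Integrable (fun ξ ↦ b ξ * planeWave k x ξ) :=
  hb.mul_bdd (continuous_planeWave.comp (Continuous.prodMk_right x)).aestronglyMeasurable
    (Filter.Eventually.of_forall fun ξ ↦ norm_planeWave_le_one x ξ)

lemma norm_wavePotential_le {b : Plane d → ℂ} (hb : Integrable b) (x : Plane d × ℝ) :
    ‖wavePotential k b x‖ ≤ ∫ ξ, ‖b ξ‖ := by
  refine norm_integral_le_of_norm_le hb.norm (Filter.Eventually.of_forall fun ξ ↦ ?_)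
  rw [norm_mul]
  exact mul_le_of_le_one_right (norm_nonneg _) (norm_planeWave_le_one x ξ)

lemma besselWeight_one_eq (ξ : Plane d) :
    besselWeight k 1 ξ = √(k ^ 2 + (2 * Real.pi * ‖ξ‖) ^ 2) := by
  rw [besselWeight, Real.sqrt_eq_rpow]

/-- Away from the sphere `2π|ξ| = k` the decay rate of the evanescent waves is comparable to the
weight. The radius `k/π` is twice that of the sphere. -/
lemma besselWeight_one_le_outRoot_re (hk : 0 < k) {ξ : Plane d} (hξ : k / Real.pi ≤ ‖ξ‖) :
    besselWeight k 1 ξ ≤ 2 * (outRoot k ξ).re := by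
  rw [besselWeight_one_eq, outRoot_re]
  have hpi := Real.pi_pos
  rw [div_le_iff₀ hpi] at hξ
  refine Real.sqrt_le_iff.2 ⟨by positivity, ?_⟩
  have h2 : (2 * k) ^ 2 ≤ (2 * Real.pi * ‖ξ‖) ^ 2 := by
    apply pow_le_pow_left₀ (by positivity); linarith
  rw [mul_pow 2 (√_), Real.sq_sqrt (by nlinarith)]
  nlinarith

lemma norm_outRoot_le (k : ℝ) (ξ : Plane d) : ‖outRoot k ξ‖ ≤ besselWeight k 1 ξ := by
  rw [norm_outRoot, besselWeight_one_eq]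
  apply Real.sqrt_le_sqrt
  rw [abs_le]
  constructor <;> nlinarith [sq_nonneg k, sq_nonneg (2 * Real.pi * ‖ξ‖)]

/-- The evanescent factor has all the decay needed to make densities integrable off the
hyperplane. -/
lemma memLp_besselWeight_mul_exp (hk : 0 < k) {t : ℝ} (ht : 0 < t) :
    MemLp (fun ξ : Plane d ↦ ((besselWeight k (1 / 2) ξ *
      Real.exp (-t * (outRoot k ξ).re) : ℝ) : ℂ)) 2 volume := by
  have hm : Continuous (fun ξ : Plane d ↦ ((besselWeight k (1 / 2) ξ *
      Real.exp (-t * (outRoot k ξ).re) : ℝ) : ℂ)) := by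
    have h1 := continuous_besselWeight (d := d) hk (1 / 2)
    have h2 := continuous_outRoot (d := d) k
    fun_prop
  rw [memLp_two_iff_integrable_sq_norm hm.aestronglyMeasurable]
  have hpi := Real.pi_pos
  refine ((integrable_exp_neg_mul_norm (d := d) (c := t * (2 * Real.pi)) (by positivity)).const_mul
    (1 / t * Real.exp (5 * t * k))).mono' (hm.norm.pow 2).aestronglyMeasurable (Filter.Eventually.of_forall fun ξ ↦ ?_)
  rw [Complex.norm_real, Real.norm_of_nonneg (by positivity), Real.norm_of_nonneg
    (mul_nonneg (besselWeight_pos hk _ _).le (Real.exp_pos _).le), mul_pow, sq (besselWeight _ _ _),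
    besselWeight_mul hk, ← Real.exp_nat_mul]
  norm_num
  set y := 2 * Real.pi * ‖ξ‖ with hy
  have hy0 : 0 ≤ y := by positivity
  have h1 : besselWeight k 1 ξ ≤ k + y := by
    rw [besselWeight_one_eq]
    exact Real.sqrt_le_iff.2 ⟨by positivity, by nlinarith⟩
  have h2 : y - 2 * k ≤ (outRoot k ξ).re := by
    rw [outRoot_re]
    refine le_trans ?_ (abs_le_of_nonneg_sub hk hy0)
    have := le_abs_self (y - k)
    linarith
  have h3 : k + y ≤ t⁻¹ * Real.exp (t * (k + y)) := by
    have := Real.add_one_le_exp (t * (k + y))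
    rw [inv_mul_eq_div, le_div_iff₀ ht]
    nlinarith
  calc besselWeight k 1 ξ * Real.exp (-(2 * (t * (outRoot k ξ).re)))
      ≤ (t⁻¹ * Real.exp (t * (k + y))) * Real.exp (-(2 * (t * (y - 2 * k)))) := by
        gcongr
        exact h1.trans h3
    _ = t⁻¹ * Real.exp (5 * t * k) * Real.exp (-(t * (2 * Real.pi) * ‖ξ‖)) := by
        rw [mul_assoc, mul_assoc, ← Real.exp_add, ← Real.exp_add, hy]
        congr 2
        ring

lemma integrable_mul_planeWave_of_memLp (hk : 0 < k) {b : Plane d → ℂ}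
    (hb : MemLp (fun ξ ↦ (besselWeight k (-(1 / 2)) ξ : ℂ) * b ξ) 2 volume) {x : Plane d × ℝ}
    (hx : x.2 ≠ 0) : Integrable (fun ξ ↦ b ξ * planeWave k x ξ) := by
  have hi := hb.integrable_mul (memLp_besselWeight_mul_exp (d := d) hk (abs_pos.2 hx))
  have hbm := aestronglyMeasurable_of_besselWeight_mul hk hb.1
  refine hi.mono (hbm.mul
    (continuous_planeWave.comp (Continuous.prodMk_right x)).aestronglyMeasurable)
    (Filter.Eventually.of_forall fun ξ ↦ le_of_eq ?_)
  have := besselWeight_neg_mul hk (1 / 2) ξ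
  simp only [Pi.mul_apply, norm_mul, norm_planeWave, Complex.norm_real]
  rw [Real.norm_of_nonneg (besselWeight_pos hk _ _).le,
    Real.norm_of_nonneg (besselWeight_pos hk _ _).le, Real.norm_of_nonneg (Real.exp_pos _).le]
  linear_combination (-(‖b ξ‖ * Real.exp (-|x.2| * (outRoot k ξ).re))) * this

lemma lintegral_exp_neg_abs {r : ℝ} (hr : 0 < r) :
    ∫⁻ t : ℝ, ENNReal.ofReal (Real.exp (-|t| * r)) = ENNReal.ofReal (2 / r) := by
  have h1 : ∫ t : ℝ, Real.exp (-|t| * r) = 2 / r := by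
    rw [integral_comp_abs (f := fun t ↦ Real.exp (-t * r))]
    have := integral_exp_mul_Ioi (a := -r) (by linarith) 0
    simp only [mul_zero, Real.exp_zero] at this
    simp_rw [show ∀ x : ℝ, -x * r = -r * x by intro x; ring]
    rw [this]
    field_simp
  rw [← h1, ofReal_integral_eq_lintegral_ofReal]
  · by_contra hni
    rw [integral_undef hni] at h1
    have : 0 < 2 / r := by positivity
    linarith
  · exact Filter.Eventually.of_forall fun t ↦ (Real.exp_pos _).le

/-- The `L²` estimate for superpositions of evanescent waves, by Plancherel's theorem in each
plane parallel to the hyperplane. -/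
lemma lintegral_wavePotential_sq_le (hk : 0 < k) {b : Plane d → ℂ}
    (hb : MemLp (fun ξ ↦ (besselWeight k (-(1 / 2)) ξ : ℂ) * b ξ) 2 volume)
    (h0 : ∀ ξ, ‖ξ‖ < k / Real.pi → b ξ = 0) :
    ∫⁻ x, ‖wavePotential k b x‖ₑ ^ 2 ≤
      2 * ∫⁻ ξ, ‖(besselWeight k (-(1 / 2)) ξ : ℂ) * b ξ‖ₑ ^ 2 := by
  have hbm := aestronglyMeasurable_of_besselWeight_mul hk hb.1
  have hVm := aestronglyMeasurable_wavePotential (k := k) hbm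
  have hslice : ∀ t : ℝ, t ≠ 0 → ∫⁻ y : Plane d, ‖wavePotential k b (y, t)‖ₑ ^ 2 ≤
      ∫⁻ ξ, ‖b ξ‖ₑ ^ 2 * ENNReal.ofReal (Real.exp (-|t| * (2 * (outRoot k ξ).re))) := by
    intro t ht
    -- The slice at height `t` is the inverse Fourier transform of `f ∈ L¹ ∩ L²`.
    set f : Plane d → ℂ := fun ξ ↦ b ξ * Complex.exp (-(|t| : ℝ) * outRoot k ξ) with hf
    have hexp : Continuous (fun ξ : Plane d ↦ Complex.exp (-(|t| : ℝ) * outRoot k ξ)) := by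
      have := continuous_outRoot (d := d) k
      fun_prop
    have hfi : Integrable f := by
      have := integrable_mul_planeWave_of_memLp hk hb (x := (0, t)) ht
      simpa [planeWave, hf] using this
    have hf2 : MemLp f 2 volume := by
      have hC : ∃ C : ℝ, ∀ ξ, ‖f ξ‖ ≤ C * ‖(besselWeight k (-(1 / 2)) ξ : ℂ) * b ξ‖ := by
        have ht' : 0 < |t| := abs_pos.2 ht
        refine ⟨1 + (1 + 2 / |t|), fun ξ ↦ ?_⟩
        by_cases hξ : ‖ξ‖ < k / Real.pi
        · simp [hf, h0 ξ hξ]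
        have hr := besselWeight_one_le_outRoot_re hk (not_lt.1 hξ)
        have hw := besselWeight_pos hk (1 / 2) ξ
        have hprod : besselWeight k (1 / 2) ξ * besselWeight k (-(1 / 2)) ξ = 1 :=
          besselWeight_mul_neg hk (1 / 2) ξ
        have hsq : besselWeight k (1 / 2) ξ ^ 2 = besselWeight k 1 ξ := by
          rw [sq, besselWeight_mul hk]; norm_num
        have hE : besselWeight k (1 / 2) ξ * Real.exp (-|t| * (outRoot k ξ).re) ≤
            1 + (1 + 2 / |t|) := by
          have e1 : Real.exp (-|t| * (outRoot k ξ).re) ≤ 1 / (1 + |t| * (outRoot k ξ).re) := by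
            rw [neg_mul, Real.exp_neg, one_div]
            apply inv_anti₀
            · have := outRoot_re_nonneg k ξ
              positivity
            · have := Real.add_one_le_exp (|t| * (outRoot k ξ).re)
              linarith
          have hden : 0 < 1 + |t| * (outRoot k ξ).re := by
            have := outRoot_re_nonneg k ξ
            positivity
          calc _ ≤ besselWeight k (1 / 2) ξ * (1 / (1 + |t| * (outRoot k ξ).re)) := by gcongr
            _ ≤ _ := by
              rw [mul_one_div, div_le_iff₀ hden]
              have e2 : 2 / |t| * (|t| * (outRoot k ξ).re) = 2 * (outRoot k ξ).re := by
                field_simp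
              have e3 : 0 ≤ 2 / |t| := by positivity
              have e4 : 0 ≤ |t| * (outRoot k ξ).re :=
                mul_nonneg ht'.le (outRoot_re_nonneg k ξ)
              nlinarith [sq_nonneg (besselWeight k (1 / 2) ξ - 1)]
        rw [hf]
        simp only
        rw [norm_mul, norm_mul, norm_exp_neg_mul_outRoot, Complex.norm_real,
          Real.norm_of_nonneg (besselWeight_pos hk _ _).le]
        calc ‖b ξ‖ * Real.exp (-|t| * (outRoot k ξ).re) =
            (besselWeight k (1 / 2) ξ * Real.exp (-|t| * (outRoot k ξ).re)) *
              (besselWeight k (-(1 / 2)) ξ * ‖b ξ‖) := by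
              linear_combination (-(‖b ξ‖ * Real.exp (-|t| * (outRoot k ξ).re))) * hprod
          _ ≤ _ := by
              gcongr
              exact mul_nonneg (besselWeight_pos hk _ _).le (norm_nonneg _)
      obtain ⟨C, hC⟩ := hC
      exact hb.of_le_mul (hbm.mul hexp.aestronglyMeasurable) (Filter.Eventually.of_forall hC)
    have e : ∀ y : Plane d, wavePotential k b (y, t) = (𝓕⁻ f) y := by
      intro y
      rw [Real.fourierInv_eq', wavePotential]
      congr 1
      funext ξ
      rw [planeWave, smul_eq_mul, hf]
      simp only
      rw [show (2 * (Real.pi : ℂ) * Complex.I * (inner ℝ y ξ : ℝ)) =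
        ((2 * Real.pi * inner ℝ ξ y : ℝ) : ℂ) * Complex.I by
          rw [real_inner_comm]; push_cast; ring]
      ring
    simp_rw [e]
    refine (lintegral_fourierInv_sq_le hfi hf2).trans (lintegral_mono fun ξ ↦ le_of_eq ?_)
    rw [hf]
    simp only
    rw [enorm_mul, mul_pow, ← ofReal_norm (Complex.exp _), norm_exp_neg_mul_outRoot,
      ← ENNReal.ofReal_pow (Real.exp_pos _).le, ← Real.exp_nat_mul]
    congr 3
    push_cast
    ring
  have hexpm : Measurable (fun p : ℝ × Plane d ↦
      ENNReal.ofReal (Real.exp (-|p.1| * (2 * (outRoot k p.2).re)))) := by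
    have := continuous_outRoot (d := d) k
    exact ENNReal.measurable_ofReal.comp (Continuous.measurable (by fun_prop))
  calc ∫⁻ x, ‖wavePotential k b x‖ₑ ^ 2
      = ∫⁻ t : ℝ, ∫⁻ y : Plane d, ‖wavePotential k b (y, t)‖ₑ ^ 2 :=
        lintegral_prod_symm _ (hVm.enorm.pow_const 2)
    _ ≤ ∫⁻ t : ℝ, ∫⁻ ξ, ‖b ξ‖ₑ ^ 2 *
          ENNReal.ofReal (Real.exp (-|t| * (2 * (outRoot k ξ).re))) := by
        refine lintegral_mono_ae ?_
        filter_upwards [Measure.ae_ne volume (0 : ℝ)] with t ht using hslice t ht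
    _ = ∫⁻ ξ, ∫⁻ t : ℝ, ‖b ξ‖ₑ ^ 2 *
          ENNReal.ofReal (Real.exp (-|t| * (2 * (outRoot k ξ).re))) := by
        refine lintegral_lintegral_swap ?_
        exact (hbm.enorm.pow_const 2).comp_snd.mul hexpm.aemeasurable
    _ ≤ ∫⁻ ξ, 2 * ‖(besselWeight k (-(1 / 2)) ξ : ℂ) * b ξ‖ₑ ^ 2 := by
        refine lintegral_mono fun ξ ↦ ?_
        by_cases hξ : ‖ξ‖ < k / Real.pi
        · simp [h0 ξ hξ]
        have hr := besselWeight_one_le_outRoot_re hk (not_lt.1 hξ)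
        have hw := besselWeight_pos hk 1 ξ
        -- `∫ e^{-2|t| Re μ} dt = 1 / Re μ`, which is at most `2 / √(k² + |2πξ|²)` for `|ξ| ≥ k/π`.
        rw [lintegral_const_mul' _ _ (by simp), lintegral_exp_neg_abs (by linarith), enorm_mul,
          mul_pow, mul_comm (‖b ξ‖ₑ ^ 2), ← mul_assoc]
        gcongr
        rw [← ofReal_norm, Complex.norm_real, Real.norm_of_nonneg
          (besselWeight_pos hk _ _).le, ← ENNReal.ofReal_pow (besselWeight_pos hk _ _).le,
          show (2 : ENNReal) = ENNReal.ofReal 2 by simp, ← ENNReal.ofReal_mul (by norm_num)]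
        apply ENNReal.ofReal_le_ofReal
        have h1 : besselWeight k (-(1 / 2)) ξ ^ 2 = 1 / besselWeight k 1 ξ := by
          rw [sq, besselWeight_mul hk, eq_div_iff hw.ne', show -(1 / 2) + -(1 / 2) = (-1 : ℝ) by
            norm_num, besselWeight_neg_mul hk]
        rw [h1, mul_one_div]
        gcongr
    _ = _ := lintegral_const_mul' _ _ (by norm_num)

end waves

/-! ### Densities with separate control of low and high frequencies -/

/-- `b` is integrable near the sphere `2π|ξ| = k` (more precisely, for `|ξ| < k/π`), and lies in
the weighted `L²` space of order `s` away from it. The radius `k/π` is twice that of the sphere, so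
that beyond it `Re μ` is comparable with `|ξ|` (`besselWeight_one_le_outRoot_re`). -/
structure IsWaveDensity {d : ℕ} (k s : ℝ) (b : Plane d → ℂ) : Prop where
  low : Integrable ((Metric.ball 0 (k / Real.pi)).indicator b)
  high : MemLp (fun ξ ↦ (besselWeight k s ξ : ℂ) *
    (Metric.ball 0 (k / Real.pi))ᶜ.indicator b ξ) 2 volume

namespace IsWaveDensity
variable {d : ℕ} {k s : ℝ} {b : Plane d → ℂ}

lemma indicator_add (b : Plane d → ℂ) (S : Set (Plane d)) (ξ : Plane d) :
    S.indicator b ξ + Sᶜ.indicator b ξ = b ξ :=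
  congrFun (Set.indicator_self_add_compl S b) ξ

lemma aestronglyMeasurable (hk : 0 < k) (hb : IsWaveDensity k s b) :
    AEStronglyMeasurable b volume := by
  refine (hb.low.1.add (aestronglyMeasurable_of_besselWeight_mul hk hb.high.1)).congr
    (Filter.Eventually.of_forall fun ξ ↦ ?_)
  exact indicator_add b _ ξ

lemma locallyIntegrable (hk : 0 < k) (hb : IsWaveDensity k s b) :
    LocallyIntegrable b volume := by
  have h1 := hb.high.locallyIntegrable (by norm_num)
  have h2 : LocallyIntegrable ((Metric.ball 0 (k / Real.pi))ᶜ.indicator b) volume := by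
    refine (h1.continuous_mul (g := fun ξ ↦ (besselWeight k (-s) ξ : ℂ))
      (Complex.continuous_ofReal.comp (continuous_besselWeight hk (-s)))).congr
      (Filter.Eventually.of_forall fun ξ ↦ ?_)
    simp only
    rw [← mul_assoc, ← Complex.ofReal_mul, besselWeight_neg_mul hk, Complex.ofReal_one, one_mul]
  refine (hb.low.locallyIntegrable.add h2).congr (Filter.Eventually.of_forall fun ξ ↦ ?_)
  exact indicator_add b _ ξ

/-- A first order multiplier costs one order of decay. -/
lemma mul (hk : 0 < k) (hb : IsWaveDensity k (1 / 2) b) {m : Plane d → ℂ} (hm : Continuous m)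
    {C : ℝ} (hC : ∀ ξ, ‖m ξ‖ ≤ C * besselWeight k 1 ξ) :
    IsWaveDensity k (-(1 / 2)) (fun ξ ↦ m ξ * b ξ) := by
  have hC0 : 0 ≤ C := by
    have h1 := (norm_nonneg _).trans (hC 0)
    exact nonneg_of_mul_nonneg_left h1 (besselWeight_pos hk 1 0)
  have hbm := hb.aestronglyMeasurable hk
  have hmb : AEStronglyMeasurable (fun ξ ↦ m ξ * b ξ) volume := hm.aestronglyMeasurable.mul hbm
  have hpi := Real.pi_pos
  constructor
  · refine (hb.low.norm.const_mul (C * √(k ^ 2 + (2 * k) ^ 2))).mono'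
      (hmb.indicator measurableSet_ball) (Filter.Eventually.of_forall fun ξ ↦ ?_)
    by_cases hξ : ξ ∈ Metric.ball (0 : Plane d) (k / Real.pi)
    · rw [Set.indicator_of_mem hξ, Set.indicator_of_mem hξ, norm_mul]
      gcongr
      refine (hC ξ).trans ?_
      rw [besselWeight_one_eq]
      rw [mem_ball_zero_iff, lt_div_iff₀ hpi] at hξ
      have h2 : 2 * Real.pi * ‖ξ‖ ≤ 2 * k := by linarith
      gcongr
    · rw [Set.indicator_of_notMem hξ, Set.indicator_of_notMem hξ]
      simp
  · have hwm : AEStronglyMeasurable (fun ξ : Plane d ↦ (besselWeight k (-(1 / 2)) ξ : ℂ)) volume :=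
      (Complex.continuous_ofReal.comp (continuous_besselWeight hk _)).aestronglyMeasurable
    refine hb.high.of_le_mul (c := C)
      (hwm.mul (hmb.indicator measurableSet_ball.compl)) (Filter.Eventually.of_forall fun ξ ↦ ?_)
    by_cases hξ : ξ ∈ (Metric.ball (0 : Plane d) (k / Real.pi))ᶜ
    · rw [Set.indicator_of_mem hξ, Set.indicator_of_mem hξ]
      simp only [norm_mul, Complex.norm_real]
      rw [Real.norm_of_nonneg (besselWeight_pos hk _ _).le,
        Real.norm_of_nonneg (besselWeight_pos hk _ _).le]
      have e : besselWeight k (-(1 / 2)) ξ * besselWeight k 1 ξ = besselWeight k (1 / 2) ξ := by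
        rw [besselWeight_mul hk]; norm_num
      calc besselWeight k (-(1 / 2)) ξ * (‖m ξ‖ * ‖b ξ‖) ≤
          besselWeight k (-(1 / 2)) ξ * (C * besselWeight k 1 ξ * ‖b ξ‖) := by
            have := besselWeight_pos hk (-(1 / 2)) ξ
            gcongr
            exact hC ξ
        _ = _ := by rw [← e]; ring
    · rw [Set.indicator_of_notMem hξ, Set.indicator_of_notMem hξ]
      simp

lemma of_half (hk : 0 < k) (hb : IsWaveDensity k (1 / 2) b) : IsWaveDensity k (-(1 / 2)) b := by
  have := hb.mul hk (m := fun _ ↦ 1) continuous_const (C := 1 / k) fun ξ ↦ by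
    rw [norm_one, besselWeight_one_eq, div_mul_eq_mul_div, one_mul, le_div_iff₀ hk, one_mul]
    exact Real.le_sqrt_of_sq_le (by nlinarith [sq_nonneg (2 * Real.pi * ‖ξ‖)])
  simpa using this

lemma integrable_planeWave (hk : 0 < k) (hb : IsWaveDensity k (-(1 / 2)) b) {x : Plane d × ℝ}
    (hx : x.2 ≠ 0) : Integrable (fun ξ ↦ b ξ * planeWave k x ξ) := by
  refine ((integrable_mul_planeWave (k := k) hb.low x).add
    (integrable_mul_planeWave_of_memLp hk hb.high hx)).congr
    (Filter.Eventually.of_forall fun ξ ↦ ?_)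
  simp only [Pi.add_apply]
  rw [← add_mul, indicator_add]

lemma wavePotential_eq (hk : 0 < k) (hb : IsWaveDensity k (-(1 / 2)) b) {x : Plane d × ℝ}
    (hx : x.2 ≠ 0) : wavePotential k b x =
      wavePotential k ((Metric.ball 0 (k / Real.pi)).indicator b) x +
      wavePotential k ((Metric.ball 0 (k / Real.pi))ᶜ.indicator b) x := by
  rw [wavePotential, wavePotential, wavePotential, ← integral_add
    (integrable_mul_planeWave hb.low x) (integrable_mul_planeWave_of_memLp hk hb.high hx)]
  congr 1
  funext ξ
  rw [← add_mul, indicator_add]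

end IsWaveDensity

lemma ae_snd_ne_zero (d : ℕ) : ∀ᵐ x : Plane d × ℝ, x.2 ≠ 0 :=
  Measure.quasiMeasurePreserving_snd.ae (Measure.ae_ne volume (0 : ℝ))

section
variable {d : ℕ} {k : ℝ} {b : Plane d → ℂ}

lemma memLp_wavePotential (hk : 0 < k)
    (hb : MemLp (fun ξ ↦ (besselWeight k (-(1 / 2)) ξ : ℂ) * b ξ) 2 volume)
    (h0 : ∀ ξ, ‖ξ‖ < k / Real.pi → b ξ = 0) : MemLp (wavePotential k b) 2 volume := by
  refine (memLp_two_iff_lintegral (aestronglyMeasurable_wavePotential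
    (aestronglyMeasurable_of_besselWeight_mul hk hb.1))).2 ?_
  refine (lintegral_wavePotential_sq_le hk hb h0).trans_lt ?_
  exact ENNReal.mul_lt_top (by norm_num) ((memLp_two_iff_lintegral hb.1).1 hb)

lemma indicator_compl_ball_eq_zero {r : ℝ} (ξ : Plane d) (hξ : ‖ξ‖ < r) :
    (Metric.ball 0 r)ᶜ.indicator b ξ = 0 :=
  Set.indicator_of_notMem (by simpa using hξ) _

/-- Superpositions of plane waves are locally square integrable up to the hyperplane. -/
lemma IsWaveDensity.memLp_mul (hk : 0 < k) (hb : IsWaveDensity k (-(1 / 2)) b)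
    {ψ : Plane d × ℝ → ℂ} (hψ : Continuous ψ) (hψc : HasCompactSupport ψ) :
    MemLp (fun x ↦ wavePotential k b x * ψ x) 2 volume := by
  have hψ2 : MemLp ψ 2 volume := hψ.memLp_of_hasCompactSupport hψc
  obtain ⟨M, hM⟩ := hψc.exists_bound_of_continuous hψ
  set L := wavePotential k ((Metric.ball (0 : Plane d) (k / Real.pi)).indicator b) with hL
  set H := wavePotential k ((Metric.ball (0 : Plane d) (k / Real.pi))ᶜ.indicator b) with hH
  have hLm : AEStronglyMeasurable L volume := aestronglyMeasurable_wavePotential hb.low.1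
  have hH2 : MemLp H 2 volume :=
    memLp_wavePotential hk hb.high fun ξ hξ ↦ indicator_compl_ball_eq_zero ξ hξ
  have h1 : MemLp (fun x ↦ L x * ψ x) 2 volume :=
    hψ2.of_le_mul (hLm.mul hψ.aestronglyMeasurable) (Filter.Eventually.of_forall fun x ↦ by
      rw [norm_mul]
      gcongr
      exact norm_wavePotential_le hb.low x)
  have h2 : MemLp (fun x ↦ H x * ψ x) 2 volume :=
    hH2.of_le_mul (c := M) (hH2.1.mul hψ.aestronglyMeasurable) (Filter.Eventually.of_forall
      fun x ↦ by
        rw [norm_mul, mul_comm]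
        gcongr
        exact hM x)
  refine (h1.add h2).ae_eq ?_
  filter_upwards [ae_snd_ne_zero d] with x hx
  rw [Pi.add_apply, ← add_mul, ← hb.wavePotential_eq hk hx]

lemma IsWaveDensity.integrable_mul (hk : 0 < k) (hb : IsWaveDensity k (-(1 / 2)) b)
    {ψ : Plane d × ℝ → ℂ} (hψ : Continuous ψ) (hψc : HasCompactSupport ψ) :
    Integrable (fun x ↦ wavePotential k b x * ψ x) := by
  have hcut : ∃ η : Plane d × ℝ → ℂ, Continuous η ∧ HasCompactSupport η ∧
      ∀ x ∈ tsupport ψ, η x = 1 := by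
    obtain ⟨f, hf1, -, hfc, -⟩ := exists_continuous_one_zero_of_isCompact (s := tsupport ψ)
      (t := ∅) hψc isClosed_empty (by simp)
    exact ⟨fun x ↦ (f x : ℂ), Complex.continuous_ofReal.comp f.continuous,
      hfc.comp_left (g := Complex.ofReal) rfl, fun x hx ↦ by simp [hf1 hx]⟩
  obtain ⟨η, hη, hηc, hη1⟩ := hcut
  refine ((hb.memLp_mul hk hψ hψc).integrable_mul (hη.memLp_of_hasCompactSupport (p := 2) hηc)).congr
    (Filter.Eventually.of_forall fun x ↦ ?_)
  simp only [Pi.mul_apply]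
  by_cases hx : x ∈ tsupport ψ
  · rw [hη1 x hx, mul_one]
  · rw [image_eq_zero_of_notMem_tsupport hx]; simp

/-- Integrals of superpositions of plane waves against compactly supported functions are limits under
truncation in frequency, even if the density is not integrable at high frequencies. -/
lemma IsWaveDensity.tendsto_integral_truncation (hk : 0 < k) (hb : IsWaveDensity k (-(1 / 2)) b)
    {ψ : Plane d × ℝ → ℂ} (hψ : Continuous ψ) (hψc : HasCompactSupport ψ)
    (S : Set (Plane d × ℝ)) :
    Filter.Tendsto (fun N : ℕ ↦ ∫ x in S,
      wavePotential k ((Metric.ball 0 (N : ℝ)).indicator b) x * ψ x) Filter.atTop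
      (𝓝 (∫ x in S, wavePotential k b x * ψ x)) := by
  have hψ2 : MemLp ψ 2 volume := hψ.memLp_of_hasCompactSupport hψc
  set bH : Plane d → ℂ := (Metric.ball 0 (k / Real.pi))ᶜ.indicator b with hbH
  set T : ℕ → Plane d → ℂ := fun N ↦ (Metric.ball 0 (N : ℝ))ᶜ.indicator bH with hT
  have hTle : ∀ N ξ, ‖(besselWeight k (-(1 / 2)) ξ : ℂ) * T N ξ‖ ≤
      ‖(besselWeight k (-(1 / 2)) ξ : ℂ) * bH ξ‖ := fun N ξ ↦ by
    rw [norm_mul, norm_mul]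
    gcongr
    exact norm_indicator_le_norm_self _ _
  have hTm : ∀ N, AEStronglyMeasurable (fun ξ ↦ (besselWeight k (-(1 / 2)) ξ : ℂ) * T N ξ)
      volume := fun N ↦
    (Complex.continuous_ofReal.comp (continuous_besselWeight hk _)).aestronglyMeasurable.mul
      ((aestronglyMeasurable_of_besselWeight_mul hk hb.high.1).indicator measurableSet_ball.compl)
  have hT2 : ∀ N, MemLp (fun ξ ↦ (besselWeight k (-(1 / 2)) ξ : ℂ) * T N ξ) 2 volume := fun N ↦
    hb.high.mono (hTm N) (Filter.Eventually.of_forall (hTle N))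
  have hT0 : ∀ N ξ, ‖ξ‖ < k / Real.pi → T N ξ = 0 := fun N ξ hξ ↦ by
    rw [hT]
    simp only [Set.indicator]
    split_ifs
    · exact indicator_compl_ball_eq_zero ξ hξ
    · rfl
  have htail : Filter.Tendsto (fun N ↦ ∫⁻ ξ, ‖(besselWeight k (-(1 / 2)) ξ : ℂ) * T N ξ‖ₑ ^ 2)
      Filter.atTop (𝓝 0) := by
    have := tendsto_lintegral_of_dominated_convergence' (μ := (volume : Measure (Plane d)))
      (F := fun N ξ ↦ ‖(besselWeight k (-(1 / 2)) ξ : ℂ) * T N ξ‖ₑ ^ 2) (f := fun _ ↦ 0)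
      (fun ξ ↦ ‖(besselWeight k (-(1 / 2)) ξ : ℂ) * bH ξ‖ₑ ^ 2)
      (fun N ↦ (hTm N).enorm.pow_const 2)
      (fun N ↦ Filter.Eventually.of_forall fun ξ ↦ by
        refine pow_le_pow_left' ?_ 2
        exact enorm_le_iff_norm_le.2 (hTle N ξ))
      ((memLp_two_iff_lintegral hb.high.1).1 hb.high).ne
      (Filter.Eventually.of_forall fun ξ ↦ by
        refine tendsto_const_nhds.congr' ?_
        obtain ⟨N, hN⟩ := exists_nat_gt ‖ξ‖
        filter_upwards [Filter.eventually_ge_atTop N] with n hn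
        have : T n ξ = 0 := indicator_compl_ball_eq_zero ξ (hN.trans_le (by exact_mod_cast hn))
        simp [this])
    simpa using this
  have hV : Filter.Tendsto (fun N ↦ (∫⁻ x, ‖wavePotential k (T N) x‖ₑ ^ 2) ^ (1 / (2 : ℝ)) *
      (∫⁻ x, ‖ψ x‖ₑ ^ 2) ^ (1 / (2 : ℝ))) Filter.atTop (𝓝 0) := by
    have h1 : Filter.Tendsto (fun N ↦ ∫⁻ x, ‖wavePotential k (T N) x‖ₑ ^ 2) Filter.atTop (𝓝 0) := by
      have h2 := ENNReal.Tendsto.const_mul (a := 2) htail (Or.inr (by norm_num))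
      rw [mul_zero] at h2
      exact tendsto_of_tendsto_of_tendsto_of_le_of_le tendsto_const_nhds h2 (fun _ ↦ zero_le)
        fun N ↦ lintegral_wavePotential_sq_le hk (hT2 N) (hT0 N)
    have h3 := (ENNReal.continuous_rpow_const (y := 1 / (2 : ℝ))).tendsto 0 |>.comp h1
    rw [ENNReal.zero_rpow_of_pos (by norm_num)] at h3
    have hfin : (∫⁻ x, ‖ψ x‖ₑ ^ 2) ^ (1 / (2 : ℝ)) ≠ ⊤ :=
      (ENNReal.rpow_lt_top_of_nonneg (by norm_num)
        ((memLp_two_iff_lintegral hψ2.1).1 hψ2).ne).ne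
    have h4 := ENNReal.Tendsto.mul_const (b := (∫⁻ x, ‖ψ x‖ₑ ^ 2) ^ (1 / (2 : ℝ))) h3 (Or.inr hfin)
    rw [zero_mul] at h4
    exact h4
  rw [tendsto_iff_edist_tendsto_0]
  refine tendsto_of_tendsto_of_tendsto_of_le_of_le' tendsto_const_nhds hV
    (Filter.Eventually.of_forall fun _ ↦ zero_le) ?_
  obtain ⟨N₀, hN₀⟩ := exists_nat_ge (k / Real.pi)
  filter_upwards [Filter.eventually_ge_atTop N₀] with N hN
  have hkN : k / Real.pi ≤ (N : ℝ) := hN₀.trans (by exact_mod_cast hN)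
  have hTeq : T N = (Metric.ball 0 (N : ℝ))ᶜ.indicator b := by
    rw [hT, hbH]
    simp only
    rw [Set.indicator_indicator]
    congr 1
    rw [Set.inter_eq_left]
    exact Set.compl_subset_compl.2 (Metric.ball_subset_ball hkN)
  have hbN : Integrable ((Metric.ball 0 (N : ℝ)).indicator b) :=
    (((hb.locallyIntegrable hk).integrableOn_isCompact (isCompact_closedBall 0 (N : ℝ))).mono_set
      Metric.ball_subset_closedBall).integrable_indicator measurableSet_ball
  have hdiff : ∀ x : Plane d × ℝ, x.2 ≠ 0 → wavePotential k b x -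
      wavePotential k ((Metric.ball 0 (N : ℝ)).indicator b) x = wavePotential k (T N) x := by
    intro x hx
    rw [wavePotential, wavePotential, wavePotential, ← integral_sub (hb.integrable_planeWave hk hx)
      (integrable_mul_planeWave hbN x), hTeq]
    congr 1
    funext ξ
    rw [← sub_mul, ← indicator_add b (Metric.ball 0 (N : ℝ)) ξ]
    ring
  have hVN : Integrable (fun x ↦ wavePotential k ((Metric.ball 0 (N : ℝ)).indicator b) x * ψ x) := by
    refine (hψ.integrable_of_hasCompactSupport hψc).bdd_mul
      (aestronglyMeasurable_wavePotential hbN.1)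
      (Filter.Eventually.of_forall fun x ↦ norm_wavePotential_le hbN x)
  rw [edist_comm, edist_eq_enorm_sub, ← integral_sub
    (hb.integrable_mul hk hψ hψc).integrableOn hVN.integrableOn]
  have hae : (fun x ↦ wavePotential k b x * ψ x -
      wavePotential k ((Metric.ball 0 (N : ℝ)).indicator b) x * ψ x) =ᵐ[volume.restrict S]
      fun x ↦ wavePotential k (T N) x * ψ x := by
    filter_upwards [ae_restrict_of_ae (ae_snd_ne_zero d)] with x hx
    rw [← sub_mul, hdiff x hx]
  rw [integral_congr_ae hae]
  have hTVm : AEStronglyMeasurable (wavePotential k (T N)) volume :=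
    aestronglyMeasurable_wavePotential (aestronglyMeasurable_of_besselWeight_mul hk (hTm N))
  calc ‖∫ x in S, wavePotential k (T N) x * ψ x‖ₑ
      ≤ ∫⁻ x in S, ‖wavePotential k (T N) x * ψ x‖ₑ := enorm_integral_le_lintegral_enorm _
    _ ≤ ∫⁻ x, ‖wavePotential k (T N) x * ψ x‖ₑ := setLIntegral_le_lintegral _ _
    _ = ∫⁻ x, ((fun x ↦ ‖wavePotential k (T N) x‖ₑ) * fun x ↦ ‖ψ x‖ₑ) x := by
        simp only [enorm_mul, Pi.mul_apply]
    _ ≤ _ := by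
        have := ENNReal.lintegral_mul_le_Lp_mul_Lq volume Real.HolderConjugate.two_two
          hTVm.enorm hψ2.1.enorm
        simpa using this

end

/-! ### Integration by parts in the half-spaces -/

lemma measurableSet_halfSpace (d : ℕ) (σ : ℤˣ) : MeasurableSet (halfSpace d σ) :=
  measurableSet_lt measurable_const (measurable_snd.const_mul _)

lemma restrict_halfSpace (d : ℕ) (σ : ℤˣ) : (volume : Measure (Plane d × ℝ)).restrict
    (halfSpace d σ) = (volume : Measure (Plane d)).prod
      ((volume : Measure ℝ).restrict {t | 0 < ((σ : ℤ) : ℝ) * t}) := by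
  rw [← Measure.restrict_univ (μ := (volume : Measure (Plane d))), Measure.prod_restrict,
    Measure.volume_eq_prod]
  congr 1
  ext x
  simp [halfSpace]

lemma snd_ne_zero_of_mem_halfSpace {d : ℕ} {σ : ℤˣ} {x : Plane d × ℝ} (hx : x ∈ halfSpace d σ) :
    x.2 ≠ 0 := by
  rintro h
  simp [halfSpace, h] at hx

lemma abs_snd_of_mem_halfSpace {d : ℕ} {σ : ℤˣ} {x : Plane d × ℝ} (hx : x ∈ halfSpace d σ) :
    |x.2| = ((σ : ℤ) : ℝ) * x.2 := by
  rw [halfSpace, Set.mem_ofPred_eq] at hx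
  rcases Int.units_eq_one_or σ with rfl | rfl
  · simp only [Units.val_one, Int.cast_one, one_mul] at hx ⊢
    exact abs_of_pos hx
  · simp only [Units.val_neg, Units.val_one, Int.cast_neg, Int.cast_one, neg_mul, one_mul] at hx ⊢
    exact abs_of_neg (by linarith)

/-- The fundamental theorem of calculus in the half-line `σt > 0`. -/
lemma integral_deriv_halfLine (σ : ℤˣ) {h : ℝ → ℂ} (hh : ContDiff ℝ 1 h)
    (hc : HasCompactSupport h) :
    ∫ t in {t : ℝ | 0 < ((σ : ℤ) : ℝ) * t}, deriv h t = -((σ : ℤ) : ℂ) * h 0 := by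
  rcases Int.units_eq_one_or σ with rfl | rfl
  · have : {t : ℝ | 0 < (((1 : ℤˣ) : ℤ) : ℝ) * t} = Set.Ioi 0 := by ext; simp
    rw [this, hc.integral_Ioi_deriv_eq hh]
    simp
  · have : {t : ℝ | 0 < (((-1 : ℤˣ) : ℤ) : ℝ) * t} = Set.Iio 0 := by ext; simp
    rw [this, ← integral_Iic_eq_integral_Iio, hc.integral_Iic_deriv_eq hh]
    simp

/-- The divergence theorem in a half-space, for functions with compact support. -/
lemma integral_fderiv_halfSpace {d : ℕ} (σ : ℤˣ) {h : Plane d × ℝ → ℂ} (hh : ContDiff ℝ 1 h)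
    (hc : HasCompactSupport h) (v : Plane d × ℝ) :
    ∫ x in halfSpace d σ, fderiv ℝ h x v = -((σ : ℤ) : ℂ) * (v.2 * ∫ y, h (y, 0)) := by
  have hd : Differentiable ℝ h := hh.differentiable one_ne_zero
  have hfc : ∀ v, Continuous fun x ↦ fderiv ℝ h x v := fun v ↦
    (hh.continuous_fderiv one_ne_zero).clm_apply continuous_const
  have hfs : ∀ v, HasCompactSupport fun x ↦ fderiv ℝ h x v := fun v ↦
    (hc.fderiv (𝕜 := ℝ)).comp_left (g := fun L : Plane d × ℝ →L[ℝ] ℂ ↦ L v) rfl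
  have hint : ∀ v, Integrable (fun x ↦ fderiv ℝ h x v)
      ((volume : Measure (Plane d)).prod
        ((volume : Measure ℝ).restrict {t | 0 < ((σ : ℤ) : ℝ) * t})) := fun v ↦ by
    rw [← restrict_halfSpace]
    exact ((hfc v).integrable_of_hasCompactSupport (hfs v)).integrableOn
  have hclosedy : ∀ t : ℝ, Topology.IsClosedEmbedding fun y : Plane d ↦ (y, t) := fun t ↦
    ⟨isEmbedding_prodMkLeft t, by
      have : Set.range (fun y : Plane d ↦ (y, t)) = Set.univ ×ˢ {t} := by
        ext ⟨a, b⟩; simp [eq_comm]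
      rw [this]; exact isClosed_univ.prod isClosed_singleton⟩
  have hclosedt : ∀ y : Plane d, Topology.IsClosedEmbedding fun t : ℝ ↦ (y, t) := fun y ↦
    ⟨isEmbedding_prodMkRight y, by
      have : Set.range (fun t : ℝ ↦ (y, t)) = {y} ×ˢ Set.univ := by
        ext ⟨a, b⟩; simp [eq_comm]
      rw [this]; exact isClosed_singleton.prod isClosed_univ⟩
  have h1 : ∫ x in halfSpace d σ, fderiv ℝ h x (v.1, 0) = 0 := by
    rw [restrict_halfSpace, integral_prod_symm _ (hint _)]
    refine integral_eq_zero_of_ae (Filter.Eventually.of_forall fun t ↦ ?_)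
    have hg : ContDiff ℝ 1 fun y : Plane d ↦ h (y, t) := hh.comp (by fun_prop)
    have hgc : HasCompactSupport fun y : Plane d ↦ h (y, t) :=
      hc.comp_isClosedEmbedding (hclosedy t)
    have e : ∀ y : Plane d, fderiv ℝ h (y, t) (v.1, 0) = fderiv ℝ (fun y ↦ h (y, t)) y v.1 := by
      intro y
      have h2 : HasFDerivAt (fun y : Plane d ↦ (y, t)) (ContinuousLinearMap.inl ℝ (Plane d) ℝ) y :=
        hasFDerivAt_prodMk_left y t
      have := ((hd (y, t)).hasFDerivAt.comp y h2).fderiv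
      rw [show (fun y ↦ h (y, t)) = h ∘ fun y ↦ (y, t) from rfl, this]
      simp
    simp_rw [e, Pi.zero_apply]
    have hgi : Integrable fun y ↦ fderiv ℝ (fun y : Plane d ↦ h (y, t)) y v.1 :=
      ((hg.continuous_fderiv one_ne_zero).clm_apply
        continuous_const).integrable_of_hasCompactSupport
        ((hgc.fderiv (𝕜 := ℝ)).comp_left (g := fun L : Plane d →L[ℝ] ℂ ↦ L v.1) rfl)
    have := integral_mul_fderiv_eq_neg_fderiv_mul_of_integrable (μ := (volume : Measure (Plane d)))
      (f := fun _ : Plane d ↦ (1 : ℂ)) (g := fun y ↦ h (y, t)) (v := v.1) (by simp)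
      (by simpa using hgi) (by simpa using hg.continuous.integrable_of_hasCompactSupport hgc)
      (fun x _ ↦ by fun_prop) (fun x _ ↦ hg.differentiable one_ne_zero x)
    simpa using this
  have h2 : ∫ x in halfSpace d σ, fderiv ℝ h x (0, v.2) =
      -((σ : ℤ) : ℂ) * (v.2 * ∫ y, h (y, 0)) := by
    rw [restrict_halfSpace, integral_prod _ (hint _), ← integral_const_mul, ← integral_const_mul]
    congr 1
    funext y
    have hg : ContDiff ℝ 1 fun t : ℝ ↦ h (y, t) := hh.comp (by fun_prop)
    have hgc : HasCompactSupport fun t : ℝ ↦ h (y, t) :=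
      hc.comp_isClosedEmbedding (hclosedt y)
    have e : ∀ t : ℝ, fderiv ℝ h (y, t) (0, v.2) = v.2 * deriv (fun t ↦ h (y, t)) t := by
      intro t
      have h2 : HasFDerivAt (fun t : ℝ ↦ (y, t)) (ContinuousLinearMap.inr ℝ (Plane d) ℝ) t :=
        hasFDerivAt_prodMk_right y t
      have h3 := ((hd (y, t)).hasFDerivAt.comp t h2).hasDerivAt.deriv
      rw [show (fun t ↦ h (y, t)) = h ∘ fun t ↦ (y, t) from rfl, h3,
        show ((0 : Plane d), v.2) = v.2 • ((0 : Plane d), (1 : ℝ)) by simp, map_smul,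
        Complex.real_smul]
      simp
    simp_rw [e]
    rw [integral_const_mul, integral_deriv_halfLine σ hg hgc]
    ring
  have e : ∀ x, fderiv ℝ h x v = fderiv ℝ h x (v.1, 0) + fderiv ℝ h x (0, v.2) := fun x ↦ by
    rw [← map_add]; simp
  simp_rw [e]
  rw [integral_add, h1, h2, zero_add]
  · exact ((hfc _).integrable_of_hasCompactSupport (hfs _)).integrableOn
  · exact ((hfc _).integrable_of_hasCompactSupport (hfs _)).integrableOn

/-- The symbol of the derivative of plane waves in direction `v`, in the half-space `U^σ`. -/
noncomputable def waveDeriv {d : ℕ} (k : ℝ) (σ : ℤˣ) (v : Plane d × ℝ) (ξ : Plane d) : ℂ :=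
  2 * Real.pi * Complex.I * (inner ℝ v.1 ξ : ℝ) - ((σ : ℤ) : ℂ) * v.2 * outRoot k ξ

section ibp
variable {d : ℕ} {k : ℝ}

lemma continuous_waveDeriv (σ : ℤˣ) (v : Plane d × ℝ) :
    Continuous (fun ξ ↦ waveDeriv k σ v ξ) := by
  have := continuous_outRoot (d := d) k
  unfold waveDeriv
  fun_prop

lemma norm_waveDeriv_le (σ : ℤˣ) (v : Plane d × ℝ) (ξ : Plane d) :
    ‖waveDeriv k σ v ξ‖ ≤ (‖v.1‖ + |v.2|) * besselWeight k 1 ξ := by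
  have hσ : ‖((σ : ℤ) : ℂ)‖ = 1 := by
    rcases Int.units_eq_one_or σ with rfl | rfl <;> simp
  rw [waveDeriv, add_mul]
  refine (norm_sub_le _ _).trans (add_le_add ?_ ?_)
  · have h1 : ‖2 * (Real.pi : ℂ) * Complex.I * (inner ℝ v.1 ξ : ℝ)‖ =
        2 * Real.pi * |inner ℝ v.1 ξ| := by
      simp [abs_of_pos Real.pi_pos]
    have hpi := Real.pi_pos
    rw [h1, besselWeight_one_eq]
    calc 2 * Real.pi * |inner ℝ v.1 ξ| ≤ 2 * Real.pi * (‖v.1‖ * ‖ξ‖) := by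
          gcongr; exact abs_real_inner_le_norm _ _
      _ = ‖v.1‖ * (2 * Real.pi * ‖ξ‖) := by ring
      _ ≤ _ := by
          gcongr
          exact Real.le_sqrt_of_sq_le (by nlinarith [sq_nonneg k])
  · rw [norm_mul, norm_mul, hσ, one_mul, Complex.norm_real, Real.norm_eq_abs]
    gcongr
    exact norm_outRoot_le k ξ

/-- Integration by parts against a single plane wave. -/
lemma integral_planeWave_ibp (σ : ℤˣ) {θ : Plane d × ℝ → ℂ} (hθ : ContDiff ℝ ∞ θ)
    (hc : HasCompactSupport θ) {w : 𝓢(Plane d, ℂ)} (hw : ∀ y, w y = θ (y, 0))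
    (v : Plane d × ℝ) (ξ : Plane d) :
    ∫ x in halfSpace d σ, (planeWave k x ξ * fderiv ℝ θ x v +
      waveDeriv k σ v ξ * planeWave k x ξ * θ x) = -((σ : ℤ) : ℂ) * (v.2 * (𝓕⁻ w) ξ) := by
  set E : Plane d × ℝ → ℂ := fun x ↦ Complex.exp (2 * Real.pi * Complex.I * (inner ℝ x.1 ξ : ℝ) -
    ((σ : ℤ) : ℂ) * x.2 * outRoot k ξ) with hE
  have hEs : ContDiff ℝ ∞ E := by
    have h1 : ContDiff ℝ ∞ (fun x : Plane d × ℝ ↦ ((inner ℝ x.1 ξ : ℝ) : ℂ)) :=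
      Complex.ofRealCLM.contDiff.comp (contDiff_fst.inner ℝ contDiff_const)
    have h2 : ContDiff ℝ ∞ (fun x : Plane d × ℝ ↦ (x.2 : ℂ)) :=
      Complex.ofRealCLM.contDiff.comp contDiff_snd
    rw [hE]
    exact ((contDiff_const.mul h1).sub ((contDiff_const.mul h2).mul contDiff_const)).cexp
  have hEd : ∀ x, fderiv ℝ E x v = waveDeriv k σ v ξ * E x := by
    intro x
    have h1 : HasFDerivAt (fun x : Plane d × ℝ ↦ ((inner ℝ x.1 ξ : ℝ) : ℂ))
        (Complex.ofRealCLM ∘L (innerSL ℝ ξ) ∘L ContinuousLinearMap.fst ℝ (Plane d) ℝ) x := by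
      have := (Complex.ofRealCLM ∘L (innerSL ℝ ξ) ∘L
        ContinuousLinearMap.fst ℝ (Plane d) ℝ).hasFDerivAt (x := x)
      convert! this using 1
      funext y
      simp [real_inner_comm]
    have h2 : HasFDerivAt (fun x : Plane d × ℝ ↦ (x.2 : ℂ))
        (Complex.ofRealCLM ∘L ContinuousLinearMap.snd ℝ (Plane d) ℝ) x :=
      (Complex.ofRealCLM ∘L ContinuousLinearMap.snd ℝ (Plane d) ℝ).hasFDerivAt
    have h3 : HasFDerivAt E _ x := ((h1.const_mul (2 * (Real.pi : ℂ) * Complex.I)).sub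
      ((h2.const_mul ((σ : ℤ) : ℂ)).mul_const (outRoot k ξ))).cexp
    rw [h3.fderiv, waveDeriv]
    simp [hE, real_inner_comm]
    ring
  have hEeq : ∀ x ∈ halfSpace d σ, planeWave k x ξ = E x := by
    intro x hx
    rw [planeWave, ← Complex.exp_add, hE, abs_snd_of_mem_halfSpace hx]
    congr 1
    push_cast
    ring
  have hmain := integral_fderiv_halfSpace σ (h := fun x ↦ E x * θ x)
    ((hEs.mul hθ).of_le (by norm_num)) hc.mul_left v
  have hdE : Differentiable ℝ E := hEs.differentiable (by norm_num)
  have hdθ : Differentiable ℝ θ := hθ.differentiable (by norm_num)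
  calc _ = ∫ x in halfSpace d σ, fderiv ℝ (fun x ↦ E x * θ x) x v := by
        refine setIntegral_congr_fun (measurableSet_halfSpace d σ) fun x hx ↦ ?_
        beta_reduce
        rw [fderiv_fun_mul (hdE x) (hdθ x), hEeq x hx]
        simp only [add_apply, smul_apply, smul_eq_mul, hEd]
        ring
    _ = _ := by
        rw [hmain, SchwartzMap.fourierInv_coe, Real.fourierInv_eq']
        congr 3
        funext y
        rw [hE, hw, smul_eq_mul]
        simp only
        congr 2
        rw [real_inner_comm]
        push_cast
        ring

lemma integral_wavePotential_mul {c : Plane d → ℂ} (hc : Integrable c) {ψ : Plane d × ℝ → ℂ}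
    (hψ : Continuous ψ) (hψc : HasCompactSupport ψ) (S : Set (Plane d × ℝ)) :
    Integrable (fun ξ ↦ ∫ x in S, c ξ * planeWave k x ξ * ψ x) ∧
    ∫ x in S, wavePotential k c x * ψ x = ∫ ξ, ∫ x in S, c ξ * planeWave k x ξ * ψ x := by
  have hint : Integrable (Function.uncurry fun (x : Plane d × ℝ) (ξ : Plane d) ↦
      c ξ * planeWave k x ξ * ψ x) ((volume.restrict S).prod volume) := by
    have h1 : Integrable (fun p : (Plane d × ℝ) × Plane d ↦ ψ p.1 * c p.2)
        ((volume.restrict S).prod volume) :=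
      (hψ.integrable_of_hasCompactSupport hψc).integrableOn.integrable.mul_prod hc
    refine (h1.mul_bdd (c := 1) (continuous_planeWave (k := k)).aestronglyMeasurable
      (Filter.Eventually.of_forall fun p ↦ norm_planeWave_le_one p.1 p.2)).congr
      (Filter.Eventually.of_forall fun p ↦ ?_)
    simp only [Function.uncurry]
    ring
  refine ⟨hint.integral_prod_right, ?_⟩
  rw [← integral_integral_swap hint]
  congr 1
  funext x
  rw [wavePotential, ← integral_mul_const]

lemma IsWaveDensity.integrable_mul_schwartz (hk : 0 < k) {b : Plane d → ℂ}
    (hb : IsWaveDensity k (-(1 / 2)) b) (w : 𝓢(Plane d, ℂ)) :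
    Integrable (fun ξ ↦ b ξ * w ξ) := by
  obtain ⟨M, -, hM⟩ := w.decay 0 0
  have hM' : ∀ ξ, ‖w ξ‖ ≤ M := fun ξ ↦ by simpa using hM ξ
  have h1 := hb.low.mul_bdd (w.continuous.aestronglyMeasurable) (Filter.Eventually.of_forall hM')
  have h2 := hb.high.integrable_mul (memLp_besselWeight_mul hk (1 / 2) w)
  refine (h1.add h2).congr (Filter.Eventually.of_forall fun ξ ↦ ?_)
  simp only [Pi.add_apply, Pi.mul_apply]
  have h3 : (besselWeight k (-(1 / 2)) ξ : ℂ) * (besselWeight k (1 / 2) ξ : ℂ) = 1 := by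
    exact_mod_cast besselWeight_neg_mul hk (1 / 2) ξ
  rw [← indicator_add b (Metric.ball 0 (k / Real.pi)) ξ]
  linear_combination ((Metric.ball 0 (k / Real.pi))ᶜ.indicator b ξ * w ξ) * h3

lemma tendsto_integral_indicator_ball_mul {b w : Plane d → ℂ}
    (hb : AEStronglyMeasurable b volume) (hw : AEStronglyMeasurable w volume)
    (hbw : Integrable (fun ξ ↦ b ξ * w ξ)) :
    Filter.Tendsto (fun N : ℕ ↦ ∫ ξ, (Metric.ball 0 (N : ℝ)).indicator b ξ * w ξ)
      Filter.atTop (𝓝 (∫ ξ, b ξ * w ξ)) := by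
  refine tendsto_integral_of_dominated_convergence (fun ξ ↦ ‖b ξ * w ξ‖)
    (fun N ↦ (hb.indicator measurableSet_ball).mul hw)
    hbw.norm (fun N ↦ Filter.Eventually.of_forall fun ξ ↦ ?_)
    (Filter.Eventually.of_forall fun ξ ↦ ?_)
  · rw [norm_mul, norm_mul]
    gcongr
    exact norm_indicator_le_norm_self _ _
  · refine tendsto_const_nhds.congr' ?_
    obtain ⟨N, hN⟩ := exists_nat_gt ‖ξ‖
    filter_upwards [Filter.eventually_ge_atTop N] with n hn
    rw [Set.indicator_of_mem]
    rw [mem_ball_zero_iff]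
    exact hN.trans_le (by exact_mod_cast hn)

lemma continuous_fderiv_apply_of_contDiff {θ : Plane d × ℝ → ℂ} (hθ : ContDiff ℝ ∞ θ)
    (v : Plane d × ℝ) : Continuous fun x ↦ fderiv ℝ θ x v :=
  (hθ.continuous_fderiv (by norm_num)).clm_apply continuous_const

lemma hasCompactSupport_fderiv_apply {θ : Plane d × ℝ → ℂ} (hc : HasCompactSupport θ)
    (v : Plane d × ℝ) : HasCompactSupport fun x ↦ fderiv ℝ θ x v :=
  (hc.fderiv (𝕜 := ℝ)).comp_left (g := fun L : Plane d × ℝ →L[ℝ] ℂ ↦ L v) rfl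

/-- Integration by parts for truncated densities, which are integrable, so that the integrals over `x`
and `ξ` can be exchanged. -/
lemma integral_truncation_ibp {b : Plane d → ℂ} (hb : LocallyIntegrable b volume)
    (σ : ℤˣ) (v : Plane d × ℝ) (hm : LocallyIntegrable (fun ξ ↦ waveDeriv k σ v ξ * b ξ) volume)
    {θ : Plane d × ℝ → ℂ} (hθ : ContDiff ℝ ∞ θ)
    (hc : HasCompactSupport θ) {w : 𝓢(Plane d, ℂ)} (hw : ∀ y, w y = θ (y, 0)) (r : ℝ) :
    (∫ x in halfSpace d σ,
        wavePotential k ((Metric.ball 0 r).indicator b) x * fderiv ℝ θ x v) +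
      (∫ x in halfSpace d σ, wavePotential k
        ((Metric.ball 0 r).indicator fun ξ ↦ waveDeriv k σ v ξ * b ξ) x * θ x) =
      -((σ : ℤ) : ℂ) * (v.2 * ∫ ξ, (Metric.ball 0 r).indicator b ξ * (𝓕⁻ w) ξ) := by
  have hdc := continuous_fderiv_apply_of_contDiff hθ v
  have hds := hasCompactSupport_fderiv_apply hc v
  have hi : ∀ c : Plane d → ℂ, LocallyIntegrable c volume →
      Integrable ((Metric.ball 0 r).indicator c) := fun c hc ↦
    ((hc.integrableOn_isCompact (isCompact_closedBall 0 r)).mono_set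
      Metric.ball_subset_closedBall).integrable_indicator measurableSet_ball
  obtain ⟨i1, e1⟩ := integral_wavePotential_mul (k := k) (hi b hb) hdc hds (halfSpace d σ)
  obtain ⟨i2, e2⟩ := integral_wavePotential_mul (k := k) (hi _ hm) hθ.continuous hc
    (halfSpace d σ)
  rw [e1, e2, ← integral_add i1 i2, ← integral_const_mul, ← integral_const_mul]
  refine integral_congr_ae (Filter.Eventually.of_forall fun ξ ↦ ?_)
  beta_reduce
  have hpw : Continuous fun x : Plane d × ℝ ↦ planeWave k x ξ := by
    unfold planeWave; fun_prop
  have j1 : ∀ z : ℂ, IntegrableOn (fun x ↦ z * planeWave k x ξ * fderiv ℝ θ x v)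
      (halfSpace d σ) volume := fun z ↦
    (((continuous_const.mul hpw).mul hdc).integrable_of_hasCompactSupport hds.mul_left).integrableOn
  have j2 : ∀ z : ℂ, IntegrableOn (fun x ↦ z * planeWave k x ξ * θ x)
      (halfSpace d σ) volume := fun z ↦
    (((continuous_const.mul hpw).mul hθ.continuous).integrable_of_hasCompactSupport
      hc.mul_left).integrableOn
  have h3 := integral_planeWave_ibp (k := k) σ hθ hc hw v ξ
  rw [← integral_add (j1 _) (j2 _)]
  calc _ = ∫ x in halfSpace d σ, (Metric.ball 0 r).indicator b ξ *
        (planeWave k x ξ * fderiv ℝ θ x v + waveDeriv k σ v ξ * planeWave k x ξ * θ x) := by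
        refine setIntegral_congr_fun (measurableSet_halfSpace d σ) fun x _ ↦ ?_
        beta_reduce
        by_cases hξ : ξ ∈ Metric.ball (0 : Plane d) r
        · rw [Set.indicator_of_mem hξ, Set.indicator_of_mem hξ]
          ring
        · rw [Set.indicator_of_notMem hξ, Set.indicator_of_notMem hξ]
          ring
    _ = _ := by
        rw [integral_const_mul, h3]
        ring

/-- Integration by parts for superpositions of plane waves: for every density in the weighted space
of order `1/2`, the weak derivatives in the half-spaces are obtained by multiplying the density by
the symbol, and the boundary values are the inverse Fourier transform of the density. -/
lemma integral_wavePotential_ibp (hk : 0 < k) {b : Plane d → ℂ} (hb : IsWaveDensity k (1 / 2) b)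
    (σ : ℤˣ) {θ : Plane d × ℝ → ℂ} (hθ : ContDiff ℝ ∞ θ)
    (hc : HasCompactSupport θ) {w : 𝓢(Plane d, ℂ)} (hw : ∀ y, w y = θ (y, 0))
    (v : Plane d × ℝ) :
    ∫ x in halfSpace d σ, (wavePotential k b x * fderiv ℝ θ x v +
      wavePotential k (fun ξ ↦ waveDeriv k σ v ξ * b ξ) x * θ x) =
      -((σ : ℤ) : ℂ) * (v.2 * ∫ ξ, b ξ * (𝓕⁻ w) ξ) := by
  have hb' := hb.of_half hk
  have hm := hb.mul hk (continuous_waveDeriv σ v) (norm_waveDeriv_le (k := k) σ v)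
  have hdc := continuous_fderiv_apply_of_contDiff hθ v
  have hds := hasCompactSupport_fderiv_apply hc v
  rw [integral_add (hb'.integrable_mul hk hdc hds).integrableOn
    (hm.integrable_mul hk hθ.continuous hc).integrableOn]
  refine tendsto_nhds_unique ((hb'.tendsto_integral_truncation hk hdc hds (halfSpace d σ)).add
    (hm.tendsto_integral_truncation hk hθ.continuous hc (halfSpace d σ))) ?_
  have t3 := tendsto_integral_indicator_ball_mul (hb'.aestronglyMeasurable hk)
    (𝓕⁻ w).continuous.aestronglyMeasurable (hb'.integrable_mul_schwartz hk (𝓕⁻ w))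
  refine ((t3.const_mul (v.2 : ℂ)).const_mul (-((σ : ℤ) : ℂ))).congr fun N ↦ ?_
  exact (integral_truncation_ibp (hb'.locallyIntegrable hk) σ v (hm.locallyIntegrable hk) hθ hc hw
    N).symm

end ibp

/-! ### Weak gradients and traces -/

/-- The real linear functional on `ℝᵈ × ℝ` with the values of `c` on the standard basis. -/
noncomputable def ofComponents {d : ℕ} (c : Plane d × ℝ → ℂ) : Plane d × ℝ →L[ℝ] ℂ :=
  (∑ j, (EuclideanSpace.proj j ∘L ContinuousLinearMap.fst ℝ (Plane d) ℝ).smulRight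
    (c (EuclideanSpace.single j 1, 0))) +
  (ContinuousLinearMap.snd ℝ (Plane d) ℝ).smulRight (c (0, 1))

lemma ofComponents_apply {d : ℕ} {c : Plane d × ℝ → ℂ} (hadd : ∀ v w, c (v + w) = c v + c w)
    (hsmul : ∀ (r : ℝ) v, c (r • v) = r • c v) (v : Plane d × ℝ) : ofComponents c v = c v := by
  let L : Plane d × ℝ →ₗ[ℝ] ℂ := { toFun := c, map_add' := hadd, map_smul' := hsmul }
  have hv : v = (∑ j, v.1 j • ((EuclideanSpace.single j 1, 0) : Plane d × ℝ)) +
      v.2 • ((0, 1) : Plane d × ℝ) := by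
    refine Prod.ext ?_ ?_
    · have := (EuclideanSpace.basisFun (Fin d) ℝ).sum_repr v.1
      simpa [Prod.fst_sum] using this.symm
    · simp [Prod.snd_sum]
  have h : L v = (∑ j, v.1 j • L (EuclideanSpace.single j 1, 0)) + v.2 • L (0, 1) := by
    conv_lhs => rw [hv]
    rw [map_add, map_sum, map_smul]
    simp_rw [map_smul]
  change _ = L v
  rw [h]
  simp [ofComponents, L]

lemma memLp_smulRight {E α : Type*} [NormedAddCommGroup E] [NormedSpace ℝ E]
    [MeasurableSpace α] {μ : Measure α} (L : E →L[ℝ] ℝ) {c : α → ℂ} (hc : MemLp c 2 μ) :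
    MemLp (fun x ↦ L.smulRight (c x)) 2 μ := by
  have hL : Continuous fun z : ℂ ↦ L.smulRight z :=
    (ContinuousLinearMap.smulRightL ℝ E ℂ L).continuous
  refine hc.of_le_mul (c := ‖L‖) (hL.comp_aestronglyMeasurable hc.1)
    (Filter.Eventually.of_forall fun x ↦ ?_)
  rw [ContinuousLinearMap.norm_smulRight_apply]

lemma memLp_sum_add {F ι α : Type*} [NormedAddCommGroup F] [Fintype ι] [MeasurableSpace α]
    {μ : Measure α} {f : ι → α → F} {g : α → F} (hf : ∀ j, MemLp (f j) 2 μ) (hg : MemLp g 2 μ) :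
    MemLp (fun x ↦ (∑ j, f j x) + g x) 2 μ :=
  (memLp_finsetSum Finset.univ fun j _ ↦ hf j).add hg

lemma memLp_sum_smulRight_add {E ι α : Type*} [NormedAddCommGroup E] [NormedSpace ℝ E] [Fintype ι]
    [MeasurableSpace α] {μ : Measure α} (L : ι → E →L[ℝ] ℝ) (M : E →L[ℝ] ℝ) {c : ι → α → ℂ}
    {c' : α → ℂ} (hc : ∀ j, MemLp (c j) 2 μ) (hc' : MemLp c' 2 μ) :
    MemLp (fun x ↦ (∑ j, (L j).smulRight (c j x)) + M.smulRight (c' x)) 2 μ :=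
  memLp_sum_add (F := E →L[ℝ] ℂ) (f := fun j x ↦ (L j).smulRight (c j x))
    (g := fun x ↦ M.smulRight (c' x)) (fun j ↦ memLp_smulRight (L j) (hc j)) (memLp_smulRight M hc')

lemma memLp_ofComponents {d : ℕ} {μ : Measure (Plane d × ℝ)} {c : Plane d × ℝ → Plane d × ℝ → ℂ}
    (hc : ∀ v, MemLp (fun x ↦ c x v) 2 μ) : MemLp (fun x ↦ ofComponents (c x)) 2 μ := by
  unfold ofComponents
  exact memLp_sum_smulRight_add (fun j : Fin d ↦ EuclideanSpace.proj j ∘L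
    ContinuousLinearMap.fst ℝ (Plane d) ℝ) (ContinuousLinearMap.snd ℝ (Plane d) ℝ)
    (c := fun j x ↦ c x (EuclideanSpace.single j 1, 0)) (c' := fun x ↦ c x (0, 1))
    (fun j ↦ hc _) (hc _)

section
variable {d : ℕ} {k : ℝ} {b : Plane d → ℂ}

lemma wavePotential_waveDeriv_add (hk : 0 < k) (hb : IsWaveDensity k (1 / 2) b) (σ : ℤˣ)
    {x : Plane d × ℝ} (hx : x.2 ≠ 0) (v w : Plane d × ℝ) :
    wavePotential k (fun ξ ↦ waveDeriv k σ (v + w) ξ * b ξ) x =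
      wavePotential k (fun ξ ↦ waveDeriv k σ v ξ * b ξ) x +
      wavePotential k (fun ξ ↦ waveDeriv k σ w ξ * b ξ) x := by
  have h := fun v ↦ (hb.mul hk (continuous_waveDeriv σ v)
    (norm_waveDeriv_le (k := k) σ v)).integrable_planeWave hk hx
  unfold wavePotential
  rw [← integral_add (h v) (h w)]
  refine integral_congr_ae (Filter.Eventually.of_forall fun ξ ↦ ?_)
  simp only [waveDeriv, Prod.fst_add, Prod.snd_add, inner_add_left]
  push_cast
  ring

lemma wavePotential_waveDeriv_smul (σ : ℤˣ) (x : Plane d × ℝ) (r : ℝ) (v : Plane d × ℝ) :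
    wavePotential k (fun ξ ↦ waveDeriv k σ (r • v) ξ * b ξ) x =
      r • wavePotential k (fun ξ ↦ waveDeriv k σ v ξ * b ξ) x := by
  unfold wavePotential
  rw [← integral_smul]
  refine integral_congr_ae (Filter.Eventually.of_forall fun ξ ↦ ?_)
  simp only [waveDeriv, Prod.smul_fst, Prod.smul_snd, real_inner_smul_left, Complex.real_smul,
    smul_eq_mul]
  push_cast
  ring

/-- The product of a superposition of plane waves and a test function is in `W¹` of both
half-spaces, and its traces are the inverse Fourier transform of the density times the boundary
values of the test function. The values of `u` on the hyperplane, a null set, are immaterial. -/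
lemma hasTrace_mul_wavePotential (hk : 0 < k) (hb : IsWaveDensity k (1 / 2) b) (σ : ℤˣ)
    {χ u : Plane d × ℝ → ℂ} (hχ : IsTest Set.univ χ)
    (hu : ∀ x, x.2 ≠ 0 → u x = χ x * wavePotential k b x) {g : 𝓢'(Plane d, ℂ)}
    (hg : ∀ w w' : 𝓢(Plane d, ℂ), (∀ y, w' y = χ (y, 0) * w y) → g w = ∫ ξ, b ξ * (𝓕⁻ w') ξ) :
    HasTrace σ u g := by
  obtain ⟨hχs, hχc, -⟩ := hχ
  have hb' := hb.of_half hk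
  have hm := fun v ↦ hb.mul hk (continuous_waveDeriv σ v) (norm_waveDeriv_le (k := k) σ v)
  set c : Plane d × ℝ → Plane d × ℝ → ℂ := fun x v ↦
    wavePotential k (fun ξ ↦ waveDeriv k σ v ξ * b ξ) x * χ x +
      wavePotential k b x * fderiv ℝ χ x v with hc
  have hcv : ∀ x ∈ halfSpace d σ, ∀ v, ofComponents (c x) v = c x v := by
    intro x hx v
    refine ofComponents_apply (fun v w ↦ ?_) (fun r v ↦ ?_) v
    · simp only [hc]
      rw [wavePotential_waveDeriv_add hk hb σ (snd_ne_zero_of_mem_halfSpace hx), map_add]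
      ring
    · simp only [hc]
      rw [wavePotential_waveDeriv_smul, map_smul, Complex.real_smul, Complex.real_smul,
        Complex.real_smul]
      ring
  have hχd := continuous_fderiv_apply_of_contDiff hχs
  have hχds := hasCompactSupport_fderiv_apply hχc
  have hcore : ∀ θ : Plane d × ℝ → ℂ, ContDiff ℝ ∞ θ → HasCompactSupport θ → ∀ v,
      IntegrableOn (fun x ↦ u x * fderiv ℝ θ x v) (halfSpace d σ) volume ∧
      IntegrableOn (fun x ↦ ofComponents (c x) v * θ x) (halfSpace d σ) volume ∧
      ∀ w' : 𝓢(Plane d, ℂ), (∀ y, w' y = χ (y, 0) * θ (y, 0)) →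
      ∫ x in halfSpace d σ, (u x * fderiv ℝ θ x v + ofComponents (c x) v * θ x) =
        -((σ : ℤ) : ℂ) * (v.2 * ∫ ξ, b ξ * (𝓕⁻ w') ξ) := by
    intro θ hθ hθc v
    have hθd := continuous_fderiv_apply_of_contDiff hθ v
    have i1 := (hb'.integrable_mul hk (hχs.continuous.mul hθd) hχc.mul_right).integrableOn
      (s := halfSpace d σ)
    have i2 := ((hm v).integrable_mul hk (hχs.continuous.mul hθ.continuous)
      hχc.mul_right).integrableOn (s := halfSpace d σ)
    have i3 := (hb'.integrable_mul hk ((hχd v).mul hθ.continuous)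
      (hχds v).mul_right).integrableOn (s := halfSpace d σ)
    refine ⟨i1.congr_fun (fun x hx ↦ ?_) (measurableSet_halfSpace d σ),
      (i2.add i3).congr_fun (fun x hx ↦ ?_) (measurableSet_halfSpace d σ), fun w' hw' ↦ ?_⟩
    · simp only [Pi.mul_apply]
      rw [hu x (snd_ne_zero_of_mem_halfSpace hx)]
      ring
    · simp only [Pi.mul_apply, Pi.add_apply]
      rw [hcv x hx, hc]
      ring
    rw [← integral_wavePotential_ibp hk hb σ (hχs.mul hθ) hχc.mul_right (w := w') hw' v]
    refine setIntegral_congr_fun (measurableSet_halfSpace d σ) fun x hx ↦ ?_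
    have e : fderiv ℝ (χ * θ) x v = χ x * fderiv ℝ θ x v + θ x * fderiv ℝ χ x v := by
      rw [fderiv_mul (hχs.differentiable (by norm_num) x) (hθ.differentiable (by norm_num) x)]
      simp
    have e' : fderiv ℝ (fun i ↦ χ i * θ i) x v = fderiv ℝ (χ * θ) x v := rfl
    beta_reduce
    rw [hcv x hx, hc, hu x (snd_ne_zero_of_mem_halfSpace hx), e', e]
    ring
  refine ⟨fun x ↦ ofComponents (c x), ⟨?_, ?_, ?_⟩, ?_⟩
  · refine ((hb'.memLp_mul hk hχs.continuous hχc).restrict _).ae_eq ?_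
    filter_upwards [ae_restrict_of_ae (ae_snd_ne_zero d)] with x hx
    rw [hu x hx, mul_comm]
  · refine memLp_ofComponents fun v ↦ ?_
    exact (((hm v).memLp_mul hk hχs.continuous hχc).add
      (hb'.memLp_mul hk (hχd v) (hχds v))).restrict _
  · rintro θ ⟨hθ, hθc, hθV⟩ v
    obtain ⟨i1, i2, h⟩ := hcore θ hθ hθc v
    have h0 := h 0 fun y ↦ by
      have : ((y, 0) : Plane d × ℝ) ∉ tsupport θ := fun hy ↦
        snd_ne_zero_of_mem_halfSpace (hθV hy) rfl
      simp [image_eq_zero_of_notMem_tsupport this]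
    rw [integral_add i1 i2] at h0
    have hz : (𝓕⁻ (0 : 𝓢(Plane d, ℂ))) = 0 := map_zero (FourierTransform.fourierInvCLM ℂ 𝓢(Plane d, ℂ))
    rw [hz] at h0
    simp only [zero_apply, mul_zero, integral_zero] at h0
    exact eq_neg_of_add_eq_zero_left h0
  · rintro θ ⟨hθ, hθc, -⟩ w hw
    obtain ⟨-, -, h⟩ := hcore θ hθ hθc (0, 1)
    have hemb : Topology.IsClosedEmbedding fun y : Plane d ↦ (y, (0 : ℝ)) :=
      ⟨isEmbedding_prodMkLeft 0, by
        have : Set.range (fun y : Plane d ↦ (y, (0 : ℝ))) = Set.univ ×ˢ {0} := by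
          ext ⟨a, b⟩; simp [eq_comm]
        rw [this]; exact isClosed_univ.prod isClosed_singleton⟩
    have hs : ContDiff ℝ ∞ fun y : Plane d ↦ χ (y, 0) * θ (y, 0) :=
      (hχs.comp (by fun_prop)).mul (hθ.comp (by fun_prop))
    have hcs : HasCompactSupport fun y : Plane d ↦ χ (y, 0) * θ (y, 0) :=
      HasCompactSupport.mul_right (hχc.comp_isClosedEmbedding hemb)
    have h1 := h (hcs.toSchwartzMap hs) fun y ↦ rfl
    rw [h1, hg w (hcs.toSchwartzMap hs) fun y ↦ by rw [hw]; rfl]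
    simp

/-- The trace is determined by the function on test functions. -/
lemma HasTrace.unique {σ : ℤˣ} {u : Plane d × ℝ → ℂ} {g g' : 𝓢'(Plane d, ℂ)}
    (h : HasTrace σ u g) (h' : HasTrace σ u g') {w : 𝓢(Plane d, ℂ)} (hw : HasCompactSupport w) :
    g w = g' w := by
  obtain ⟨G, ⟨-, hG2, hG⟩, hGt⟩ := h
  obtain ⟨G', ⟨-, hG2', hG'⟩, hGt'⟩ := h'
  have hopen : IsOpen (halfSpace d σ) :=
    isOpen_lt continuous_const (continuous_snd.const_mul _)
  have happ : ∀ {G : Plane d × ℝ → Plane d × ℝ →L[ℝ] ℂ},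
      MemLp G 2 (volume.restrict (halfSpace d σ)) →
      MemLp (fun x ↦ G x (0, 1)) 2 (volume.restrict (halfSpace d σ)) := fun hG ↦
    (ContinuousLinearMap.apply ℝ ℂ ((0, 1) : Plane d × ℝ)).comp_memLp' hG
  -- Weak normal derivatives are unique almost everywhere.
  have hae : ∀ᵐ x : Plane d × ℝ, x ∈ halfSpace d σ → G x (0, 1) - G' x (0, 1) = 0 := by
    refine hopen.ae_eq_zero_of_integral_contDiff_smul_eq_zero ?_ fun f hf hfc hfs ↦ ?_
    · have h1 := (((happ hG2).sub (happ hG2')).locallyIntegrable (by norm_num))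
      rw [locallyIntegrableOn_iff hopen.isLocallyClosed]
      intro K hK hKc
      have h2 := h1.integrableOn_isCompact hKc
      rw [IntegrableOn, Measure.restrict_restrict_of_subset hK] at h2
      exact h2
    · have hθ : IsTest (halfSpace d σ) (fun x ↦ (f x : ℂ)) :=
        ⟨Complex.ofRealCLM.contDiff.comp hf, hfc.comp_left (g := Complex.ofReal) rfl,
          (tsupport_comp_subset (g := Complex.ofReal) rfl f).trans hfs⟩
      have e := hG _ hθ (0, 1)
      rw [hG' _ hθ (0, 1), neg_inj] at e
      have hθ2 : MemLp (fun x ↦ (f x : ℂ)) 2 (volume.restrict (halfSpace d σ)) :=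
        (hθ.1.continuous.memLp_of_hasCompactSupport hθ.2.1).restrict _
      have j1 := (happ hG2).integrable_mul hθ2
      have j2 := (happ hG2').integrable_mul hθ2
      have e2 : ∫ x, f x • (G x (0, 1) - G' x (0, 1)) =
          ∫ x in halfSpace d σ, f x • (G x (0, 1) - G' x (0, 1)) := by
        refine (setIntegral_eq_integral_of_forall_compl_eq_zero fun x hx ↦ ?_).symm
        rw [image_eq_zero_of_notMem_tsupport fun hx' ↦ hx (hfs hx'), zero_smul]
      rw [e2]
      calc _ = ∫ x in halfSpace d σ, (G x (0, 1) * f x - G' x (0, 1) * f x) := by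
            congr 1
            funext x
            rw [Complex.real_smul]
            ring
        _ = 0 := by
            refine (integral_sub j1 j2).trans ?_
            simp only [Pi.mul_apply]
            rw [← e, sub_self]
  -- Every test function `w` on the hyperplane is the boundary value of a test function `w(y) η(t)`.
  let η : ContDiffBump (0 : ℝ) := ⟨1, 2, one_pos, one_lt_two⟩
  have hη0 : η 0 = 1 := η.one_of_mem_closedBall (by simp [η])
  set θ : Plane d × ℝ → ℂ := fun x ↦ w x.1 * (η x.2 : ℂ) with hθ
  have hθs : ContDiff ℝ ∞ θ :=
    ((w.smooth ⊤).comp contDiff_fst).mul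
      (Complex.ofRealCLM.contDiff.comp (η.contDiff.comp contDiff_snd))
  have hθc : HasCompactSupport θ := by
    refine HasCompactSupport.intro (hw.isCompact.prod η.hasCompactSupport.isCompact) fun x hx ↦ ?_
    rw [Set.mem_prod, not_and_or] at hx
    rcases hx with hx | hx
    · simp [hθ, image_eq_zero_of_notMem_tsupport hx]
    · simp [hθ, image_eq_zero_of_notMem_tsupport hx]
  have hwθ : ∀ y, w y = θ (y, 0) := fun y ↦ by simp [hθ, hη0]
  have t1 := hGt θ ⟨hθs, hθc, Set.subset_univ _⟩ w hwθ
  have t2 := hGt' θ ⟨hθs, hθc, Set.subset_univ _⟩ w hwθ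
  have t3 : ∫ x in halfSpace d σ, (u x * fderiv ℝ θ x (0, 1) + G x (0, 1) * θ x) =
      ∫ x in halfSpace d σ, (u x * fderiv ℝ θ x (0, 1) + G' x (0, 1) * θ x) := by
    refine setIntegral_congr_ae (measurableSet_halfSpace d σ) ?_
    filter_upwards [hae] with x hx hxs
    rw [sub_eq_zero.1 (hx hxs)]
  rw [t1, t2] at t3
  refine mul_left_cancel₀ ?_ t3
  rcases Int.units_eq_one_or σ with rfl | rfl <;> simp

end

/-! ### The single-layer potential as a superposition of plane waves -/

/-- The density `φ̂ / (2μ)` of plane waves in the single-layer potential of `φ`. The quotient is `0`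
on the null set `μ = 0`. -/
noncomputable def layerDensity {d : ℕ} {k s : ℝ} (φ : sobolev d k s) (ξ : Plane d) : ℂ :=
  fourierDensity φ ξ / (2 * outRoot k ξ)

section
variable {d : ℕ} {k : ℝ} {Γ : Set (Plane d)}

lemma mem_sobolevTilde_of_testFunction {s : ℝ} {u : sobolev d k s} {θ : 𝓢(Plane d, ℂ)}
    (hθ : θ ∈ testFunctions Γ)
    (hu : (u : 𝓢'(Plane d, ℂ)) = SchwartzMap.toTemperedDistributionCLM (Plane d) ℂ volume θ) :
    u ∈ sobolevTilde k s Γ :=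
  Submodule.le_topologicalClosure _ (Submodule.mem_map_of_mem ⟨θ, hθ, hu.symm⟩)

/-- At high frequencies the symbol `1/(2μ)` gains one order of decay. -/
lemma one_div_two_mul_norm_outRoot_le (hk : 0 < k) {ξ : Plane d} (hξ : k / Real.pi ≤ ‖ξ‖) :
    1 / (2 * ‖outRoot k ξ‖) ≤ besselWeight k (-1) ξ := by
  have h1 := besselWeight_one_le_outRoot_re hk hξ
  have h2 := Complex.abs_re_le_norm (outRoot k ξ)
  rw [abs_of_nonneg (outRoot_re_nonneg k ξ)] at h2
  have h3 := besselWeight_pos hk 1 ξ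
  have h4 : besselWeight k (-1) ξ = 1 / besselWeight k 1 ξ := by
    rw [eq_div_iff h3.ne', besselWeight_neg_mul hk]
  rw [h4]
  exact one_div_le_one_div_of_le h3 (by linarith)

/-- At low frequencies the symbol `1/(2μ)` is integrable, in spite of its singularity on the sphere
`2π|ξ| = k`. -/
lemma integrable_indicator_inv_outRoot (hd : 0 < d) (hk : 0 < k) :
    Integrable ((Metric.ball (0 : Plane d) (k / Real.pi)).indicator
      fun ξ ↦ 1 / (2 * ‖outRoot k ξ‖)) := by
  have hpi := Real.pi_pos
  have hm : Measurable fun ξ : Plane d ↦ 1 / (2 * ‖outRoot k ξ‖) := by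
    have := (continuous_outRoot (d := d) k).measurable
    fun_prop
  have h := (integrable_pow_mul_exp_neg_outRoot hd hk one_pos 0).const_mul
    (1 / 2 * Real.exp (√(k ^ 2 + (2 * k) ^ 2)))
  refine h.mono' (hm.indicator measurableSet_ball).aestronglyMeasurable
    (Filter.Eventually.of_forall fun ξ ↦ ?_)
  by_cases hξ : ξ ∈ Metric.ball (0 : Plane d) (k / Real.pi)
  · rw [Set.indicator_of_mem hξ, Real.norm_of_nonneg (by positivity)]
    rw [mem_ball_zero_iff, lt_div_iff₀ hpi] at hξ
    have h1 : (outRoot k ξ).re ≤ √(k ^ 2 + (2 * k) ^ 2) := by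
      refine (Complex.re_le_norm _).trans ((norm_outRoot_le k ξ).trans ?_)
      rw [besselWeight_one_eq]
      have h2 : 2 * Real.pi * ‖ξ‖ ≤ 2 * k := by linarith
      gcongr
    have h3 : 1 ≤ Real.exp (√(k ^ 2 + (2 * k) ^ 2)) * Real.exp (-1 * (outRoot k ξ).re) := by
      rw [← Real.exp_add, Real.one_le_exp_iff]
      linarith
    calc 1 / (2 * ‖outRoot k ξ‖) = 1 * (1 / 2 * (1 / ‖outRoot k ξ‖)) := by
          rw [one_mul, one_div_mul_one_div]
      _ ≤ (Real.exp (√(k ^ 2 + (2 * k) ^ 2)) * Real.exp (-1 * (outRoot k ξ).re)) *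
          (1 / 2 * (1 / ‖outRoot k ξ‖)) := by gcongr
      _ = _ := by ring
  · rw [Set.indicator_of_notMem hξ, norm_zero]
    positivity

/-- At low frequencies `φ̂` is bounded and `1/μ` is integrable; at high frequencies division by `μ` gains
one order. -/
lemma isWaveDensity_layerDensity (hd : 0 < d) (hk : 0 < k) (hΓ : Bornology.IsBounded Γ)
    {φ : sobolev d k (-(1 / 2))} (hφ : φ ∈ sobolevTilde k (-(1 / 2)) Γ) :
    IsWaveDensity k (1 / 2) (layerDensity φ) := by
  have hm : AEStronglyMeasurable (layerDensity φ) volume := by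
    have h1 : AEStronglyMeasurable (fun ξ : Plane d ↦ (2 * outRoot k ξ)⁻¹) volume := by
      have := (continuous_outRoot (d := d) k).measurable
      exact Measurable.aestronglyMeasurable (by fun_prop)
    exact (aestronglyMeasurable_fourierDensity hk φ).mul h1
  have hnorm : ∀ ξ, ‖layerDensity φ ξ‖ = 1 / (2 * ‖outRoot k ξ‖) * ‖fourierDensity φ ξ‖ := by
    intro ξ
    rw [layerDensity, norm_div, norm_mul, Complex.norm_ofNat]
    ring
  constructor
  · obtain ⟨C, hC, hb⟩ := exists_bound_fourierDensity hk hΓ (k / Real.pi)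
    refine ((integrable_indicator_inv_outRoot hd hk).mul_const (C * sobolevNorm φ)).mono'
      (hm.indicator measurableSet_ball) ?_
    filter_upwards [hb φ hφ] with ξ hξ
    by_cases hmem : ξ ∈ Metric.ball (0 : Plane d) (k / Real.pi)
    · rw [Set.indicator_of_mem hmem, Set.indicator_of_mem hmem, hnorm]
      gcongr
      exact hξ (mem_ball_zero_iff.1 hmem).le
    · rw [Set.indicator_of_notMem hmem, Set.indicator_of_notMem hmem]
      simp
  · have hwm : AEStronglyMeasurable (fun ξ : Plane d ↦ (besselWeight k (1 / 2) ξ : ℂ)) volume :=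
      (Complex.continuous_ofReal.comp (continuous_besselWeight hk _)).aestronglyMeasurable
    refine (memLp_fourierDensity hk φ).mono (hwm.mul (hm.indicator measurableSet_ball.compl))
      (Filter.Eventually.of_forall fun ξ ↦ ?_)
    by_cases hmem : ξ ∈ (Metric.ball (0 : Plane d) (k / Real.pi))ᶜ
    · have hξ : k / Real.pi ≤ ‖ξ‖ := by simpa using hmem
      rw [Set.indicator_of_mem hmem, norm_mul, norm_mul, hnorm, Complex.norm_real,
        Complex.norm_real, Real.norm_of_nonneg (besselWeight_pos hk _ _).le,
        Real.norm_of_nonneg (besselWeight_pos hk _ _).le]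
      have e : besselWeight k (1 / 2) ξ * besselWeight k (-1) ξ = besselWeight k (-(1 / 2)) ξ := by
        rw [besselWeight_mul hk]; norm_num
      rw [← mul_assoc, ← e]
      have := besselWeight_pos hk (1 / 2) ξ
      gcongr
      exact one_div_two_mul_norm_outRoot_le hk hξ
    · rw [Set.indicator_of_notMem hmem]
      simp only [mul_zero, norm_zero]
      positivity

/-- Densities which are integrable at low and weighted `L²` at high frequencies define bounded
functionals on `H̃^{-1/2}(Γ)`. -/
lemma IsWaveDensity.exists_bound (hk : 0 < k) (hΓ : Bornology.IsBounded Γ) {q : Plane d → ℂ}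
    (hq : IsWaveDensity k (1 / 2) q) :
    ∃ C : ℝ, ∀ φ ∈ sobolevTilde k (-(1 / 2)) Γ, Integrable (fun ξ ↦ q ξ * fourierDensity φ ξ) ∧
      ‖∫ ξ, q ξ * fourierDensity φ ξ‖ ≤ C * sobolevNorm φ := by
  obtain ⟨C, hC, hb⟩ := exists_bound_fourierDensity hk hΓ (k / Real.pi)
  set qL := (Metric.ball (0 : Plane d) (k / Real.pi)).indicator q with hqL
  set qH := (Metric.ball (0 : Plane d) (k / Real.pi))ᶜ.indicator q with hqH
  have hH : MemLp (fun ξ ↦ (besselWeight k (-(-(1 / 2))) ξ : ℂ) * qH ξ) 2 volume := by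
    rw [neg_neg]; exact hq.high
  refine ⟨(∫ ξ, ‖qL ξ‖) * C + (eLpNorm (fun ξ ↦ (besselWeight k (-(-(1 / 2))) ξ : ℂ) * qH ξ) 2
    volume).toReal, fun φ hφ ↦ ?_⟩
  obtain ⟨i2, e2⟩ := integrable_mul_fourierDensity hk hH φ
  have hbd : ∀ᵐ ξ, ‖qL ξ * fourierDensity φ ξ‖ ≤ ‖qL ξ‖ * (C * sobolevNorm φ) := by
    filter_upwards [hb φ hφ] with ξ hξ
    rw [norm_mul]
    by_cases hmem : ξ ∈ Metric.ball (0 : Plane d) (k / Real.pi)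
    · gcongr
      exact hξ (mem_ball_zero_iff.1 hmem).le
    · rw [hqL, Set.indicator_of_notMem hmem]
      simp
  have i1 : Integrable (fun ξ ↦ qL ξ * fourierDensity φ ξ) :=
    (hq.low.norm.mul_const _).mono'
      (hq.low.1.mul (aestronglyMeasurable_fourierDensity hk φ)) hbd
  have e : (fun ξ ↦ q ξ * fourierDensity φ ξ) = fun ξ ↦
      qL ξ * fourierDensity φ ξ + qH ξ * fourierDensity φ ξ := by
    funext ξ
    rw [← add_mul, IsWaveDensity.indicator_add]
  rw [e]
  refine ⟨i1.add i2, ?_⟩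
  rw [integral_add i1 i2, add_mul]
  refine (norm_add_le _ _).trans (add_le_add ?_ e2)
  rw [mul_assoc, ← integral_mul_const]
  exact norm_integral_le_of_norm_le (hq.low.norm.mul_const _) hbd

lemma IsWaveDensity.tendsto (hk : 0 < k) (hΓ : Bornology.IsBounded Γ) {q : Plane d → ℂ}
    (hq : IsWaveDensity k (1 / 2) q) {φ : sobolev d k (-(1 / 2))}
    (hφ : φ ∈ sobolevTilde k (-(1 / 2)) Γ) {u : ℕ → sobolev d k (-(1 / 2))}
    (hu : ∀ n, u n ∈ sobolevTilde k (-(1 / 2)) Γ)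
    (hlim : Filter.Tendsto (fun n ↦ sobolevNorm (φ - u n)) Filter.atTop (𝓝 0)) :
    Filter.Tendsto (fun n ↦ ∫ ξ, q ξ * fourierDensity (u n) ξ) Filter.atTop
      (𝓝 (∫ ξ, q ξ * fourierDensity φ ξ)) := by
  obtain ⟨C, hC⟩ := hq.exists_bound hk hΓ
  rw [tendsto_iff_norm_sub_tendsto_zero]
  have h0 := hlim.const_mul C
  rw [mul_zero] at h0
  refine squeeze_zero (fun _ ↦ norm_nonneg _) (fun n ↦ ?_) h0
  refine le_trans (le_of_eq ?_) (hC _ (Submodule.sub_mem _ hφ (hu n))).2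
  rw [norm_sub_rev, ← integral_sub (hC _ hφ).1 (hC _ (hu n)).1]
  congr 1
  refine integral_congr_ae ?_
  filter_upwards [fourierDensity_sub φ (u n)] with ξ hξ
  rw [hξ, mul_sub]

/-- The inverse Fourier transform of `Φ(x, ·)` on the hyperplane, for `x` off the hyperplane:
together with `IsWaveDensity.exists_bound` it makes evaluation of the potential at `x` continuous on
`H̃^{-1/2}(Γ)`. -/
lemma isWaveDensity_planeWave_div (hd : 0 < d) (hk : 0 < k) {x : Plane d × ℝ} (hx : x.2 ≠ 0) :
    IsWaveDensity k (1 / 2) (fun ξ : Plane d ↦ planeWave k x ξ / (2 * outRoot k ξ)) := by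
  have hpw : Continuous fun ξ : Plane d ↦ planeWave k x ξ := by
    have := continuous_outRoot (d := d) k
    unfold planeWave; fun_prop
  have hm : Measurable (fun ξ : Plane d ↦ planeWave k x ξ / (2 * outRoot k ξ)) := by
    have := (continuous_outRoot (d := d) k).measurable
    have := hpw.measurable
    fun_prop
  have hnorm : ∀ ξ, ‖planeWave k x ξ / (2 * outRoot k ξ)‖ =
      1 / (2 * ‖outRoot k ξ‖) * ‖planeWave k x ξ‖ := by
    intro ξ
    rw [norm_div, norm_mul, Complex.norm_ofNat]
    ring
  constructor
  · refine (integrable_indicator_inv_outRoot hd hk).mono'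
      (hm.indicator measurableSet_ball).aestronglyMeasurable
      (Filter.Eventually.of_forall fun ξ ↦ ?_)
    by_cases hmem : ξ ∈ Metric.ball (0 : Plane d) (k / Real.pi)
    · rw [Set.indicator_of_mem hmem, Set.indicator_of_mem hmem, hnorm]
      exact mul_le_of_le_one_right (by positivity) (norm_planeWave_le_one x ξ)
    · rw [Set.indicator_of_notMem hmem, Set.indicator_of_notMem hmem, norm_zero]
  · have hwm : AEStronglyMeasurable (fun ξ : Plane d ↦ (besselWeight k (1 / 2) ξ : ℂ)) volume :=
      (Complex.continuous_ofReal.comp (continuous_besselWeight hk _)).aestronglyMeasurable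
    refine (memLp_besselWeight_mul_exp (d := d) hk (abs_pos.2 hx)).of_le_mul (c := 1 / k)
      (hwm.mul (hm.indicator measurableSet_ball.compl).aestronglyMeasurable)
      (Filter.Eventually.of_forall fun ξ ↦ ?_)
    by_cases hmem : ξ ∈ (Metric.ball (0 : Plane d) (k / Real.pi))ᶜ
    · have hξ : k / Real.pi ≤ ‖ξ‖ := by simpa using hmem
      have hw := besselWeight_pos hk (1 / 2) ξ
      rw [Set.indicator_of_mem hmem, norm_mul, hnorm, norm_planeWave, Complex.norm_real,
        Complex.norm_real, Real.norm_of_nonneg hw.le,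
        Real.norm_of_nonneg (mul_nonneg hw.le (Real.exp_pos _).le)]
      have h1 : 1 / (2 * ‖outRoot k ξ‖) ≤ 1 / k := by
        have h2 := besselWeight_one_le_outRoot_re hk hξ
        have h3 := Complex.re_le_norm (outRoot k ξ)
        have h4 : k ≤ besselWeight k 1 ξ := by
          rw [besselWeight_one_eq]
          exact Real.le_sqrt_of_sq_le (by nlinarith [sq_nonneg (2 * Real.pi * ‖ξ‖)])
        exact one_div_le_one_div_of_le hk (by linarith)
      calc _ ≤ besselWeight k (1 / 2) ξ * (1 / k * Real.exp (-|x.2| * (outRoot k ξ).re)) := by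
            gcongr
        _ = _ := by ring
    · rw [Set.indicator_of_notMem hmem]
      simp only [mul_zero, norm_zero]
      positivity

lemma kernelTrace_eq {x : Plane d × ℝ} {w : 𝓢(Plane d, ℂ)} (hw : IsKernelTrace k Γ x w)
    {y : Plane d} (hy : y ∈ Γ) : w y = fundSol k x (y, 0) := by
  obtain ⟨ρ, ⟨-, hρ⟩, -, h⟩ := hw
  have : ρ (y, 0) = 1 := hρ.self_of_nhdsSet _ ⟨hy, rfl⟩
  rw [h, this, one_mul]

/-- Off the hyperplane, test functions act on the kernel through the plane wave representation of
the fundamental solution. -/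
lemma integral_kernelTrace_mul (hd : d = 1 ∨ d = 2) (hk : 0 < k) {x : Plane d × ℝ} (hx : x.2 ≠ 0)
    {w : 𝓢(Plane d, ℂ)} (hw : IsKernelTrace k Γ x w) {θ : 𝓢(Plane d, ℂ)}
    (hθ : θ ∈ testFunctions Γ) :
    ∫ y, w y * θ y = ∫ ξ, planeWave k x ξ / (2 * outRoot k ξ) * (𝓕 θ) ξ := by
  have hd0 : 0 < d := by omega
  have hE : Continuous fun p : Plane d × Plane d ↦
      Complex.exp (2 * Real.pi * Complex.I * (inner ℝ (x.1 - p.1) p.2 : ℝ)) := by fun_prop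
  have h1 : ∀ y, w y * θ y = ∫ ξ, θ y * (Complex.exp (2 * Real.pi * Complex.I *
      (inner ℝ (x.1 - y) ξ : ℝ)) * layerSymbol k |x.2| ξ) := by
    intro y
    by_cases hy : y ∈ tsupport θ
    · rw [kernelTrace_eq hw (hθ.2 hy), fundSol_eq_integral hd hk x hx, mul_comm,
        integral_const_mul]
    · simp [image_eq_zero_of_notMem_tsupport hy]
  have hint : Integrable (Function.uncurry fun (y ξ : Plane d) ↦
      θ y * (Complex.exp (2 * Real.pi * Complex.I * (inner ℝ (x.1 - y) ξ : ℝ)) *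
        layerSymbol k |x.2| ξ)) (volume.prod volume) := by
    have h2 : Integrable (fun p : Plane d × Plane d ↦ θ p.1 * layerSymbol k |x.2| p.2)
        (volume.prod volume) :=
      θ.integrable.mul_prod (integrable_layerSymbol hd0 hk (abs_pos.2 hx))
    refine (h2.mul_bdd (c := 1) hE.aestronglyMeasurable
      (Filter.Eventually.of_forall fun p ↦ (norm_exp_inner _ _).le)).congr
      (Filter.Eventually.of_forall fun p ↦ ?_)
    simp only [Function.uncurry]
    ring
  simp_rw [h1]
  rw [integral_integral_swap hint]
  refine integral_congr_ae (Filter.Eventually.of_forall fun ξ ↦ ?_)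
  beta_reduce
  rw [SchwartzMap.fourier_coe, Real.fourier_eq', ← integral_const_mul]
  refine integral_congr_ae (Filter.Eventually.of_forall fun y ↦ ?_)
  beta_reduce
  have h3 : Complex.exp (2 * Real.pi * Complex.I * (inner ℝ (x.1 - y) ξ : ℝ)) =
      Complex.exp (2 * Real.pi * Complex.I * (inner ℝ x.1 ξ : ℝ)) *
        Complex.exp (((-2 * Real.pi * inner ℝ y ξ : ℝ) : ℂ) * Complex.I) := by
    rw [← Complex.exp_add, inner_sub_left]
    congr 1
    push_cast
    ring
  rw [h3, planeWave, layerSymbol, smul_eq_mul]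
  ring

lemma exists_isKernelTrace (hd : d = 1 ∨ d = 2) (hk : 0 < k) (hΓ : Bornology.IsBounded Γ)
    {x : Plane d × ℝ} (hx : x.2 ≠ 0) : ∃ w, IsKernelTrace k Γ x w := by
  obtain ⟨R, hR, hΓR⟩ := hΓ.subset_closedBall_lt 0 0
  have ht : 0 < |x.2| := abs_pos.2 hx
  let f : ContDiffBump (0 : Plane d) := ⟨R + 1, R + 2, by linarith, by linarith⟩
  let η : ContDiffBump (0 : ℝ) := ⟨|x.2| / 4, |x.2| / 2, by linarith, by linarith⟩
  set ρ : Plane d × ℝ → ℂ := fun y ↦ (f y.1 : ℂ) * (η y.2 : ℂ) with hρ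
  have hρs : ContDiff ℝ ∞ ρ :=
    (Complex.ofRealCLM.contDiff.comp (f.contDiff.comp contDiff_fst)).mul
      (Complex.ofRealCLM.contDiff.comp (η.contDiff.comp contDiff_snd))
  have hsub : tsupport ρ ⊆ tsupport f ×ˢ tsupport η := by
    refine closure_minimal (fun y hy ↦ ?_) ((isClosed_tsupport _).prod (isClosed_tsupport _))
    rw [Function.mem_support, hρ] at hy
    refine ⟨subset_tsupport _ ?_, subset_tsupport _ ?_⟩
    · intro h0
      exact hy (by simp [h0])
    · intro h0
      exact hy (by simp [h0])
  have hρc : HasCompactSupport ρ :=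
    (f.hasCompactSupport.isCompact.prod η.hasCompactSupport.isCompact).of_isClosed_subset
      (isClosed_tsupport _) hsub
  have hcs : HasCompactSupport fun y : Plane d ↦ ρ (y, 0) * fundSol k x (y, 0) := by
    refine HasCompactSupport.mul_right (HasCompactSupport.intro f.hasCompactSupport fun y hy ↦ ?_)
    simp [hρ, image_eq_zero_of_notMem_tsupport hy]
  have hs : ContDiff ℝ ∞ fun y : Plane d ↦ ρ (y, 0) * fundSol k x (y, 0) :=
    (hρs.comp (by fun_prop)).mul (contDiff_fundSol hd hk x hx)
  refine ⟨hcs.toSchwartzMap hs, ρ, ⟨⟨hρs, hρc, Set.subset_univ _⟩, ?_⟩, fun hmem ↦ ?_, fun y ↦ rfl⟩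
  · have hopen : IsOpen (Metric.ball (0 : Plane d) (R + 1) ×ˢ Metric.ball (0 : ℝ) (|x.2| / 4)) :=
      Metric.isOpen_ball.prod Metric.isOpen_ball
    have hss : screen Γ ⊆ Metric.ball (0 : Plane d) (R + 1) ×ˢ Metric.ball (0 : ℝ) (|x.2| / 4) := by
      rintro ⟨y, t⟩ ⟨hy, ht0⟩
      have hy' := hΓR hy
      simp only [Set.mem_singleton_iff] at ht0
      subst ht0
      refine ⟨Metric.closedBall_subset_ball (by linarith) hy', Metric.mem_ball_self (by linarith)⟩
    filter_upwards [hopen.mem_nhdsSet.2 hss] with y hy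
    have e1 : f y.1 = 1 := f.one_of_mem_closedBall (Metric.ball_subset_closedBall hy.1)
    have e2 : η y.2 = 1 := η.one_of_mem_closedBall (Metric.ball_subset_closedBall hy.2)
    simp [hρ, e1, e2]
  · have h2 := (hsub hmem).2
    rw [η.tsupport_eq, mem_closedBall_zero_iff, Real.norm_eq_abs] at h2
    change |x.2| ≤ |x.2| / 2 at h2
    linarith

/-- The single-layer potential as a superposition of plane waves. For test functions this is the Weyl
representation, and both sides are continuous in `φ`. -/
lemma singleLayerPotential_eq (hd : d = 1 ∨ d = 2) (hk : 0 < k) (hΓ : Bornology.IsBounded Γ)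
    {φ : sobolev d k (-(1 / 2))} (hφ : φ ∈ sobolevTilde k (-(1 / 2)) Γ) {x : Plane d × ℝ}
    (hx : x.2 ≠ 0) :
    singleLayerPotential k Γ φ x = wavePotential k (layerDensity φ) x := by
  have hex := exists_isKernelTrace hd hk hΓ hx
  have hw := hex.choose_spec
  rw [singleLayerPotential, dif_pos hex]
  set w := hex.choose
  obtain ⟨u, θ, hu, hlim⟩ := exists_testFunction_seq hφ
  have hmem : ∀ n, u n ∈ sobolevTilde k (-(1 / 2)) Γ := fun n ↦
    mem_sobolevTilde_of_testFunction (hu n).1 (hu n).2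
  have t1 := (isWaveDensity_planeWave_div (k := k) (by omega) hk hx).tendsto hk hΓ hφ hmem hlim
  have t2 := tendsto_integral_mul_fourierDensity hk (q := fun ξ ↦ (𝓕⁻ w) ξ)
    (by simpa using memLp_besselWeight_mul hk (1 / 2) (𝓕⁻ w)) hlim
  have e : ∀ n, ∫ ξ, (𝓕⁻ w) ξ * fourierDensity (u n) ξ =
      ∫ ξ, planeWave k x ξ / (2 * outRoot k ξ) * fourierDensity (u n) ξ := by
    intro n
    have h1 : ∫ ξ, (𝓕⁻ w) ξ * fourierDensity (u n) ξ = (u n : 𝓢'(Plane d, ℂ)) w := by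
      rw [sobolev_apply hk]
      simp_rw [mul_comm]
    rw [h1, (hu n).2, SchwartzMap.toTemperedDistributionCLM_apply_apply (volume : Measure (Plane d))]
    simp only [smul_eq_mul]
    rw [integral_kernelTrace_mul hd hk hx hw (hu n).1]
    refine integral_congr_ae ?_
    filter_upwards [fourierDensity_schwartz hk (u n) (θ n) (hu n).2] with ξ hξ
    rw [hξ]
  simp_rw [e] at t2
  have h2 := tendsto_nhds_unique t2 t1
  rw [sobolev_apply hk, wavePotential]
  calc ∫ ξ, fourierDensity φ ξ * (𝓕⁻ w) ξ = ∫ ξ, (𝓕⁻ w) ξ * fourierDensity φ ξ := by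
        simp_rw [mul_comm]
    _ = _ := h2
    _ = _ := by
        refine integral_congr_ae (Filter.Eventually.of_forall fun ξ ↦ ?_)
        simp only [layerDensity]
        ring

end

/-! ### The single-layer operator and its sesquilinear form -/

section
variable {d : ℕ} {k : ℝ} {Γ : Set (Plane d)}

lemma IsCutoff.exists_boundary {χ : Plane d × ℝ → ℂ} (hχ : IsCutoff Γ χ) :
    ∃ χ₀ : 𝓢(Plane d, ℂ), (∀ y, χ₀ y = χ (y, 0)) ∧ ∀ y ∈ Γ, χ₀ y = 1 := by
  obtain ⟨⟨hs, hc, -⟩, h1⟩ := hχ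
  have hemb : Topology.IsClosedEmbedding fun y : Plane d ↦ (y, (0 : ℝ)) :=
    ⟨isEmbedding_prodMkLeft 0, by
      have : Set.range (fun y : Plane d ↦ (y, (0 : ℝ))) = Set.univ ×ˢ {0} := by
        ext ⟨a, b⟩; simp [eq_comm]
      rw [this]; exact isClosed_univ.prod isClosed_singleton⟩
  have hs0 : ContDiff ℝ ∞ fun y : Plane d ↦ χ (y, 0) := hs.comp (by fun_prop)
  refine ⟨(hc.comp_isClosedEmbedding hemb).toSchwartzMap hs0, fun y ↦ rfl, fun y hy ↦ ?_⟩
  exact h1.self_of_nhdsSet _ ⟨hy, rfl⟩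

lemma smulLeftCLM_eq_self {χ ψ : 𝓢(Plane d, ℂ)} (hχ : ∀ y ∈ Γ, χ y = 1)
    (hψ : ψ ∈ testFunctions Γ) : SchwartzMap.smulLeftCLM ℂ χ ψ = ψ := by
  ext y
  rw [SchwartzMap.smulLeftCLM_apply_apply χ.hasTemperateGrowth]
  by_cases hy : y ∈ tsupport ψ
  · rw [hχ y (hψ.2 hy), one_smul]
  · rw [image_eq_zero_of_notMem_tsupport hy, smul_zero]

/-- The distribution with Fourier transform `b`, multiplied by a Schwartz function, is in `H^{1/2}`:
at low frequencies the weight is bounded. -/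
lemma IsWaveDensity.exists_sobolev (hk : 0 < k) {b : Plane d → ℂ}
    (hb : IsWaveDensity k (1 / 2) b) (χ : 𝓢(Plane d, ℂ)) :
    ∃ g : sobolev d k (1 / 2), ∀ w : 𝓢(Plane d, ℂ), (g : 𝓢'(Plane d, ℂ)) w =
      ∫ ξ, b ξ * (𝓕⁻ (SchwartzMap.smulLeftCLM ℂ χ w)) ξ := by
  have hpi := Real.pi_pos
  have h1 : Integrable (fun ξ ↦ (besselWeight k (1 / 2) ξ : ℂ) *
      (Metric.ball (0 : Plane d) (k / Real.pi)).indicator b ξ) := by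
    obtain ⟨M, hM⟩ := (isCompact_closedBall (0 : Plane d) (k / Real.pi)).exists_bound_of_continuousOn
      (continuous_besselWeight hk (1 / 2)).continuousOn
    refine (hb.low.norm.const_mul M).mono' ?_ (Filter.Eventually.of_forall fun ξ ↦ ?_)
    · exact (Complex.continuous_ofReal.comp
        (continuous_besselWeight hk (1 / 2))).aestronglyMeasurable.mul hb.low.1
    · rw [norm_mul, Complex.norm_real]
      by_cases hξ : ξ ∈ Metric.ball (0 : Plane d) (k / Real.pi)
      · gcongr
        exact hM ξ (Metric.ball_subset_closedBall hξ)
      · rw [Set.indicator_of_notMem hξ]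
        simp
  obtain ⟨g, hg⟩ := exists_sobolev_mul hk h1 hb.high χ
  refine ⟨g, fun w ↦ ?_⟩
  rw [hg]
  simp_rw [IsWaveDensity.indicator_add]

/-- The traces of the localized single-layer potential from both sides. -/
lemma exists_hasTrace_singleLayer (hd : d = 1 ∨ d = 2) (hk : 0 < k) (hΓ : Bornology.IsBounded Γ)
    {φ : sobolev d k (-(1 / 2))} (hφ : φ ∈ sobolevTilde k (-(1 / 2)) Γ)
    {χ : Plane d × ℝ → ℂ} (hχ : IsCutoff Γ χ) (σ : ℤˣ) :
    ∃ g : sobolev d k (1 / 2), HasTrace σ (fun x ↦ χ x * singleLayerPotential k Γ φ x) g ∧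
      ∀ ψ ∈ testFunctions Γ, (g : 𝓢'(Plane d, ℂ)) ψ = ∫ ξ, layerDensity φ ξ * (𝓕⁻ ψ) ξ := by
  have hb := isWaveDensity_layerDensity (by omega) hk hΓ hφ
  obtain ⟨χ₀, hχ₀, hχ1⟩ := hχ.exists_boundary
  obtain ⟨g, hg⟩ := hb.exists_sobolev hk χ₀
  refine ⟨g, hasTrace_mul_wavePotential hk hb σ hχ.1
    (fun x hx ↦ by rw [singleLayerPotential_eq hd hk hΓ hφ hx]) fun w w' hw' ↦ ?_, fun ψ hψ ↦ ?_⟩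
  · have : SchwartzMap.smulLeftCLM ℂ χ₀ w = w' := by
      ext y
      rw [SchwartzMap.smulLeftCLM_apply_apply χ₀.hasTemperateGrowth, hw', hχ₀, smul_eq_mul]
    rw [hg, this]
  · rw [hg, smulLeftCLM_eq_self hχ1 hψ]

lemma exists_isCutoff (hd : d = 1 ∨ d = 2) (hΓ : Bornology.IsBounded Γ) :
    ∃ χ : Plane d × ℝ → ℂ, IsCutoff Γ χ := by
  obtain ⟨-, ρ, hρ, -⟩ := exists_isKernelTrace hd one_pos hΓ (x := (0, 1)) one_ne_zero
  exact ⟨ρ, hρ⟩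

/-- On `Γ` the boundary values of the localized single-layer potential depend neither on the side nor
on the cutoff, so that the trace for one choice is an extension for all. -/
lemma exists_extendsSingleLayer (hd : d = 1 ∨ d = 2) (hk : 0 < k) (hΓ : Bornology.IsBounded Γ)
    {φ : sobolev d k (-(1 / 2))} (hφ : φ ∈ sobolevTilde k (-(1 / 2)) Γ) :
    ∃ U : sobolev d k (1 / 2), ExtendsSingleLayer k Γ φ U := by
  obtain ⟨χ, hχ⟩ := exists_isCutoff hd hΓ
  obtain ⟨U, -, hU⟩ := exists_hasTrace_singleLayer hd hk hΓ hφ hχ 1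
  refine ⟨U, fun σ χ' hχ' ↦ ?_⟩
  obtain ⟨g, hg, hg'⟩ := exists_hasTrace_singleLayer hd hk hΓ hφ hχ' σ
  exact ⟨g, hg, fun ψ hψ ↦ by rw [hU ψ hψ, hg' ψ hψ]⟩

/-- Every extension of `S_k φ` agrees on `Γ` with the distribution whose Fourier transform is
`φ̂ / (2μ)`, by uniqueness of traces. -/
lemma ExtendsSingleLayer.apply_eq (hd : d = 1 ∨ d = 2) (hk : 0 < k) (hΓ : Bornology.IsBounded Γ)
    {φ : sobolev d k (-(1 / 2))} (hφ : φ ∈ sobolevTilde k (-(1 / 2)) Γ)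
    {U : sobolev d k (1 / 2)} (hU : ExtendsSingleLayer k Γ φ U) {ψ : 𝓢(Plane d, ℂ)}
    (hψ : ψ ∈ testFunctions Γ) :
    (U : 𝓢'(Plane d, ℂ)) ψ = ∫ ξ, layerDensity φ ξ * (𝓕⁻ ψ) ξ := by
  obtain ⟨χ, hχ⟩ := exists_isCutoff hd hΓ
  obtain ⟨g, hg, hUg⟩ := hU 1 χ hχ
  obtain ⟨g', hg', hg''⟩ := exists_hasTrace_singleLayer hd hk hΓ hφ hχ 1
  rw [hUg ψ hψ, hg.unique hg' hψ.1, hg'' ψ hψ]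

lemma exists_conj_testFunction {θ : 𝓢(Plane d, ℂ)} (hθ : θ ∈ testFunctions Γ) :
    ∃ θ' ∈ testFunctions Γ, ∀ ξ, (𝓕⁻ θ') ξ = starRingEnd ℂ ((𝓕 θ) ξ) := by
  have hc : HasCompactSupport fun y ↦ starRingEnd ℂ (θ y) :=
    hθ.1.comp_left (g := starRingEnd ℂ) (map_zero _)
  have hs : ContDiff ℝ ∞ fun y ↦ starRingEnd ℂ (θ y) :=
    Complex.conjCLE.contDiff.comp (θ.smooth ⊤)
  have hsub : tsupport (fun y ↦ starRingEnd ℂ (θ y)) ⊆ Γ :=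
    (tsupport_comp_subset (g := starRingEnd ℂ) (map_zero _) θ).trans hθ.2
  set θ' : 𝓢(Plane d, ℂ) := hc.toSchwartzMap hs with hθ'
  have hval : ∀ y, θ' y = starRingEnd ℂ (θ y) := fun y ↦ rfl
  refine ⟨θ', ⟨hc, hsub⟩, fun ξ ↦ ?_⟩
  rw [SchwartzMap.fourierInv_coe, SchwartzMap.fourier_coe, Real.fourierInv_eq', Real.fourier_eq',
    ← integral_conj]
  refine integral_congr_ae (Filter.Eventually.of_forall fun y ↦ ?_)
  beta_reduce
  rw [hval, smul_eq_mul, smul_eq_mul, map_mul, ← Complex.exp_conj, map_mul, Complex.conj_ofReal,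
    Complex.conj_I]
  congr 2
  push_cast
  ring

lemma IsWaveDensity.conj {s : ℝ} {b : Plane d → ℂ} (hb : IsWaveDensity k s b) :
    IsWaveDensity k s (fun ξ ↦ starRingEnd ℂ (b ξ)) := by
  have e : ∀ S : Set (Plane d), S.indicator (fun ξ ↦ starRingEnd ℂ (b ξ)) =
      fun ξ ↦ starRingEnd ℂ (S.indicator b ξ) := fun S ↦
    Set.indicator_comp_of_zero (g := starRingEnd ℂ) (map_zero _)
  constructor
  · rw [e]
    exact hb.low.mono (Complex.continuous_conj.comp_aestronglyMeasurable hb.low.1)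
      (Filter.Eventually.of_forall fun ξ ↦ (RCLike.norm_conj _).le)
  · rw [e]
    refine hb.high.mono ((Complex.continuous_conj.comp_aestronglyMeasurable hb.high.1).congr
      (Filter.Eventually.of_forall fun ξ ↦ ?_)) (Filter.Eventually.of_forall fun ξ ↦ ?_)
    · simp
    · simp

/-- The form `∫ φ̂ conj(ψ̂) / (2μ)`, which represents `⟨S_k φ, ψ⟩` on the Fourier side. -/
noncomputable def layerForm {s s' : ℝ} (φ : sobolev d k s) (ψ : sobolev d k s') : ℂ :=
  ∫ ξ, layerDensity φ ξ * starRingEnd ℂ (fourierDensity ψ ξ)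

lemma layerForm_eq_conj {s s' : ℝ} (φ : sobolev d k s) (ψ : sobolev d k s') :
    layerForm φ ψ =
      starRingEnd ℂ (∫ ξ, starRingEnd ℂ (layerDensity φ ξ) * fourierDensity ψ ξ) := by
  rw [layerForm, ← integral_conj]
  simp

lemma integrable_layerForm (hd : 0 < d) (hk : 0 < k) (hΓ : Bornology.IsBounded Γ)
    {φ ψ : sobolev d k (-(1 / 2))} (hφ : φ ∈ sobolevTilde k (-(1 / 2)) Γ)
    (hψ : ψ ∈ sobolevTilde k (-(1 / 2)) Γ) :
    Integrable fun ξ ↦ layerDensity φ ξ * starRingEnd ℂ (fourierDensity ψ ξ) := by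
  obtain ⟨C, hC⟩ := (isWaveDensity_layerDensity hd hk hΓ hφ).conj.exists_bound hk hΓ
  have h := (hC ψ hψ).1
  refine h.mono ((Complex.continuous_conj.comp_aestronglyMeasurable h.1).congr
    (Filter.Eventually.of_forall fun ξ ↦ ?_)) (Filter.Eventually.of_forall fun ξ ↦ ?_)
  · simp
  · simp

/-- Both sides are continuous in `ψ`, which may therefore be a test function; then `conj ψ` is a test
function on `Γ` as well, and the pairing is the value of `U` at `conj ψ`. -/
lemma ExtendsSingleLayer.dualPairing_eq (hd : d = 1 ∨ d = 2) (hk : 0 < k)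
    (hΓ : Bornology.IsBounded Γ) {φ ψ : sobolev d k (-(1 / 2))}
    (hφ : φ ∈ sobolevTilde k (-(1 / 2)) Γ) (hψ : ψ ∈ sobolevTilde k (-(1 / 2)) Γ)
    {U : sobolev d k (1 / 2)} (hU : ExtendsSingleLayer k Γ φ U) :
    dualPairing U ψ = layerForm φ ψ := by
  obtain ⟨u, θ, hu, hlim⟩ := exists_testFunction_seq hψ
  have hmem : ∀ n, u n ∈ sobolevTilde k (-(1 / 2)) Γ := fun n ↦
    mem_sobolevTilde_of_testFunction (hu n).1 (hu n).2
  have e : ∀ n, dualPairing U (u n) = layerForm φ (u n) := by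
    intro n
    obtain ⟨θ', hθ', hF⟩ := exists_conj_testFunction (hu n).1
    have hae := fourierDensity_schwartz hk (u n) (θ n) (hu n).2
    have h1 := hU.apply_eq hd hk hΓ hφ hθ'
    rw [sobolev_apply hk] at h1
    simp_rw [hF] at h1
    rw [dualPairing_eq_integral hk, layerForm]
    calc _ = ∫ ξ, fourierDensity U ξ * starRingEnd ℂ ((𝓕 (θ n)) ξ) := by
          refine integral_congr_ae ?_
          filter_upwards [hae] with ξ hξ
          rw [hξ]
      _ = _ := h1
      _ = _ := by
          refine integral_congr_ae ?_
          filter_upwards [hae] with ξ hξ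
          rw [hξ]
  have t1 : Filter.Tendsto (fun n ↦ dualPairing U (u n)) Filter.atTop (𝓝 (dualPairing U ψ)) := by
    have hrep : Filter.Tendsto (fun n ↦ sobolevRep (u n)) Filter.atTop (𝓝 (sobolevRep ψ)) := by
      rw [tendsto_iff_norm_sub_tendsto_zero]
      refine hlim.congr fun n ↦ ?_
      rw [sobolevNorm, map_sub, norm_sub_rev]
    exact hrep.inner tendsto_const_nhds
  have t2 : Filter.Tendsto (fun n ↦ layerForm φ (u n)) Filter.atTop (𝓝 (layerForm φ ψ)) := by
    simp_rw [layerForm_eq_conj]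
    exact (Complex.continuous_conj.tendsto _).comp
      ((isWaveDensity_layerDensity (by omega) hk hΓ hφ).conj.tendsto hk hΓ hψ hmem hlim)
  simp_rw [e] at t1
  exact tendsto_nhds_unique t1 t2

/-- The sesquilinear form of the single-layer operator. -/
noncomputable def singleLayerForm (hd : 0 < d) (hk : 0 < k) (hΓ : Bornology.IsBounded Γ) :
    sobolevTilde k (-(1 / 2)) Γ →ₗ[ℂ] sobolevTilde k (-(1 / 2)) Γ →ₗ⋆[ℂ] ℂ :=
  LinearMap.mk₂'ₛₗ (RingHom.id ℂ) (starRingEnd ℂ) (fun φ ψ ↦ layerForm φ.1 ψ.1)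
    (fun φ φ' ψ ↦ by
      rw [layerForm, layerForm, layerForm, ← integral_add
        (integrable_layerForm hd hk hΓ φ.2 ψ.2) (integrable_layerForm hd hk hΓ φ'.2 ψ.2)]
      refine integral_congr_ae ?_
      filter_upwards [fourierDensity_add φ.1 φ'.1] with ξ hξ
      simp only [layerDensity, Submodule.coe_add, hξ]
      ring)
    (fun c φ ψ ↦ by
      rw [layerForm, layerForm, smul_eq_mul, ← integral_const_mul]
      refine integral_congr_ae ?_
      filter_upwards [fourierDensity_smul c φ.1] with ξ hξ
      simp only [layerDensity, Submodule.coe_smul, hξ, RingHom.id_apply]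
      ring)
    (fun φ ψ ψ' ↦ by
      rw [layerForm, layerForm, layerForm, ← integral_add
        (integrable_layerForm hd hk hΓ φ.2 ψ.2) (integrable_layerForm hd hk hΓ φ.2 ψ'.2)]
      refine integral_congr_ae ?_
      filter_upwards [fourierDensity_add ψ.1 ψ'.1] with ξ hξ
      simp only [Submodule.coe_add, hξ, map_add]
      ring)
    (fun c φ ψ ↦ by
      rw [layerForm, layerForm, smul_eq_mul, ← integral_const_mul]
      refine integral_congr_ae ?_
      filter_upwards [fourierDensity_smul c ψ.1] with ξ hξ
      simp only [Submodule.coe_smul, hξ, map_mul]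
      ring)

/-- The symbol `1/(2μ)` takes values in the positive real half-axis outside, and in the positive
imaginary half-axis inside the sphere `2π|ξ| = k`; so real and imaginary part never cancel. -/
lemma besselWeight_le_re_add_im (hk : 0 < k) {ξ : Plane d} (hξ : (2 * Real.pi * ‖ξ‖) ^ 2 ≠ k ^ 2) :
    1 / 2 * besselWeight k (-1) ξ ≤
      (1 / (2 * outRoot k ξ)).re + (1 / (2 * outRoot k ξ)).im := by
  set a := (2 * Real.pi * ‖ξ‖) ^ 2 with ha
  have ha0 : 0 ≤ a := by positivity
  have hw : besselWeight k (-1) ξ = 1 / √(k ^ 2 + a) := by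
    have h1 := besselWeight_pos hk 1 ξ
    rw [ha, ← besselWeight_one_eq, eq_div_iff h1.ne', besselWeight_neg_mul hk]
  rw [hw, outRoot, ← ha]
  rcases lt_or_gt_of_ne hξ with h | h
  · have hr : 0 < √(k ^ 2 - a) := Real.sqrt_pos.2 (sub_pos.2 h)
    rw [Real.sqrt_eq_zero_of_nonpos (sub_nonpos.2 h.le)]
    have e : (1 : ℂ) / (2 * (((0 : ℝ) : ℂ) - Complex.I * (√(k ^ 2 - a) : ℂ))) =
        ((1 / 2 * (1 / √(k ^ 2 - a)) : ℝ) : ℂ) * Complex.I := by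
      have hr' : (√(k ^ 2 - a) : ℂ) ≠ 0 := by exact_mod_cast hr.ne'
      push_cast
      have hI := Complex.I_ne_zero
      field_simp
      linear_combination (√(k ^ 2 - a) : ℂ) * Complex.I_sq
    rw [e, Complex.re_ofReal_mul, Complex.im_ofReal_mul, Complex.I_re, Complex.I_im, mul_zero,
      zero_add, mul_one]
    gcongr
    linarith
  · have hr : 0 < √(a - k ^ 2) := Real.sqrt_pos.2 (sub_pos.2 h)
    rw [Real.sqrt_eq_zero_of_nonpos (sub_nonpos.2 h.le)]
    have e : (1 : ℂ) / (2 * ((√(a - k ^ 2) : ℂ) - Complex.I * ((0 : ℝ) : ℂ))) =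
        ((1 / 2 * (1 / √(a - k ^ 2)) : ℝ) : ℂ) := by
      push_cast
      rw [mul_zero, sub_zero, one_div_mul_one_div]
    rw [e, Complex.ofReal_re, Complex.ofReal_im, add_zero]
    gcongr
    linarith [sq_nonneg k]

/-- Coercivity of the form, from `Re z + Im z ≤ √2 |z|` and the pointwise bound for the symbol. -/
lemma sobolevNorm_sq_le_layerForm (hd : 0 < d) (hk : 0 < k) (hΓ : Bornology.IsBounded Γ)
    {φ : sobolev d k (-(1 / 2))} (hφ : φ ∈ sobolevTilde k (-(1 / 2)) Γ) :
    1 / (2 * √2) * sobolevNorm φ ^ 2 ≤ ‖layerForm φ φ‖ := by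
  have hint := integrable_layerForm hd hk hΓ hφ hφ
  set z := layerForm φ φ with hz
  have h1 : z.re + z.im = ∫ ξ, ((layerDensity φ ξ * starRingEnd ℂ (fourierDensity φ ξ)).re +
      (layerDensity φ ξ * starRingEnd ℂ (fourierDensity φ ξ)).im) :=
    ((Complex.reCLM + Complex.imCLM).integral_comp_comm hint).symm
  have hnorm : Integrable fun ξ ↦ besselWeight k (2 * -(1 / 2)) ξ * ‖fourierDensity φ ξ‖ ^ 2 := by
    have h := memLp_fourierDensity hk φ
    rw [memLp_two_iff_integrable_sq_norm h.1] at h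
    refine h.congr (Filter.Eventually.of_forall fun ξ ↦ ?_)
    simp only [norm_mul, Complex.norm_real]
    rw [Real.norm_of_nonneg (besselWeight_pos hk _ _).le, mul_pow, two_mul, ← besselWeight_mul hk,
      sq (besselWeight _ _ _)]
  have h2 : 1 / 2 * sobolevNorm φ ^ 2 ≤ z.re + z.im := by
    rw [h1, sobolevNorm_sq hk, ← integral_const_mul]
    refine integral_mono_ae (hnorm.const_mul _) (hint.re.add hint.im) ?_
    filter_upwards [ae_outRoot_ne_zero hd hk] with ξ hξ
    have e : layerDensity φ ξ * starRingEnd ℂ (fourierDensity φ ξ) =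
        ((‖fourierDensity φ ξ‖ ^ 2 : ℝ) : ℂ) * (1 / (2 * outRoot k ξ)) := by
      rw [layerDensity, div_mul_eq_mul_div, Complex.mul_conj, Complex.normSq_eq_norm_sq]
      ring
    rw [e, Complex.re_ofReal_mul, Complex.im_ofReal_mul, ← mul_add, ← mul_assoc, mul_comm]
    gcongr
    have := besselWeight_le_re_add_im hk hξ
    norm_num at this ⊢
    exact this
  have h3 : z.re + z.im ≤ √2 * ‖z‖ := by
    have h4 : (z.re + z.im) ^ 2 ≤ (√2 * ‖z‖) ^ 2 := by
      rw [mul_pow, Real.sq_sqrt zero_le_two, Complex.sq_norm, Complex.normSq_apply]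
      nlinarith [sq_nonneg (z.re - z.im)]
    exact le_of_sq_le_sq h4 (by positivity)
  have hs : 0 < √2 := by positivity
  rw [one_div_mul_eq_div, div_le_iff₀ (by positivity)]
  linarith

end

theorem theorem5p3 {d : ℕ} (hd : d = 1 ∨ d = 2) (Γ : Set (Plane d)) (hΓ_open : IsOpen Γ)
    (hΓ_bdd : Bornology.IsBounded Γ) (hΓ_ne : Γ.Nonempty) (k : ℝ) (hk : 0 < k) :
    ∃ a : sobolevTilde k (-(1 / 2)) Γ →ₗ[ℂ] sobolevTilde k (-(1 / 2)) Γ →ₗ⋆[ℂ] ℂ,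
      (∀ φ : sobolevTilde k (-(1 / 2)) Γ,
        (∃ U : sobolev d k (1 / 2), ExtendsSingleLayer k Γ φ.1.1 U) ∧
        ∀ U : sobolev d k (1 / 2), ExtendsSingleLayer k Γ φ.1.1 U →
          ∀ ψ : sobolevTilde k (-(1 / 2)) Γ, a φ ψ = dualPairing U ψ.1) ∧
      ∀ φ : sobolevTilde k (-(1 / 2)) Γ,
        1 / (2 * Real.sqrt 2) * sobolevNorm φ.1 ^ 2 ≤ ‖a φ φ‖ := by
  have hd0 : 0 < d := by omega
  refine ⟨singleLayerForm hd0 hk hΓ_bdd, fun φ ↦ ⟨exists_extendsSingleLayer hd hk hΓ_bdd φ.2,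
    fun U hU ψ ↦ ?_⟩, fun φ ↦ ?_⟩
  · exact (hU.dualPairing_eq hd hk hΓ_bdd φ.2 ψ.2).symm
  · exact sobolevNorm_sq_le_layerForm hd0 hk hΓ_bdd φ.2
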